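/- Let $n\ge 0$ be an integer, $T>0$ and $q\in L_2([0,T];\mathbb M_n)$, where $\mathbb M_n$ is the space of complex $n\times n$ matrices. On the triangle $\Delta_T=\{(x,t):0\le x\le t\le T\}$ there is exactly one continuous function $w:\Delta_T\to\mathbb M_n$ that is a generalized solution of the Goursat problem $$w_{tt}-w_{xx}+q(x)w=0,\qquad w(0,t)=0,\qquad w(x,x)=-\tfrac12\int_0^x q(s)\,ds,$$ in the sense that $v(\xi,\eta):=w\big(\tfrac{\eta-\xi}2,\tfrac{\eta+\xi}2\big)$ satisfies, for all $0\le\xi\le\eta$ with $\xi+\eta\le 2T$, the integral equation $$v(\xi,\eta)=-\frac12\int_{\xi/2}^{\eta/2}q(s)\,ds-\frac14\int_0^{\xi}d\xi_1\int_{\xi}^{\eta}d\eta_1\,q\Big(\frac{\eta_1-\xi_1}2\Big)v(\xi_1,\eta_1).$$ For a control $f$ on $[0,T]$, continued by zero to the negative half-line, let $$u^f_\beta(x,t)=f(t-x)+\int_x^t w(x,s)f(t-s)\,ds\qquad(0\le x\le t\le T)$$ be the solution (classical for smooth data with $f$ vanishing near $0$, generalized otherwise) of the initial-boundary value problem $u_{tt}-u_{xx}+q(x)u=0$,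 $u|_{t=0}=u_t|_{t=0}=0$, $u|_{x=0}=f$. Then the control operator $$W^T_{\rm v}:f\mapsto u^f_\beta(\cdot,T)$$ is a bounded linear operator in $L_2([0,T];\mathbb C^n)$; it maps the Sobolev space $H^2([0,T];\mathbb C^n)$ into itself, and its restriction to $H^2([0,T];\mathbb C^n)$ is an isomorphism of that space, i.e. it is bounded and bijective with bounded inverse in the $H^2$-norm $\big(\|f\|_{L_2}^2+\|f'\|_{L_2}^2+\|f''\|_{L_2}^2\big)^{1/2}$. -/

import Mathlib

open MeasureTheory Set
open scoped ContDiff Matrix.Norms.L2Operator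

/-- The space `L₂([0,T]; ℂⁿ)`. -/
abbrev L2Space (T : ℝ) (n : ℕ) : Type :=
  Lp (EuclideanSpace ℂ (Fin n)) 2 (volume.restrict (Icc (0 : ℝ) T))

/-- `g` is the weak derivative of `f` on the interval `(0,T)`, tested against all real-valued
smooth functions with compact support in `(0,T)`. -/
def IsWeakDeriv {T : ℝ} {n : ℕ} (f g : L2Space T n) : Prop :=
  ∀ φ : ℝ → ℝ, ContDiff ℝ ∞ φ → HasCompactSupport φ → tsupport φ ⊆ Ioo 0 T →
    ∫ x in Icc 0 T, deriv φ x • f x = -∫ x in Icc 0 T, φ x • g x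

theorem integrable_test_smul {T : ℝ} {n : ℕ} {ψ : ℝ → ℝ} (hψ : Continuous ψ)
    (hc : HasCompactSupport ψ) (f : L2Space T n) :
    Integrable (fun x => ψ x • f x) (volume.restrict (Icc (0 : ℝ) T)) := by
  obtain ⟨C, hC⟩ := hψ.bounded_above_of_compact_support hc
  exact ((Lp.memLp f).integrable (by norm_num)).bdd_smul C hψ.aestronglyMeasurable
    (Filter.Eventually.of_forall hC)

theorem IsWeakDeriv.add {T : ℝ} {n : ℕ} {f g f' g' : L2Space T n}
    (h : IsWeakDeriv f g) (h' : IsWeakDeriv f' g') : IsWeakDeriv (f + f') (g + g') := by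
  intro φ hφ hc hs
  have hd : Continuous (deriv φ) := hφ.continuous_deriv (by simp)
  have e1 : ∫ x in Icc 0 T, deriv φ x • (f + f' : L2Space T n) x
      = ∫ x in Icc 0 T, (deriv φ x • f x + deriv φ x • f' x) := by
    refine integral_congr_ae ?_
    filter_upwards [Lp.coeFn_add f f'] with x hx
    rw [hx, Pi.add_apply, smul_add]
  have e2 : ∫ x in Icc 0 T, φ x • (g + g' : L2Space T n) x
      = ∫ x in Icc 0 T, (φ x • g x + φ x • g' x) := by
    refine integral_congr_ae ?_
    filter_upwards [Lp.coeFn_add g g'] with x hx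
    rw [hx, Pi.add_apply, smul_add]
  rw [e1, e2, integral_add (integrable_test_smul hd hc.deriv f)
    (integrable_test_smul hd hc.deriv f'), integral_add
    (integrable_test_smul hφ.continuous hc g) (integrable_test_smul hφ.continuous hc g'),
    h φ hφ hc hs, h' φ hφ hc hs, neg_add]

theorem IsWeakDeriv.smul {T : ℝ} {n : ℕ} {f g : L2Space T n} (c : ℂ)
    (h : IsWeakDeriv f g) : IsWeakDeriv (c • f) (c • g) := by
  intro φ hφ hc hs
  have e1 : ∫ x in Icc 0 T, deriv φ x • (c • f : L2Space T n) x
      = ∫ x in Icc 0 T, c • (deriv φ x • f x) := by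
    refine integral_congr_ae ?_
    filter_upwards [Lp.coeFn_smul c f] with x hx
    rw [hx, Pi.smul_apply, smul_comm]
  have e2 : ∫ x in Icc 0 T, φ x • (c • g : L2Space T n) x
      = ∫ x in Icc 0 T, c • (φ x • g x) := by
    refine integral_congr_ae ?_
    filter_upwards [Lp.coeFn_smul c g] with x hx
    rw [hx, Pi.smul_apply, smul_comm]
  rw [e1, e2, integral_smul, integral_smul, h φ hφ hc hs, smul_neg]

theorem IsWeakDeriv.zero {T : ℝ} {n : ℕ} : IsWeakDeriv (0 : L2Space T n) 0 := by
  have h : ∀ ψ : ℝ → ℝ, ∫ x in Icc 0 T, ψ x • (0 : L2Space T n) x = 0 := by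
    intro ψ
    refine integral_eq_zero_of_ae ?_
    filter_upwards [Lp.coeFn_zero (EuclideanSpace ℂ (Fin n)) 2
      (volume.restrict (Icc (0 : ℝ) T))] with x hx
    rw [hx]
    simp
  intro φ _ _ _
  rw [h, h, neg_zero]

/-- The Sobolev space `H²([0,T]; ℂⁿ)`: a function `f ∈ L₂` with weak derivatives `f', f'' ∈ L₂`,
recorded as the triple `(f, f', f'')`. The weak derivatives are determined by `f`, and the norm
inherited from the ambient Hilbert sum is the Sobolev norm
`(‖f‖² + ‖f'‖² + ‖f''‖²)^(1/2)`. -/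
noncomputable def H2Space (T : ℝ) (n : ℕ) :
    Submodule ℂ (PiLp 2 (fun _ : Fin 3 => L2Space T n)) where
  carrier := {F | IsWeakDeriv (F 0) (F 1) ∧ IsWeakDeriv (F 1) (F 2)}
  add_mem' := fun ha hb => ⟨ha.1.add hb.1, ha.2.add hb.2⟩
  zero_mem' := ⟨IsWeakDeriv.zero, IsWeakDeriv.zero⟩
  smul_mem' := fun c _ ha => ⟨ha.1.smul c, ha.2.smul c⟩

/-- The function in `L₂([0,T]; ℂⁿ)` underlying an element of `H²([0,T]; ℂⁿ)`. -/
def h2ToL2 {T : ℝ} {n : ℕ} (F : H2Space T n) : L2Space T n := F.1 0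

/-- The triangle `0 ≤ x ≤ t ≤ T`. -/
def triangle (T : ℝ) : Set (ℝ × ℝ) := {p | 0 ≤ p.1 ∧ p.1 ≤ p.2 ∧ p.2 ≤ T}

/-- `w` is the generalized solution on the triangle `0 ≤ x ≤ t ≤ T` of the Goursat problem
`w_tt - w_xx + q w = 0`, `w(0,t) = 0`, `w(x,x) = -1/2 ∫₀ˣ q`: it is continuous, and
`v(ξ,η) = w((η-ξ)/2, (η+ξ)/2)` solves the corresponding integral equation. (The triangle is
`0 ≤ ξ ≤ η`, `ξ + η ≤ 2T` in the characteristic coordinates `ξ = t - x`, `η = t + x`.) -/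
def IsGoursatKernel {n : ℕ} (q : ℝ → Matrix (Fin n) (Fin n) ℂ) (T : ℝ)
    (w : ℝ → ℝ → Matrix (Fin n) (Fin n) ℂ) : Prop :=
  ContinuousOn (fun p : ℝ × ℝ => w p.1 p.2) (triangle T) ∧
  ∀ ξ η : ℝ, 0 ≤ ξ → ξ ≤ η → ξ + η ≤ 2 * T →
    w ((η - ξ) / 2) ((η + ξ) / 2) =
      -((1 / 2 : ℝ) • ∫ s in (ξ / 2)..(η / 2), q s)
      - (1 / 4 : ℝ) • ∫ ξ₁ in (0 : ℝ)..ξ, ∫ η₁ in ξ..η,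
          q ((η₁ - ξ₁) / 2) * w ((η₁ - ξ₁) / 2) ((η₁ + ξ₁) / 2)

/-- The solution `u(x,t) = f(t - x) + ∫ₓᵗ w(x,s) f(t - s) ds` of the initial-boundary value
problem with boundary control `f`, where `f` is continued by zero to the negative half-line and
the integral is zero for `x ≥ t`. -/
noncomputable def wave {n : ℕ} (w : ℝ → ℝ → Matrix (Fin n) (Fin n) ℂ)
    (f : ℝ → EuclideanSpace ℂ (Fin n)) (x t : ℝ) : EuclideanSpace ℂ (Fin n) :=
  (Ici (0 : ℝ)).indicator f (t - x) +
    ∫ s in Ioc x t,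
      Matrix.toEuclideanCLM (n := Fin n) (𝕜 := ℂ) (w x s) ((Ici (0 : ℝ)).indicator f (t - s))

/-! In `C(triangle T, B)` the Goursat equation reads `(1 + K) w = source`, with `K` a Volterra
operator. Slicing the characteristic rectangle at fixed space variable `y` gives the form `∫ q(y) ∫
w(y,s) ds dy`: the singular factor `q` depends on `y` alone, and the inner integral runs over times
`s ≤ t`. Hence `K^k` is bounded by `(‖q‖₁ t)^k / k!` (`norm_goursatOp_pow_apply_le`), a power of `K`
is small, and `1 + K` is invertible. This is existence and uniqueness of `w` at once.

The control operator is `W = (1 + V) R`, where `R` is the reflection `f ↦ f(T - ·)` and `V` the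
Volterra operator with the bounded kernel `w`. Factorial bounds for the powers of `V` make `1 + V`
invertible, and `R` is an involution, so `W` is bijective in `L₂`.

The core is the regularity of `V R f`. As `q` is only in `L₂`, the kernel cannot be differentiated
twice directly. Instead the Goursat equation is read as a Duhamel formula: with `Y` the response to
a unit step, `w(x,s) = -1/2 ∫ q(y) [Y(y, s-|x-y|) - Y(y, s-x-y)] dy`. Convolution with `f` yields `V
R f (x) = -1/2 ∫ q(y) [u(y, T-|x-y|) - u(y, T-x-y)] dy`, where `u` is the wave of the primitive of
`f` (`integral_kernel_eq_retardedDiff`). Now `x` occurs only in the time argument of a wave. One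
`x`-derivative costs one time derivative, which undoes the primitive; so `V R` maps `L₂` into `H¹`.
If `f = c + ∫ g`, the wave of `f` is a step plus a time primitive `P`, and a second derivative can
be taken: the sign change at `y = x` produces a multiple of `q(x) P(x,T)`, and the step produces
values of `q c` at `x` and `(T ± x)/2`. All of these are in `L₂` because `q` is. So `V R` maps `H¹`
into `H²`.

Therefore `W` preserves `H²`. Conversely, if `W f ∈ H²`, then `R f = W f - V R f` gives `f ∈ H¹`,
and used once more gives `f ∈ H²`. The restriction is thus a bijection of the Hilbert space `H²`;
the closed graph and open mapping theorems supply both bounds. -/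

/-! ### Inverting `1 ± a` when the powers of `a` decay factorially. -/

theorem isUnit_one_sub_of_norm_pow_le {R : Type*} [NormedRing R] [CompleteSpace R] {a : R}
    {C D : ℝ} (h : ∀ k : ℕ, ‖a ^ (k + 1)‖ ≤ C * (D ^ k / k.factorial)) : IsUnit (1 - a) := by
  have ht : Filter.Tendsto (fun k : ℕ => C * (D ^ k / k.factorial)) Filter.atTop (nhds 0) := by
    simpa using (FloorSemiring.tendsto_pow_div_factorial_atTop D).const_mul C
  obtain ⟨k, hk⟩ := (ht.eventually (gt_mem_nhds one_pos)).exists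
  have hu : IsUnit (1 - a ^ (k + 1)) := isUnit_one_sub_of_norm_lt_one ((h k).trans_lt hk)
  -- `1 - a^(k+1)` is `1 - a` times a geometric sum that commutes with it, and a commuting product
  -- is a unit only if both factors are.
  rw [← mul_neg_geom_sum] at hu
  refine ((Commute.isUnit_mul_iff ?_).1 hu).1
  exact (Commute.sum_right _ _ _ fun i _ =>
    ((Commute.one_left _).sub_left ((Commute.refl a).pow_right i)))

theorem isUnit_one_add_of_norm_pow_le {R : Type*} [NormedRing R] [CompleteSpace R] {a : R}
    {C D : ℝ} (h : ∀ k : ℕ, ‖a ^ (k + 1)‖ ≤ C * (D ^ k / k.factorial)) : IsUnit (1 + a) := by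
  rw [← sub_neg_eq_add]
  refine isUnit_one_sub_of_norm_pow_le (C := C) (D := D) fun k => ?_
  rcases Nat.even_or_odd (k + 1) with hk | hk
  · rw [hk.neg_pow]
    exact h k
  · rw [hk.neg_pow, norm_neg]
    exact h k

/-! ### The triangle and its retraction. -/

/-- The retraction of the plane onto the triangle `0 ≤ x ≤ t ≤ T`. -/
noncomputable def triProj (T : ℝ) (p : ℝ × ℝ) : ℝ × ℝ :=
  (max 0 (min p.1 (max 0 (min p.2 T))), max 0 (min p.2 T))

theorem triProj_mem {T : ℝ} (hT : 0 ≤ T) (p : ℝ × ℝ) : triProj T p ∈ triangle T := by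
  refine ⟨le_max_left _ _, ?_, ?_⟩
  · exact max_le (le_max_left _ _) (min_le_right _ _)
  · exact max_le hT (min_le_right _ _)

theorem triProj_of_mem {T : ℝ} {p : ℝ × ℝ} (hp : p ∈ triangle T) : triProj T p = p := by
  obtain ⟨h1, h2, h3⟩ := hp
  have h4 : max 0 (min p.2 T) = p.2 := by
    rw [min_eq_left h3, max_eq_right (h1.trans h2)]
  unfold triProj
  rw [h4, min_eq_left h2, max_eq_right h1]

theorem continuous_triProj (T : ℝ) : Continuous (triProj T) := by
  unfold triProj
  fun_prop

theorem isCompact_triangle (T : ℝ) : IsCompact (triangle T) := by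
  have hc : IsClosed (triangle T) := by
    have : triangle T = {p : ℝ × ℝ | 0 ≤ p.1} ∩ {p | p.1 ≤ p.2} ∩ {p | p.2 ≤ T} := by
      ext p; simp [triangle, and_assoc]
    rw [this]
    exact ((isClosed_le continuous_const continuous_fst).inter
      (isClosed_le continuous_fst continuous_snd)).inter
      (isClosed_le continuous_snd continuous_const)
  refine (isCompact_Icc (a := ((0 : ℝ), (0 : ℝ))) (b := (T, T))).of_isClosed_subset hc ?_
  rintro p ⟨h1, h2, h3⟩
  exact ⟨⟨h1, h1.trans h2⟩, ⟨h2.trans h3, h3⟩⟩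

instance (T : ℝ) : CompactSpace (triangle T) :=
  isCompact_iff_compactSpace.1 (isCompact_triangle T)

/-! ### Integration of the kernel in time. -/

section TimeIntegral

variable {B : Type*} [NormedAddCommGroup B] [NormedSpace ℝ B]

/-- The integral of `w y` from the front `s = y` up to time `τ`, zero before the front. -/
noncomputable def timeIntegral (w : ℝ → ℝ → B) (y τ : ℝ) : B := ∫ s in y..max y τ, w y s

theorem timeIntegral_of_le (w : ℝ → ℝ → B) {y τ : ℝ} (h : τ ≤ y) : timeIntegral w y τ = 0 := by
  simp [timeIntegral, max_eq_left h]

theorem timeIntegral_of_ge (w : ℝ → ℝ → B) {y τ : ℝ} (h : y ≤ τ) :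
    timeIntegral w y τ = ∫ s in y..τ, w y s := by
  simp [timeIntegral, max_eq_right h]

theorem continuous_timeIntegral {w : ℝ → ℝ → B} (hw : Continuous (Function.uncurry w)) :
    Continuous (Function.uncurry (timeIntegral w)) := by
  have h0 : ∀ y : ℝ, ∀ a b, IntervalIntegrable (w y) volume a b := fun y a b =>
    (hw.comp (Continuous.prodMk_right y)).intervalIntegrable a b
  have : Function.uncurry (timeIntegral w) = fun p : ℝ × ℝ =>
      (∫ s in (0 : ℝ)..max p.1 p.2, w p.1 s) - ∫ s in (0 : ℝ)..p.1, w p.1 s := by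
    ext p
    simp only [Function.uncurry, timeIntegral]
    rw [intervalIntegral.integral_interval_sub_left (h0 _ _ _) (h0 _ _ _)]
  rw [this]
  have hw' : Continuous (Function.uncurry fun (p : ℝ × ℝ) (s : ℝ) => w p.1 s) :=
    hw.comp (by fun_prop : Continuous fun z : (ℝ × ℝ) × ℝ => (z.1.1, z.2))
  refine Continuous.sub ?_ ?_
  · exact intervalIntegral.continuous_parametric_intervalIntegral_of_continuous hw' (by fun_prop)
  · exact intervalIntegral.continuous_parametric_intervalIntegral_of_continuous hw' (by fun_prop)

theorem timeIntegral_sub {w : ℝ → ℝ → B} (hw : Continuous (Function.uncurry w)) {y a b : ℝ}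
    (hab : a ≤ b) :
    timeIntegral w y b - timeIntegral w y a = ∫ s in Ioc (max y a) b, w y s := by
  have h0 : ∀ a b, IntervalIntegrable (w y) volume a b := fun a b =>
    (hw.comp (Continuous.prodMk_right y)).intervalIntegrable a b
  unfold timeIntegral
  rw [intervalIntegral.integral_interval_sub_left (h0 _ _) (h0 _ _),
    intervalIntegral.integral_of_le (max_le_max le_rfl hab)]
  congr 2
  ext s
  simp only [mem_Ioc, max_lt_iff, le_max_iff]
  constructor
  · rintro ⟨⟨h1, h2⟩, h3 | h3⟩
    · linarith
    · exact ⟨⟨h1, h2⟩, h3⟩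
  · rintro ⟨h1, h2⟩
    exact ⟨h1, Or.inr h2⟩

theorem norm_timeIntegral_le {w : ℝ → ℝ → B} {C : ℝ} (hC : ∀ x t, ‖w x t‖ ≤ C) (y τ : ℝ) :
    ‖timeIntegral w y τ‖ ≤ C * max 0 (τ - y) := by
  have h := intervalIntegral.norm_integral_le_of_norm_le_const (a := y) (b := max y τ)
    (f := w y) (C := C) (fun s _ => hC y s)
  refine h.trans (le_of_eq ?_)
  rw [abs_of_nonneg (sub_nonneg.2 (le_max_left _ _)), ← max_sub_sub_right, sub_self]

end TimeIntegral

/-! ### The characteristic rectangle in space-time coordinates. -/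

section Goursat

variable {B : Type*} [NormedRing B] [NormedAlgebra ℝ B]

/-- The integral of `q w` over the characteristic rectangle of the Goursat problem, sliced by the
space variable. -/
noncomputable def goursatInt (q : ℝ → B) (w : ℝ → ℝ → B) (x t : ℝ) : B :=
  ∫ y, q y * (timeIntegral w y (t - |x - y|) - timeIntegral w y (t - x - y))

theorem sub_add_le_sub_abs {x y t : ℝ} (hx : 0 ≤ x) (hy : 0 ≤ y) : t - x - y ≤ t - |x - y| := by
  have : |x - y| ≤ x + y := by rw [abs_le]; constructor <;> linarith
  linarith

/-- Fubini with the order of `ξ` and `y` exchanged. With `s = y + ξ`, the slice of the rectangle at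
fixed `y ≥ 0` is the time interval `max y (t-x-y) < s ≤ t - |x-y|`; slices with `y < 0` vanish with
`q`. -/
theorem integral_characteristic {q : ℝ → B} {w : ℝ → ℝ → B} {C : ℝ}
    (hq : Integrable q) (hq0 : ∀ y < 0, q y = 0)
    (hw : Continuous (Function.uncurry w)) (hC : ∀ x t, ‖w x t‖ ≤ C) [CompleteSpace B]
    {x t : ℝ} (hx : 0 ≤ x) (hxt : x ≤ t) :
    ∫ ξ in (0 : ℝ)..(t - x), ∫ y in ((t - x - ξ) / 2)..((t + x - ξ) / 2), q y * w y (y + ξ)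
      = goursatInt q w x t := by
  classical
  set S : Set (ℝ × ℝ) := {p | (0 < p.1 ∧ p.1 ≤ t - x) ∧ ((t - x - p.1) / 2 < p.2 ∧
    p.2 ≤ (t + x - p.1) / 2)} with hS
  have hSm : MeasurableSet S := by
    refine MeasurableSet.inter (MeasurableSet.inter ?_ ?_) (MeasurableSet.inter ?_ ?_)
    · exact measurableSet_lt measurable_const measurable_fst
    · exact measurableSet_le measurable_fst measurable_const
    · exact measurableSet_lt (by fun_prop) measurable_snd
    · exact measurableSet_le measurable_snd (by fun_prop)
  set F : ℝ → ℝ → B := fun ξ y => S.indicator (fun p => q p.2 * w p.2 (p.2 + p.1)) (ξ, y) with hF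
  have hFi : Integrable (Function.uncurry F) (volume.prod volume) := by
    have hg : Integrable (fun p : ℝ × ℝ => (Ioc 0 (t - x)).indicator (fun _ => C) p.1 * ‖q p.2‖)
        (volume.prod volume) :=
      Integrable.mul_prod
        ((integrable_indicator_iff measurableSet_Ioc).2 (by simp)) hq.norm
    refine hg.mono' ?_ ?_
    · have : Function.uncurry F = S.indicator (fun p => q p.2 * w p.2 (p.2 + p.1)) := by
        ext p; rfl
      rw [this]
      refine AEStronglyMeasurable.indicator ?_ hSm
      refine (hq.aestronglyMeasurable.comp_snd).mul ?_
      exact (hw.comp (by fun_prop : Continuous fun p : ℝ × ℝ =>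
        (p.2, p.2 + p.1))).aestronglyMeasurable
    · refine Filter.Eventually.of_forall fun p => ?_
      simp only [Function.uncurry, hF]
      by_cases hp : p ∈ S
      · rw [indicator_of_mem (by exact hp), indicator_of_mem (by exact hp.1)]
        refine (norm_mul_le _ _).trans ?_
        rw [mul_comm]
        exact mul_le_mul_of_nonneg_right (hC _ _) (norm_nonneg _)
      · rw [indicator_of_notMem (by exact hp), norm_zero]
        refine mul_nonneg (indicator_nonneg (fun _ _ => (norm_nonneg _).trans (hC 0 0)) _)
          (norm_nonneg _)
  have h1 : ∫ ξ in (0 : ℝ)..(t - x), ∫ y in ((t - x - ξ) / 2)..((t + x - ξ) / 2),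
      q y * w y (y + ξ) = ∫ ξ, ∫ y, F ξ y := by
    rw [intervalIntegral.integral_of_le (by linarith), ← integral_indicator measurableSet_Ioc]
    refine integral_congr_ae (Filter.Eventually.of_forall fun ξ => ?_)
    by_cases hξ : ξ ∈ Ioc 0 (t - x)
    · simp only [indicator_of_mem hξ]
      rw [intervalIntegral.integral_of_le (by linarith), ← integral_indicator measurableSet_Ioc]
      refine integral_congr_ae (Filter.Eventually.of_forall fun y => ?_)
      by_cases hy : y ∈ Ioc ((t - x - ξ) / 2) ((t + x - ξ) / 2)
      · simp only [hF, indicator_of_mem hy]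
        rw [indicator_of_mem (show (ξ, y) ∈ S from ⟨hξ, hy⟩)]
      · simp only [hF, indicator_of_notMem hy]
        rw [indicator_of_notMem (fun h : (ξ, y) ∈ S => hy h.2)]
    · simp only [indicator_of_notMem hξ]
      symm
      refine integral_eq_zero_of_ae (Filter.Eventually.of_forall fun y => ?_)
      simp only [hF]
      rw [indicator_of_notMem (fun h : (ξ, y) ∈ S => hξ h.1)]
      rfl
  rw [h1, integral_integral_swap hFi]
  unfold goursatInt
  refine integral_congr_ae (Filter.Eventually.of_forall fun y => ?_)
  simp only
  rcases lt_or_ge y 0 with hy | hy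
  · simp only [hF, hq0 y hy, zero_mul]
    refine integral_eq_zero_of_ae (Filter.Eventually.of_forall fun ξ => ?_)
    simp [indicator_apply, hq0 y hy]
  · rw [timeIntegral_sub hw (sub_add_le_sub_abs hx hy)]
    have h2 : ∀ ξ, F ξ y = q y * (Ioc (max y (t - x - y)) (t - |x - y|)).indicator (w y)
        (y + ξ) := by
      intro ξ
      -- The four inequalities correspond one to one: `ξ > 0` to `s > y`, the lower bound on `y` to
      -- `s > t-x-y`, and the two upper bounds to the two halves of `|x-y| ≤ t - s`.
      have hiff : (ξ, y) ∈ S ↔ y + ξ ∈ Ioc (max y (t - x - y)) (t - |x - y|) := by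
        simp only [hS, mem_ofPred_eq, mem_Ioc, max_lt_iff, le_sub_comm (c := |x - y|), abs_le]
        constructor
        · rintro ⟨⟨a, b⟩, c, d⟩
          refine ⟨⟨?_, ?_⟩, ?_, ?_⟩ <;> linarith
        · rintro ⟨⟨a, b⟩, c, d⟩
          refine ⟨⟨?_, ?_⟩, ?_, ?_⟩ <;> linarith
      simp only [hF]
      by_cases h : (ξ, y) ∈ S
      · rw [indicator_of_mem h, indicator_of_mem (hiff.1 h)]
      · rw [indicator_of_notMem h, indicator_of_notMem (fun h' => h (hiff.2 h')), mul_zero]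
    simp_rw [h2]
    rw [integral_const_mul_of_integrable, integral_add_left_eq_self
      ((Ioc (max y (t - x - y)) (t - |x - y|)).indicator (w y)) y,
      integral_indicator measurableSet_Ioc]
    refine Integrable.comp_add_left (f := (Ioc (max y (t - x - y)) (t - |x - y|)).indicator (w y))
      ?_ y
    rw [integrable_indicator_iff measurableSet_Ioc]
    exact (hw.comp (Continuous.prodMk_right y)).integrableOn_Ioc

end Goursat

/-! ### The Volterra operator of the Goursat problem. -/

section GoursatOp

variable {B : Type*} [NormedRing B] [NormedAlgebra ℝ B]

/-- The times involved lie in `(0, t]` whatever `x` and `y` are. A majorant depending on time alone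
therefore suffices, and it is what makes the iteration produce factorials. -/
theorem norm_timeIntegral_sub_le {w : ℝ → ℝ → B} (hw : Continuous (Function.uncurry w))
    {T : ℝ} {β : ℝ → ℝ} (hβ : Continuous β) (hβ0 : ∀ s, 0 ≤ s → 0 ≤ β s)
    (hwβ : ∀ y s, (y, s) ∈ triangle T → ‖w y s‖ ≤ β s)
    {x y t : ℝ} (hx : 0 ≤ x) (hy : 0 ≤ y) (ht0 : 0 ≤ t) (ht : t ≤ T) :
    ‖timeIntegral w y (t - |x - y|) - timeIntegral w y (t - x - y)‖ ≤ ∫ s in (0 : ℝ)..t, β s := by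
  rw [timeIntegral_sub hw (sub_add_le_sub_abs hx hy), intervalIntegral.integral_of_le ht0]
  have hsub : Ioc (max y (t - x - y)) (t - |x - y|) ⊆ Ioc 0 t := fun s hs =>
    ⟨hy.trans_lt ((le_max_left _ _).trans_lt hs.1), hs.2.trans (by linarith [abs_nonneg (x - y)])⟩
  calc _ ≤ ∫ s in Ioc (max y (t - x - y)) (t - |x - y|), β s := by
        refine norm_integral_le_of_norm_le hβ.integrableOn_Ioc ?_
        refine (ae_restrict_iff' measurableSet_Ioc).2 (Filter.Eventually.of_forall fun s hs => ?_)
        exact hwβ y s ⟨hy, ((le_max_left _ _).trans_lt hs.1).le, (hsub hs).2.trans ht⟩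
    _ ≤ _ := by
        refine setIntegral_mono_set hβ.integrableOn_Ioc ?_ hsub.eventuallyLE
        exact (ae_restrict_iff' measurableSet_Ioc).2
          (Filter.Eventually.of_forall fun s hs => hβ0 s hs.1.le)

theorem norm_goursat_integrand_le {q : ℝ → B} {T : ℝ} (hq0 : ∀ y, y ∉ Icc 0 T → q y = 0)
    {w : ℝ → ℝ → B} (hw : Continuous (Function.uncurry w))
    {β : ℝ → ℝ} (hβ : Continuous β) (hβ0 : ∀ s, 0 ≤ s → 0 ≤ β s)
    (hwβ : ∀ y s, (y, s) ∈ triangle T → ‖w y s‖ ≤ β s)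
    {x t : ℝ} (hx : 0 ≤ x) (ht0 : 0 ≤ t) (ht : t ≤ T) (y : ℝ) :
    ‖q y * (timeIntegral w y (t - |x - y|) - timeIntegral w y (t - x - y))‖
      ≤ ‖q y‖ * ∫ s in (0 : ℝ)..t, β s := by
  by_cases hy : y ∈ Icc 0 T
  · exact (norm_mul_le _ _).trans (mul_le_mul_of_nonneg_left
      (norm_timeIntegral_sub_le hw hβ hβ0 hwβ hx hy.1 ht0 ht) (norm_nonneg _))
  · simp [hq0 y hy]

theorem norm_goursatInt_le {q : ℝ → B} {T : ℝ} (hq : Integrable q)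
    (hq0 : ∀ y, y ∉ Icc 0 T → q y = 0)
    {w : ℝ → ℝ → B} (hw : Continuous (Function.uncurry w))
    {β : ℝ → ℝ} (hβ : Continuous β) (hβ0 : ∀ s, 0 ≤ s → 0 ≤ β s)
    (hwβ : ∀ y s, (y, s) ∈ triangle T → ‖w y s‖ ≤ β s)
    {x t : ℝ} (hx : 0 ≤ x) (ht0 : 0 ≤ t) (ht : t ≤ T) :
    ‖goursatInt q w x t‖ ≤ (∫ y, ‖q y‖) * ∫ s in (0 : ℝ)..t, β s := by
  rw [← integral_mul_const]
  exact norm_integral_le_of_norm_le (hq.norm.mul_const _)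
    (Filter.Eventually.of_forall (norm_goursat_integrand_le hq0 hw hβ hβ0 hwβ hx ht0 ht))

theorem continuous_goursat_factor {w : ℝ → ℝ → B} (hw : Continuous (Function.uncurry w)) :
    Continuous fun p : (ℝ × ℝ) × ℝ => timeIntegral w p.2 (p.1.2 - |p.1.1 - p.2|) -
      timeIntegral w p.2 (p.1.2 - p.1.1 - p.2) := by
  have h := continuous_timeIntegral hw
  refine Continuous.sub ?_ ?_
  · exact h.comp (by fun_prop : Continuous fun p : (ℝ × ℝ) × ℝ => (p.2, p.1.2 - |p.1.1 - p.2|))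
  · exact h.comp (by fun_prop : Continuous fun p : (ℝ × ℝ) × ℝ => (p.2, p.1.2 - p.1.1 - p.2))

theorem aestronglyMeasurable_goursat_integrand {q : ℝ → B} (hq : Integrable q)
    {w : ℝ → ℝ → B} (hw : Continuous (Function.uncurry w)) (x t : ℝ) :
    AEStronglyMeasurable (fun y => q y * (timeIntegral w y (t - |x - y|) -
      timeIntegral w y (t - x - y))) volume :=
  hq.aestronglyMeasurable.mul ((continuous_goursat_factor hw).comp
    (by fun_prop : Continuous fun y : ℝ => ((x, t), y))).aestronglyMeasurable

theorem integrable_goursat_integrand {q : ℝ → B} {T : ℝ} (hq : Integrable q)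
    (hq0 : ∀ y, y ∉ Icc 0 T → q y = 0)
    {w : ℝ → ℝ → B} (hw : Continuous (Function.uncurry w)) {C : ℝ} (hC : ∀ x t, ‖w x t‖ ≤ C)
    {x t : ℝ} (hx : 0 ≤ x) (ht0 : 0 ≤ t) (ht : t ≤ T) :
    Integrable fun y => q y * (timeIntegral w y (t - |x - y|) -
      timeIntegral w y (t - x - y)) :=
  (hq.norm.mul_const _).mono' (aestronglyMeasurable_goursat_integrand hq hw x t)
    (Filter.Eventually.of_forall (norm_goursat_integrand_le hq0 hw (β := fun _ => C)
      continuous_const (fun _ _ => (norm_nonneg _).trans (hC 0 0)) (fun y s _ => hC y s) hx ht0 ht))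

/-- Slicing at fixed `y` puts the whole dependence on `(x,t)` into a continuous factor, so dominated
convergence applies although `q` is merely integrable. -/
theorem continuous_goursatInt {q : ℝ → B} {T : ℝ} (hq : Integrable q)
    (hq0 : ∀ y, y ∉ Icc 0 T → q y = 0)
    {w : ℝ → ℝ → B} (hw : Continuous (Function.uncurry w)) {C : ℝ} (hC : ∀ x t, ‖w x t‖ ≤ C) :
    Continuous fun p : triangle T => goursatInt q w p.1.1 p.1.2 := by
  have hC0 : 0 ≤ C := (norm_nonneg _).trans (hC 0 0)
  unfold goursatInt
  refine continuous_of_dominated (bound := fun y => ‖q y‖ * (C * T)) ?_ ?_ ?_ ?_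
  · exact fun p => aestronglyMeasurable_goursat_integrand hq hw _ _
  · rintro ⟨⟨x, t⟩, h1, h2, h3⟩
    refine Filter.Eventually.of_forall fun y => ?_
    refine (norm_goursat_integrand_le hq0 hw (β := fun _ => C) continuous_const
      (fun _ _ => hC0) (fun y s _ => hC y s) h1 (h1.trans h2) h3 y).trans ?_
    refine mul_le_mul_of_nonneg_left ?_ (norm_nonneg _)
    simp only [intervalIntegral.integral_const, sub_zero, smul_eq_mul]
    rw [mul_comm]
    exact mul_le_mul_of_nonneg_left h3 hC0
  · exact hq.norm.mul_const _
  · refine Filter.Eventually.of_forall fun y => ?_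
    exact continuous_const.mul ((continuous_goursat_factor hw).comp
      (by fun_prop : Continuous fun p : triangle T => ((p.1.1, p.1.2), y)))

/-- The bounded continuous extension of a function on the triangle to the plane. -/
noncomputable def triExtend {T : ℝ} (hT : 0 ≤ T) (z : C(triangle T, B)) (x t : ℝ) : B :=
  z ⟨triProj T (x, t), triProj_mem hT _⟩

omit [NormedAlgebra ℝ B] in
theorem continuous_triExtend {T : ℝ} (hT : 0 ≤ T) (z : C(triangle T, B)) :
    Continuous (Function.uncurry (triExtend hT z)) :=
  z.continuous.comp ((continuous_triProj T).subtype_mk _)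

omit [NormedAlgebra ℝ B] in
theorem norm_triExtend_le {T : ℝ} (hT : 0 ≤ T) (z : C(triangle T, B)) (x t : ℝ) :
    ‖triExtend hT z x t‖ ≤ ‖z‖ := z.norm_coe_le_norm _

omit [NormedAlgebra ℝ B] in
theorem triExtend_of_mem {T : ℝ} (hT : 0 ≤ T) (z : C(triangle T, B)) {x t : ℝ}
    (h : (x, t) ∈ triangle T) : triExtend hT z x t = z ⟨(x, t), h⟩ := by
  unfold triExtend
  congr 1
  exact Subtype.ext (triProj_of_mem h)

theorem timeIntegral_add {w w' : ℝ → ℝ → B} (hw : Continuous (Function.uncurry w))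
    (hw' : Continuous (Function.uncurry w')) (y τ : ℝ) :
    timeIntegral (fun x t => w x t + w' x t) y τ = timeIntegral w y τ + timeIntegral w' y τ :=
  intervalIntegral.integral_add ((hw.comp (Continuous.prodMk_right y)).intervalIntegrable _ _)
    ((hw'.comp (Continuous.prodMk_right y)).intervalIntegrable _ _)

theorem timeIntegral_smul (c : ℝ) (w : ℝ → ℝ → B) (y τ : ℝ) :
    timeIntegral (fun x t => c • w x t) y τ = c • timeIntegral w y τ :=
  intervalIntegral.integral_smul _ _

/-- The Volterra operator of the Goursat problem on continuous functions on the triangle. -/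
noncomputable def goursatOp {T : ℝ} (hT : 0 ≤ T) {q : ℝ → B} (hq : Integrable q)
    (hq0 : ∀ y, y ∉ Icc 0 T → q y = 0) : C(triangle T, B) →L[ℝ] C(triangle T, B) :=
  LinearMap.mkContinuous
    { toFun := fun z => ⟨fun p => (1 / 2 : ℝ) • goursatInt q (triExtend hT z) p.1.1 p.1.2,
        (continuous_goursatInt hq hq0 (continuous_triExtend hT z)
          (norm_triExtend_le hT z)).const_smul _⟩
      map_add' := by
        intro z z'
        ext ⟨⟨x, t⟩, h1, h2, h3⟩
        simp only [ContinuousMap.coe_mk, ContinuousMap.add_apply]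
        rw [← smul_add]
        congr 1
        unfold goursatInt
        rw [← integral_add
          (integrable_goursat_integrand hq hq0 (continuous_triExtend hT z)
            (norm_triExtend_le hT z) h1 (h1.trans h2) h3)
          (integrable_goursat_integrand hq hq0 (continuous_triExtend hT z')
            (norm_triExtend_le hT z') h1 (h1.trans h2) h3)]
        congr 1
        ext y
        have : triExtend hT (z + z') = fun x t => triExtend hT z x t + triExtend hT z' x t := rfl
        rw [this, timeIntegral_add (continuous_triExtend hT z) (continuous_triExtend hT z'),
          timeIntegral_add (continuous_triExtend hT z) (continuous_triExtend hT z'), ← mul_add]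
        congr 1
        abel
      map_smul' := by
        intro c z
        ext ⟨⟨x, t⟩, h1, h2, h3⟩
        simp only [ContinuousMap.coe_mk, ContinuousMap.smul_apply, RingHom.id_apply]
        rw [smul_comm c]
        congr 1
        unfold goursatInt
        rw [← integral_smul]
        congr 1
        ext y
        have : triExtend hT (c • z) = fun x t => c • triExtend hT z x t := rfl
        rw [this, timeIntegral_smul, timeIntegral_smul, ← smul_sub, mul_smul_comm] }
    ((∫ y, ‖q y‖) * T)
    (by
      intro z
      have hI : 0 ≤ ∫ y, ‖q y‖ := integral_nonneg fun _ => norm_nonneg _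
      refine (ContinuousMap.norm_le _ (by positivity)).2 ?_
      rintro ⟨⟨x, t⟩, h1, h2, h3⟩
      simp only [LinearMap.coe_mk, AddHom.coe_mk, ContinuousMap.coe_mk] at *
      rw [norm_smul]
      have h := norm_goursatInt_le hq hq0 (continuous_triExtend hT z) (β := fun _ => ‖z‖)
        continuous_const (fun _ _ => norm_nonneg _) (fun y s _ => norm_triExtend_le hT z y s) h1
        (h1.trans h2) h3
      simp only [intervalIntegral.integral_const, sub_zero, smul_eq_mul] at h
      have h' : ‖goursatInt q (triExtend hT z) x t‖ ≤ (∫ y, ‖q y‖) * (T * ‖z‖) :=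
        h.trans (by gcongr)
      have h0 := norm_nonneg (goursatInt q (triExtend hT z) x t)
      norm_num
      linarith)

theorem goursatOp_apply {T : ℝ} (hT : 0 ≤ T) {q : ℝ → B} (hq : Integrable q)
    (hq0 : ∀ y, y ∉ Icc 0 T → q y = 0) (z : C(triangle T, B)) (p : triangle T) :
    goursatOp hT hq hq0 z p = (1 / 2 : ℝ) • goursatInt q (triExtend hT z) p.1.1 p.1.2 := rfl

/-- Picard iteration: the bound for `k` is used as the time majorant for `k + 1`. The factor `1/2`
of the operator is simply dropped. -/
theorem norm_goursatOp_pow_apply_le {T : ℝ} (hT : 0 ≤ T) {q : ℝ → B} (hq : Integrable q)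
    (hq0 : ∀ y, y ∉ Icc 0 T → q y = 0) (z : C(triangle T, B)) (k : ℕ) :
    ∀ p : triangle T, ‖(goursatOp hT hq hq0 ^ k) z p‖
      ≤ ‖z‖ * (((∫ y, ‖q y‖) * p.1.2) ^ k / k.factorial) := by
  have hI : 0 ≤ ∫ y, ‖q y‖ := integral_nonneg fun _ => norm_nonneg _
  induction k with
  | zero => intro p; simpa using z.norm_coe_le_norm p
  | succ k ih =>
    rintro ⟨⟨x, t⟩, h1, h2, h3⟩
    have ht0 := h1.trans h2
    simp only at ht0
    rw [pow_succ', mul_apply_eq_comp, goursatOp_apply, norm_smul]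
    have h := norm_goursatInt_le hq hq0 (continuous_triExtend hT ((goursatOp hT hq hq0 ^ k) z))
      (β := fun s => ‖z‖ * (((∫ y, ‖q y‖) * s) ^ k / k.factorial)) (by fun_prop)
      (fun s hs => by positivity)
      (fun y s hys => by rw [triExtend_of_mem hT _ hys]; exact ih ⟨(y, s), hys⟩) h1 ht0 h3
    have hint : ∫ s in (0 : ℝ)..t, ‖z‖ * (((∫ y, ‖q y‖) * s) ^ k / k.factorial)
        = ‖z‖ * ((∫ y, ‖q y‖) ^ k * t ^ (k + 1) / (k + 1).factorial) := by
      simp_rw [mul_pow, mul_div_assoc]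
      rw [intervalIntegral.integral_const_mul, intervalIntegral.integral_const_mul,
        intervalIntegral.integral_div, integral_pow, Nat.factorial_succ]
      push_cast
      field_simp
      ring
    rw [hint] at h
    refine le_trans ?_ (h.trans (le_of_eq ?_))
    · simp only [norm_div, norm_one, Real.norm_ofNat]
      linarith [norm_nonneg (goursatInt q (triExtend hT ((goursatOp hT hq hq0 ^ k) z)) x t)]
    · simp only
      ring

theorem isUnit_one_add_goursatOp [CompleteSpace B] {T : ℝ} (hT : 0 ≤ T) {q : ℝ → B}
    (hq : Integrable q) (hq0 : ∀ y, y ∉ Icc 0 T → q y = 0) :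
    IsUnit (1 + goursatOp hT hq hq0) := by
  have hI : 0 ≤ ∫ y, ‖q y‖ := integral_nonneg fun _ => norm_nonneg _
  refine isUnit_one_add_of_norm_pow_le (R := C(triangle T, B) →L[ℝ] C(triangle T, B))
    (C := (∫ y, ‖q y‖) * T) (D := (∫ y, ‖q y‖) * T) fun k => ?_
  have hn : ‖goursatOp hT hq hq0 ^ (k + 1)‖ ≤
      (∫ y, ‖q y‖) * T * (((∫ y, ‖q y‖) * T) ^ k / k.factorial) := by
    refine ContinuousLinearMap.opNorm_le_bound _ (by positivity) fun z => ?_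
    refine (ContinuousMap.norm_le _ (by positivity)).2 fun p => ?_
    refine (norm_goursatOp_pow_apply_le hT hq hq0 z (k + 1) p).trans ?_
    have hp0 : 0 ≤ p.1.2 := p.2.1.trans p.2.2.1
    rw [mul_comm]
    refine mul_le_mul_of_nonneg_right ?_ (norm_nonneg _)
    -- Weakening `(k+1)!` to `k!` frees one factor to serve as the constant `C` of the abstract
    -- criterion.
    calc _ ≤ ((∫ y, ‖q y‖) * T) ^ (k + 1) / (k + 1).factorial := by
          gcongr
          exact p.2.2.2
      _ ≤ ((∫ y, ‖q y‖) * T) ^ (k + 1) / k.factorial := by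
          gcongr
          simp
      _ = _ := by rw [pow_succ']; ring
  exact hn

end GoursatOp

/-! ### Existence and uniqueness of the Goursat kernel. -/

section GoursatSolve

variable {B : Type*} [NormedRing B] [NormedAlgebra ℝ B]

/-- At fixed `ξ` the substitution `y = (η - ξ)/2` has `dη = 2 dy`, whence the factor `2`, which
turns the `1/4` of the Goursat equation into the `1/2` of `goursatOp`. The rectangle stays inside
the triangle and `y` inside `[0,T]`, so `q` may be replaced by a representative and `w` by its
extension. -/
theorem integral_goursat_rectangle [CompleteSpace B] {T : ℝ} (hT : 0 ≤ T) {q q0 : ℝ → B}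
    (hqq : q =ᵐ[volume.restrict (Icc 0 T)] q0) (hq : Integrable q0)
    (hq0 : ∀ y, y ∉ Icc 0 T → q0 y = 0) (z : C(triangle T, B)) {w : ℝ → ℝ → B}
    (hw : ∀ x t, (x, t) ∈ triangle T → w x t = triExtend hT z x t) {x t : ℝ}
    (hxt : (x, t) ∈ triangle T) :
    ∫ ξ in (0 : ℝ)..(t - x), ∫ η in (t - x)..(t + x),
        q ((η - ξ) / 2) * w ((η - ξ) / 2) ((η + ξ) / 2)
      = (2 : ℝ) • goursatInt q0 (triExtend hT z) x t := by
  obtain ⟨h1, h2, h3⟩ := hxt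
  simp only at h1 h2 h3
  rw [← integral_characteristic hq (fun y hy => hq0 y fun h => absurd h.1 (not_le.2 hy))
    (continuous_triExtend hT z) (norm_triExtend_le hT z) h1 h2, ← intervalIntegral.integral_smul]
  refine intervalIntegral.integral_congr fun ξ hξ => ?_
  rw [uIcc_of_le (by linarith)] at hξ
  have e1 : ∫ η in (t - x)..(t + x), q ((η - ξ) / 2) * w ((η - ξ) / 2) ((η + ξ) / 2)
      = ∫ η in (t - x)..(t + x), (fun y => q y * triExtend hT z y (y + ξ)) (η / 2 - ξ / 2) := by
    refine intervalIntegral.integral_congr fun η hη => ?_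
    rw [uIcc_of_le (by linarith)] at hη
    simp only
    rw [← sub_div, hw _ _ ⟨by simp only; linarith [hη.1, hξ.2],
      by simp only; linarith [hξ.1], by simp only; linarith [hη.2, hξ.2]⟩]
    congr 2
    ring
  rw [e1, intervalIntegral.integral_comp_div_sub (fun y => q y * triExtend hT z y (y + ξ)) (by norm_num : (2 : ℝ) ≠ 0)]
  congr 1
  rw [← sub_div, ← sub_div]
  have hle : (t - x - ξ) / 2 ≤ (t + x - ξ) / 2 := by linarith
  rw [intervalIntegral.integral_of_le hle, intervalIntegral.integral_of_le hle]
  refine integral_congr_ae ?_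
  have hsub : Ioc ((t - x - ξ) / 2) ((t + x - ξ) / 2) ⊆ Icc 0 T := fun y hy =>
    ⟨by linarith [hy.1, hξ.2], by linarith [hy.2, hξ.1]⟩
  filter_upwards [ae_restrict_of_ae_restrict_of_subset hsub hqq] with y hy
  rw [hy]

/-- The inhomogeneity `-1/2 ∫ q` of the Goursat integral equation. -/
noncomputable def goursatSource {T : ℝ} {q : ℝ → B} (hq : Integrable q) : C(triangle T, B) :=
  ⟨fun p => -((1 / 2 : ℝ) • ∫ s in ((p.1.2 - p.1.1) / 2)..((p.1.2 + p.1.1) / 2), q s), by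
    have hc : Continuous fun a : ℝ => ∫ s in (0 : ℝ)..a, q s :=
      intervalIntegral.continuous_primitive (fun a b => hq.intervalIntegrable) 0
    have : (fun p : triangle T =>
        -((1 / 2 : ℝ) • ∫ s in ((p.1.2 - p.1.1) / 2)..((p.1.2 + p.1.1) / 2), q s)) =
        fun p : triangle T => -((1 / 2 : ℝ) • ((∫ s in (0 : ℝ)..((p.1.2 + p.1.1) / 2), q s) -
          ∫ s in (0 : ℝ)..((p.1.2 - p.1.1) / 2), q s)) := by
      ext p
      rw [intervalIntegral.integral_interval_sub_left hq.intervalIntegrable hq.intervalIntegrable]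
    rw [this]
    refine (Continuous.const_smul (Continuous.sub ?_ ?_) _).neg
    · exact hc.comp (by fun_prop : Continuous fun p : triangle T => (p.1.2 + p.1.1) / 2)
    · exact hc.comp (by fun_prop : Continuous fun p : triangle T => (p.1.2 - p.1.1) / 2)⟩

theorem goursat_rhs_eq [CompleteSpace B] {T : ℝ} (hT : 0 ≤ T) {q q0 : ℝ → B}
    (hqq : q =ᵐ[volume.restrict (Icc 0 T)] q0) (hq : Integrable q0)
    (hq0 : ∀ y, y ∉ Icc 0 T → q0 y = 0) (z : C(triangle T, B)) {w : ℝ → ℝ → B}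
    (hw : ∀ x t, (x, t) ∈ triangle T → w x t = triExtend hT z x t) {x t : ℝ}
    (hxt : (x, t) ∈ triangle T) :
    -((1 / 2 : ℝ) • ∫ s in ((t - x) / 2)..((t + x) / 2), q s)
      - (1 / 4 : ℝ) • ∫ ξ in (0 : ℝ)..(t - x), ∫ η in (t - x)..(t + x),
          q ((η - ξ) / 2) * w ((η - ξ) / 2) ((η + ξ) / 2)
      = (goursatSource hq - goursatOp hT hq hq0 z : C(triangle T, B)) ⟨(x, t), hxt⟩ := by
  rw [integral_goursat_rectangle hT hqq hq hq0 z hw hxt, ContinuousMap.sub_apply, goursatOp_apply,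
    smul_smul]
  obtain ⟨h1, h2, h3⟩ := hxt
  simp only at h1 h2 h3
  congr 1
  · simp only [goursatSource, ContinuousMap.coe_mk]
    congr 2
    have hle : (t - x) / 2 ≤ (t + x) / 2 := by linarith
    rw [intervalIntegral.integral_of_le hle, intervalIntegral.integral_of_le hle]
    refine integral_congr_ae ?_
    have hsub : Ioc ((t - x) / 2) ((t + x) / 2) ⊆ Icc 0 T := fun y hy =>
      ⟨by linarith [hy.1], by linarith [hy.2]⟩
    exact ae_restrict_of_ae_restrict_of_subset hsub hqq
  · norm_num

end GoursatSolve

/-- Reduces uniqueness of the kernel to injectivity of `1 + goursatOp`. -/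
theorem IsGoursatKernel.goursatOp_eq {n : ℕ} {q q0 : ℝ → Matrix (Fin n) (Fin n) ℂ} {T : ℝ}
    (hT : 0 ≤ T) (hqq : q =ᵐ[volume.restrict (Icc 0 T)] q0) (hq : Integrable q0)
    (hq0 : ∀ y, y ∉ Icc 0 T → q0 y = 0) {w : ℝ → ℝ → Matrix (Fin n) (Fin n) ℂ}
    (hw : IsGoursatKernel q T w) :
    ∃ z : C(triangle T, Matrix (Fin n) (Fin n) ℂ), (1 + goursatOp hT hq hq0) z = goursatSource hq ∧
      ∀ x t, (x, t) ∈ triangle T → w x t = triExtend hT z x t := by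
  refine ⟨⟨fun p => w p.1.1 p.1.2, continuousOn_iff_continuous_domRestrict.1 hw.1⟩, ?_, ?_⟩
  swap
  · intro x t h
    rw [triExtend_of_mem hT _ h]
    rfl
  · refine ContinuousMap.ext fun p => ?_
    obtain ⟨⟨x, t⟩, hxt⟩ := p
    have h := hw.2 (t - x) (t + x) (by linarith [hxt.2.1]) (by linarith [hxt.1])
      (by linarith [hxt.2.2])
    rw [goursat_rhs_eq hT hqq hq hq0
      ⟨fun p => w p.1.1 p.1.2, continuousOn_iff_continuous_domRestrict.1 hw.1⟩ (fun x t h => by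
      rw [triExtend_of_mem hT _ h]
      rfl) hxt, ContinuousMap.sub_apply, eq_sub_iff_add_eq,
      show (t + x - (t - x)) / 2 = x by ring, show (t + x + (t - x)) / 2 = t by ring] at h
    exact h

/-- Reduces existence of the kernel to solvability of the operator equation; `x = (η - ξ)/2` and `t
= (η + ξ)/2` translate the coordinates. -/
theorem isGoursatKernel_triExtend {n : ℕ} {q q0 : ℝ → Matrix (Fin n) (Fin n) ℂ} {T : ℝ}
    (hT : 0 ≤ T) (hqq : q =ᵐ[volume.restrict (Icc 0 T)] q0) (hq : Integrable q0)
    (hq0 : ∀ y, y ∉ Icc 0 T → q0 y = 0) {z : C(triangle T, Matrix (Fin n) (Fin n) ℂ)}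
    (hz : (1 + goursatOp hT hq hq0) z = goursatSource hq) :
    IsGoursatKernel q T (triExtend hT z) := by
  refine ⟨(continuous_triExtend hT z).continuousOn, fun ξ η h1 h2 h3 => ?_⟩
  have hxt : ((η - ξ) / 2, (η + ξ) / 2) ∈ triangle T :=
    ⟨by simp only; linarith, by simp only; linarith, by simp only; linarith⟩
  have h := goursat_rhs_eq hT hqq hq hq0 z (fun _ _ _ => rfl) hxt
  rw [show (η + ξ) / 2 - (η - ξ) / 2 = ξ by ring,
    show (η + ξ) / 2 + (η - ξ) / 2 = η by ring] at h
  rw [h, ← hz, triExtend_of_mem hT z hxt]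
  simp

/-- The Goursat kernel, extended continuously and boundedly to the plane, with its defining
equation in the space and time variables. -/
theorem exists_goursatKernel {n : ℕ} {q q0 : ℝ → Matrix (Fin n) (Fin n) ℂ} {T : ℝ}
    (hT : 0 ≤ T) (hqq : q =ᵐ[volume.restrict (Icc 0 T)] q0) (hq : Integrable q0)
    (hq0 : ∀ y, y ∉ Icc 0 T → q0 y = 0) :
    ∃ w : ℝ → ℝ → Matrix (Fin n) (Fin n) ℂ, IsGoursatKernel q T w ∧
      (∀ w', IsGoursatKernel q T w' → ∀ x t, (x, t) ∈ triangle T → w' x t = w x t) ∧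
      Continuous (Function.uncurry w) ∧ (∃ C, ∀ x t, ‖w x t‖ ≤ C) ∧
      ∀ x t, (x, t) ∈ triangle T → w x t =
        -((1 / 2 : ℝ) • ∫ s in ((t - x) / 2)..((t + x) / 2), q0 s)
          - (1 / 2 : ℝ) • goursatInt q0 w x t := by
  obtain ⟨u, hu⟩ := isUnit_one_add_goursatOp hT hq hq0
  set z := (u⁻¹.1 : C(triangle T, _) →L[ℝ] C(triangle T, _)) (goursatSource hq) with hz
  have hz' : (1 + goursatOp hT hq hq0) z = goursatSource hq := by
    rw [hz, ← hu, ← mul_apply_eq_comp, u.mul_inv]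
    rfl
  refine ⟨triExtend hT z, isGoursatKernel_triExtend hT hqq hq hq0 hz', ?_,
    continuous_triExtend hT z, ⟨‖z‖, norm_triExtend_le hT z⟩, ?_⟩
  · intro w' hw' x t h
    obtain ⟨z', hz1, hz2⟩ := hw'.goursatOp_eq hT hqq hq hq0
    have : z' = z := by
      rw [hz, ← hz1, ← hu, ← mul_apply_eq_comp, u.inv_mul]
      rfl
    rw [hz2 x t h, this]
  · intro x t h
    have h' := congrArg (fun g : C(triangle T, _) => g ⟨(x, t), h⟩) hz'
    simp only [add_apply, ContinuousMap.add_apply, goursatOp_apply] at h'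
    rw [triExtend_of_mem hT z h, eq_sub_iff_add_eq]
    exact h'

/-! ### Fubini on a triangle. -/

section TriangleSwap

variable {F : Type*} [NormedAddCommGroup F] [NormedSpace ℝ F]

theorem integral_triangle_swap {h : ℝ → ℝ → F} {a b : ℝ}
    (hh : Integrable (Function.uncurry h)
      ((volume.restrict (Ioc a b)).prod (volume.restrict (Ioc a b)))) :
    ∫ σ in Ioc a b, ∫ s in Ioc a σ, h σ s = ∫ s in Ioc a b, ∫ σ in Ioc s b, h σ s := by
  set S : Set (ℝ × ℝ) := {p | p.2 ≤ p.1} with hS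
  have hSm : MeasurableSet S := measurableSet_le measurable_snd measurable_fst
  have hi : Integrable (Function.uncurry fun σ s => S.indicator (Function.uncurry h) (σ, s))
      ((volume.restrict (Ioc a b)).prod (volume.restrict (Ioc a b))) := hh.indicator hSm
  have hswap := integral_integral_swap hi
  have e1 : ∀ σ ∈ Ioc a b, ∫ s in Ioc a b, S.indicator (Function.uncurry h) (σ, s)
      = ∫ s in Ioc a σ, h σ s := by
    intro σ hσ
    have : (fun s => S.indicator (Function.uncurry h) (σ, s)) = (Iic σ).indicator (h σ) := by
      ext s
      simp [indicator_apply, hS]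
    rw [this, setIntegral_indicator measurableSet_Iic]
    congr 2
    ext s
    simp only [mem_inter_iff, mem_Ioc, mem_Iic]
    exact ⟨fun h => ⟨h.1.1, h.2⟩, fun h => ⟨⟨h.1, h.2.trans hσ.2⟩, h.2⟩⟩
  have e2 : ∀ s ∈ Ioc a b, ∫ σ in Ioc a b, S.indicator (Function.uncurry h) (σ, s)
      = ∫ σ in Ioc s b, h σ s := by
    intro s hs
    have : (fun σ => S.indicator (Function.uncurry h) (σ, s)) =
        (Ici s).indicator (fun σ => h σ s) := by
      ext σ
      simp [indicator_apply, hS]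
    rw [this, setIntegral_indicator measurableSet_Ici, ← integral_Icc_eq_integral_Ioc]
    congr 2
    ext σ
    simp only [mem_inter_iff, mem_Ioc, mem_Ici, mem_Icc]
    exact ⟨fun h => ⟨h.2, h.1.2⟩, fun h => ⟨⟨hs.1.trans_le h.1, h.2⟩, h.1⟩⟩
  rw [setIntegral_congr_fun measurableSet_Ioc e1, setIntegral_congr_fun measurableSet_Ioc e2]
    at hswap
  exact hswap

end TriangleSwap

/-! ### Waves as convolutions in time. -/

section ConvWave

variable {E : Type*} [NormedAddCommGroup E] [NormedSpace ℂ E]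

/-- The primitive of `f` vanishing at zero. -/
noncomputable def prim (f : ℝ → E) (t : ℝ) : E := ∫ r in (0 : ℝ)..t, f r

/-- The wave `f(t - x) + ∫ₓᵗ w(x,s) f(t - s) ds` with an operator-valued kernel. -/
noncomputable def convWave (w : ℝ → ℝ → E →L[ℂ] E) (f : ℝ → E) (x t : ℝ) : E :=
  f (t - x) + ∫ s in Ioc x t, w x s (f (t - s))

/-- The wave produced by the unit step control. -/
noncomputable def front (w : ℝ → ℝ → E →L[ℂ] E) (y s : ℝ) : E →L[ℂ] E :=
  (Ici y).indicator (fun s => 1 + timeIntegral w y s) s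

theorem prim_of_nonpos {f : ℝ → E} (hf0 : ∀ t < 0, f t = 0) {t : ℝ} (ht : t ≤ 0) :
    prim f t = 0 := by
  unfold prim
  rw [intervalIntegral.integral_of_ge ht, integral_Ioc_eq_integral_Ioo,
    setIntegral_congr_fun measurableSet_Ioo (g := fun _ => 0) fun s hs => hf0 s hs.2]
  simp

theorem continuous_prim {f : ℝ → E} (hf : Integrable f) : Continuous (prim f) :=
  intervalIntegral.continuous_primitive (fun _ _ => hf.intervalIntegrable) 0

theorem integral_Ioc_comp_sub {f : ℝ → E} {s τ : ℝ} (h : s ≤ τ) :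
    ∫ σ in Ioc s τ, f (σ - s) = prim f (τ - s) := by
  rw [← intervalIntegral.integral_of_le h, intervalIntegral.integral_comp_sub_right, sub_self]
  rfl

theorem integral_Ioc_comp_sub_left {f : ℝ → E} {s τ : ℝ} (h : s ≤ τ) :
    ∫ σ in Ioc s τ, f (τ - σ) = prim f (τ - s) := by
  rw [← intervalIntegral.integral_of_le h, intervalIntegral.integral_comp_sub_left, sub_self]
  rfl

theorem convWave_of_lt (w : ℝ → ℝ → E →L[ℂ] E) {f : ℝ → E} (hf0 : ∀ t < 0, f t = 0) {y τ : ℝ}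
    (h : τ < y) : convWave w f y τ = 0 := by
  simp [convWave, Ioc_eq_empty_of_le h.le, hf0 _ (sub_neg.2 h)]

variable {w : ℝ → ℝ → E →L[ℂ] E} {C : ℝ} {f : ℝ → E}

theorem stronglyMeasurable_convWave_integral (hw : Continuous (Function.uncurry w))
    (hf : StronglyMeasurable f) :
    StronglyMeasurable fun p : ℝ × ℝ => ∫ s in Ioc p.1 p.2, w p.1 s (f (p.2 - s)) := by
  have hS : MeasurableSet {z : (ℝ × ℝ) × ℝ | z.1.1 < z.2 ∧ z.2 ≤ z.1.2} :=
    MeasurableSet.inter (measurableSet_lt (f := fun z : (ℝ × ℝ) × ℝ => z.1.1) (by fun_prop)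
      measurable_snd) (measurableSet_le (g := fun z : (ℝ × ℝ) × ℝ => z.1.2) measurable_snd
      (by fun_prop))
  have hm : StronglyMeasurable fun z : (ℝ × ℝ) × ℝ => w z.1.1 z.2 (f (z.1.2 - z.2)) := by
    refine isBoundedBilinearMap_apply.continuous.comp_stronglyMeasurable
      (StronglyMeasurable.prodMk ?_ ?_)
    · exact (hw.comp (by fun_prop : Continuous fun z : (ℝ × ℝ) × ℝ =>
        (z.1.1, z.2))).stronglyMeasurable
    · exact hf.comp_measurable (by fun_prop)
  convert (hm.indicator hS).integral_prod_right' (ν := volume) using 1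
  ext p
  rw [← integral_indicator measurableSet_Ioc]
  rfl

theorem stronglyMeasurable_convWave (hw : Continuous (Function.uncurry w))
    (hf : StronglyMeasurable f) : StronglyMeasurable (Function.uncurry (convWave w f)) :=
  (hf.comp_measurable (by fun_prop : Measurable fun p : ℝ × ℝ => p.2 - p.1)).add
    (stronglyMeasurable_convWave_integral hw hf)

theorem norm_convWave_integral_le (hC : ∀ x t, ‖w x t‖ ≤ C) (hf : Integrable f) (x t : ℝ) :
    ‖∫ s in Ioc x t, w x s (f (t - s))‖ ≤ C * ∫ s, ‖f s‖ := by
  have hC0 : 0 ≤ C := (norm_nonneg _).trans (hC 0 0)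
  have hi : Integrable fun s => C * ‖f (t - s)‖ := (hf.comp_sub_left t).norm.const_mul C
  calc _ ≤ ∫ s in Ioc x t, C * ‖f (t - s)‖ := by
        refine norm_integral_le_of_norm_le hi.integrableOn (Filter.Eventually.of_forall fun s => ?_)
        exact (ContinuousLinearMap.le_opNorm _ _).trans
          (mul_le_mul_of_nonneg_right (hC _ _) (norm_nonneg _))
    _ ≤ ∫ s, C * ‖f (t - s)‖ :=
        setIntegral_le_integral hi (Filter.Eventually.of_forall fun s => by positivity)
    _ = _ := by
        rw [integral_const_mul, integral_sub_left_eq_self (fun s => ‖f s‖) volume t]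

theorem integrable_convWave_integrand (hw : Continuous (Function.uncurry w))
    (hC : ∀ x t, ‖w x t‖ ≤ C) (hf : Integrable f) (y a b : ℝ) :
    Integrable (Function.uncurry fun σ s => w y s (f (σ - s)))
      ((volume.restrict (Ioc a b)).prod (volume.restrict (Ioc a b))) := by
  have hwy : Continuous (w y) := hw.comp (Continuous.prodMk_right y)
  have h1 : Integrable ((Ioc a b).indicator fun _ => C) :=
    (integrable_indicator_iff measurableSet_Ioc).2 (by simp)
  have hg := h1.convolution_integrand (ContinuousLinearMap.mul ℝ ℝ) hf.norm (μ := volume)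
  have hfm := hf.aestronglyMeasurable.comp_quasiMeasurePreserving
    (quasiMeasurePreserving_sub_of_right_invariant (volume : Measure ℝ) (volume : Measure ℝ))
  rw [Measure.prod_restrict]
  refine (hg.integrableOn (s := Ioc a b ×ˢ Ioc a b)).mono' ?_ ?_
  · refine (isBoundedBilinearMap_apply.continuous.comp_aestronglyMeasurable
      (AEStronglyMeasurable.prodMk ?_ hfm)).restrict
    exact (hwy.comp continuous_snd).aestronglyMeasurable
  · refine (ae_restrict_iff' (measurableSet_Ioc.prod measurableSet_Ioc)).2
      (Filter.Eventually.of_forall fun p hp => ?_)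
    rw [indicator_of_mem hp.2]
    exact (ContinuousLinearMap.le_opNorm _ _).trans
      (mul_le_mul_of_nonneg_right (hC _ _) (norm_nonneg _))

/-- The wave is a convolution in time of the control with the impulse response, so it commutes with
integration in time. This is Fubini on the triangle `y < s ≤ σ ≤ τ`; causality lets both integrals
start at the front. -/
theorem integral_convWave [CompleteSpace E] (hw : Continuous (Function.uncurry w))
    (hC : ∀ x t, ‖w x t‖ ≤ C)
    (hfm : StronglyMeasurable f) (hf : Integrable f) (hf0 : ∀ t < 0, f t = 0) {y : ℝ} (hy : 0 ≤ y)
    (τ : ℝ) : ∫ σ in (0 : ℝ)..τ, convWave w f y σ = convWave w (prim f) y τ := by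
  rcases lt_or_ge τ y with h | h
  · rw [convWave_of_lt w (fun t ht => prim_of_nonpos hf0 ht.le) h]
    rcases le_or_gt 0 τ with h0 | h0
    · rw [intervalIntegral.integral_of_le h0, setIntegral_congr_fun measurableSet_Ioc
        (g := fun _ => 0) fun s hs => convWave_of_lt w hf0 (hs.2.trans_lt h)]
      simp
    · rw [intervalIntegral.integral_of_ge h0.le, integral_Ioc_eq_integral_Ioo,
        setIntegral_congr_fun measurableSet_Ioo
        (g := fun _ => 0) fun s hs => convWave_of_lt w hf0 (hs.2.trans_le hy)]
      simp
  · have hI : Integrable (fun σ => ∫ s in Ioc y σ, w y s (f (σ - s)))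
        (volume.restrict (Ioc 0 τ)) := by
      refine Measure.integrableOn_of_bounded (M := C * ∫ s, ‖f s‖) (by simp) ?_
        (Filter.Eventually.of_forall fun σ => norm_convWave_integral_le hC hf y σ)
      exact ((stronglyMeasurable_convWave_integral hw hfm).comp_measurable
        (measurable_prodMk_left (x := y))).aestronglyMeasurable
    unfold convWave
    rw [intervalIntegral.integral_of_le (hy.trans h), integral_add
      (hf.comp_sub_right y).integrableOn hI]
    congr 1
    · rw [← intervalIntegral.integral_of_le (hy.trans h),
        intervalIntegral.integral_comp_sub_right,
        ← intervalIntegral.integral_add_adjacent_intervals (b := 0) hf.intervalIntegrable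
          hf.intervalIntegrable, intervalIntegral.integral_symm]
      have := prim_of_nonpos hf0 (t := 0 - y) (by linarith)
      unfold prim at this
      rw [this]
      simp [prim]
    · have e1 : ∫ σ in Ioc 0 τ, ∫ s in Ioc y σ, w y s (f (σ - s))
          = ∫ σ in Ioc y τ, ∫ s in Ioc y σ, w y s (f (σ - s)) := by
        refine setIntegral_eq_of_subset_of_forall_sdiff_eq_zero measurableSet_Ioc
          (Ioc_subset_Ioc_left hy) fun σ hσ => ?_
        have : σ ≤ y := by
          by_contra h'
          exact hσ.2 ⟨not_le.1 h', hσ.1.2⟩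
        simp [Ioc_eq_empty_of_le this]
      rw [e1, integral_triangle_swap (integrable_convWave_integrand hw hC hf y y τ)]
      refine setIntegral_congr_fun measurableSet_Ioc fun s hs => ?_
      rw [ContinuousLinearMap.integral_comp_comm _ (hf.comp_sub_right s).integrableOn,
        integral_Ioc_comp_sub hs.2]

theorem stronglyMeasurable_front (hw : Continuous (Function.uncurry w)) :
    StronglyMeasurable (Function.uncurry (front w)) := by
  have h : StronglyMeasurable fun p : ℝ × ℝ =>
      (1 : E →L[ℂ] E) + Function.uncurry (timeIntegral w) p :=
    (continuous_const.add (continuous_timeIntegral hw)).stronglyMeasurable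
  exact h.indicator (measurableSet_le measurable_fst measurable_snd)

theorem norm_front_le (hC : ∀ x t, ‖w x t‖ ≤ C) {y s T : ℝ} (hT : 0 ≤ T) (h : s - y ≤ T) :
    ‖front w y s‖ ≤ 1 + C * T := by
  have hC0 : 0 ≤ C := (norm_nonneg _).trans (hC 0 0)
  refine (norm_indicator_le_norm_self _ _).trans ((norm_add_le _ _).trans ?_)
  refine add_le_add ContinuousLinearMap.norm_id_le ((norm_timeIntegral_le hC y s).trans ?_)
  exact mul_le_mul_of_nonneg_left (max_le hT h) hC0

/-- Duhamel's principle. `front` is the time primitive of the impulse response, and in a convolution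
the primitive may be moved onto the other factor `f`. -/
theorem integral_front [CompleteSpace E] (hw : Continuous (Function.uncurry w))
    (hC : ∀ x t, ‖w x t‖ ≤ C) (hf : Integrable f) (hf0 : ∀ t < 0, f t = 0) (y τ : ℝ) :
    ∫ s, front w y s (f (τ - s)) = convWave w (prim f) y τ := by
  have hC0 : 0 ≤ C := (norm_nonneg _).trans (hC 0 0)
  have hwy : Continuous (w y) := hw.comp (Continuous.prodMk_right y)
  rcases lt_or_ge τ y with h | h
  · rw [convWave_of_lt w (fun t ht => prim_of_nonpos hf0 ht.le) h]
    refine integral_eq_zero_of_ae (Filter.Eventually.of_forall fun s => ?_)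
    simp only [front, Pi.zero_apply]
    rcases lt_or_ge s y with hs | hs
    · rw [indicator_of_notMem (by simpa using hs)]
      rfl
    · rw [hf0 _ (by linarith), map_zero]
  have e1 : ∫ s, front w y s (f (τ - s)) = ∫ s in Ioc y τ, front w y s (f (τ - s)) := by
    rw [← integral_Icc_eq_integral_Ioc]
    symm
    refine setIntegral_eq_integral_of_forall_compl_eq_zero fun s hs => ?_
    rcases lt_or_ge s y with h1 | h1
    · simp only [front]
      rw [indicator_of_notMem (by simpa using h1)]
      rfl
    · have : τ < s := by
        by_contra h'
        exact hs ⟨h1, not_lt.1 h'⟩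
      rw [hf0 _ (by linarith), map_zero]
  have hint : Integrable (Function.uncurry fun s s' => w y s' (f (τ - s)))
      ((volume.restrict (Ioc y τ)).prod (volume.restrict (Ioc y τ))) := by
    have hg : Integrable (fun p : ℝ × ℝ => ‖f (τ - p.1)‖ * C)
        ((volume.restrict (Ioc y τ)).prod (volume.restrict (Ioc y τ))) :=
      Integrable.mul_prod (hf.comp_sub_left τ).norm.integrableOn (integrable_const C)
    refine hg.mono' ?_ (Filter.Eventually.of_forall fun p => ?_)
    · refine isBoundedBilinearMap_apply.continuous.comp_aestronglyMeasurable
        (AEStronglyMeasurable.prodMk ?_ ?_)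
      · exact (hwy.comp continuous_snd).aestronglyMeasurable
      · exact ((hf.comp_sub_left τ).integrableOn.aestronglyMeasurable).comp_fst
    · rw [mul_comm]
      exact (ContinuousLinearMap.le_opNorm _ _).trans
        (mul_le_mul_of_nonneg_right (hC _ _) (norm_nonneg _))
  have e2 : ∀ s ∈ Ioc y τ, front w y s (f (τ - s)) =
      f (τ - s) + ∫ s' in Ioc y s, w y s' (f (τ - s)) := by
    intro s hs
    simp only [front]
    rw [indicator_of_mem (by exact hs.1.le), add_apply, timeIntegral_of_ge _ hs.1.le,
      intervalIntegral.integral_of_le hs.1.le,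
      ContinuousLinearMap.integral_apply hwy.integrableOn_Ioc]
    rfl
  -- The inner integral is the difference of two integrable functions by the splitting `e2`, so no
  -- separate estimate is needed.
  have hI : Integrable (fun s => ∫ s' in Ioc y s, w y s' (f (τ - s)))
      (volume.restrict (Ioc y τ)) := by
    have hg : Integrable (fun s => front w y s (f (τ - s)) - f (τ - s))
        (volume.restrict (Ioc y τ)) := by
      refine Integrable.sub ?_ (hf.comp_sub_left τ).integrableOn
      refine ((hf.comp_sub_left τ).norm.const_mul (1 + C * (τ - y))).integrableOn.mono' ?_ ?_
      · refine isBoundedBilinearMap_apply.continuous.comp_aestronglyMeasurable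
          (AEStronglyMeasurable.prodMk ?_ (hf.comp_sub_left τ).integrableOn.aestronglyMeasurable)
        exact ((stronglyMeasurable_front hw).comp_measurable
          (measurable_prodMk_left (x := y))).aestronglyMeasurable
      · refine (ae_restrict_iff' measurableSet_Ioc).2 (Filter.Eventually.of_forall fun s hs => ?_)
        exact (ContinuousLinearMap.le_opNorm _ _).trans (mul_le_mul_of_nonneg_right
          (norm_front_le hC (by linarith) (by linarith [hs.2])) (norm_nonneg _))
    refine hg.congr ((ae_restrict_iff' measurableSet_Ioc).2
      (Filter.Eventually.of_forall fun s hs => ?_))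
    simp only
    rw [e2 s hs, add_sub_cancel_left]
  rw [e1, setIntegral_congr_fun measurableSet_Ioc e2,
    integral_add (hf.comp_sub_left τ).integrableOn hI, integral_Ioc_comp_sub_left h,
    integral_triangle_swap hint]
  unfold convWave
  congr 1
  refine setIntegral_congr_fun measurableSet_Ioc fun s hs => ?_
  rw [ContinuousLinearMap.integral_comp_comm _ (hf.comp_sub_left τ).integrableOn,
    integral_Ioc_comp_sub_left hs.2]

end ConvWave

/-! ### The Goursat equation as a retarded potential. -/

section Reflection

variable {E : Type*} [NormedAddCommGroup E] [NormedSpace ℂ E]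

/-- The difference of the direct and the reflected retarded potential at time `T`. -/
noncomputable def retardedDiff (T : ℝ) (q : ℝ → E →L[ℂ] E) (k : ℝ → ℝ → E) (x : ℝ) : E :=
  ∫ y, q y (k y (T - |x - y|) - k y (T - x - y))

variable {q : ℝ → E →L[ℂ] E} {w : ℝ → ℝ → E →L[ℂ] E} {C T : ℝ} {f : ℝ → E}

theorem aestronglyMeasurable_clm_apply {α : Type*} [MeasurableSpace α] {μ : Measure α}
    {A : α → E →L[ℂ] E} {g : α → E} (hA : AEStronglyMeasurable A μ)
    (hg : AEStronglyMeasurable g μ) : AEStronglyMeasurable (fun a => A a (g a)) μ :=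
  isBoundedBilinearMap_apply.continuous.comp_aestronglyMeasurable (hA.prodMk hg)

/-- `front` is a Heaviside step plus `timeIntegral`. The steps of the direct and the reflected
signal cancel except for `y` between `(s-x)/2` and `(s+x)/2`, exactly the range of the source term
in the Goursat equation. -/
theorem front_sub_front_eq (w : ℝ → ℝ → E →L[ℂ] E) {x y s : ℝ} (hx : 0 ≤ x) (hxs : x ≤ s) :
    front w y (s - |x - y|) - front w y (s - x - y) =
      (Ioc ((s - x) / 2) ((s + x) / 2)).indicator (fun _ => (1 : E →L[ℂ] E)) y +
        (timeIntegral w y (s - |x - y|) - timeIntegral w y (s - x - y)) := by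
  have h : ∀ τ, front w y τ = (Ici y).indicator (fun _ => (1 : E →L[ℂ] E)) τ
      + timeIntegral w y τ := by
    intro τ
    unfold front
    rcases lt_or_ge τ y with h | h
    · rw [indicator_of_notMem (notMem_Ici.2 h), indicator_of_notMem (notMem_Ici.2 h),
        timeIntegral_of_le w h.le, add_zero]
    · rw [indicator_of_mem (mem_Ici.2 h), indicator_of_mem (mem_Ici.2 h)]
  have h1 : y ≤ s - |x - y| ↔ y ≤ (s + x) / 2 := by
    rw [le_sub_comm, abs_le]
    constructor
    · rintro ⟨a, b⟩; linarith
    · intro a; constructor <;> linarith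
  have h2 : y ≤ s - x - y ↔ y ≤ (s - x) / 2 := by
    constructor <;> intro a <;> linarith
  have h3 : (Ici y).indicator (fun _ => (1 : E →L[ℂ] E)) (s - |x - y|)
      - (Ici y).indicator (fun _ => (1 : E →L[ℂ] E)) (s - x - y)
      = (Ioc ((s - x) / 2) ((s + x) / 2)).indicator (fun _ => (1 : E →L[ℂ] E)) y := by
    simp only [indicator_apply, mem_Ici, mem_Ioc, h1, h2]
    by_cases a : y ≤ (s - x) / 2
    · rw [if_pos a, if_pos (by linarith), if_neg (fun h => absurd h.1 (not_lt.2 a)), sub_self]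
    · rw [if_neg a, sub_zero]
      simp [not_le.1 a]
  rw [h, h, ← h3]
  abel

/-- The source and the Volterra term merge into one retarded potential of the step response. This
removes the separate inhomogeneity and prepares the convolution with a control. -/
theorem kernel_eq_integral_front (hq : Integrable q) (hq0 : ∀ y, y ∉ Icc 0 T → q y = 0)
    (hw : Continuous (Function.uncurry w)) (hC : ∀ x t, ‖w x t‖ ≤ C)
    (hker : ∀ x t, (x, t) ∈ triangle T → w x t =
        -((1 / 2 : ℝ) • ∫ s in ((t - x) / 2)..((t + x) / 2), q s)
          - (1 / 2 : ℝ) • goursatInt q w x t) {x s : ℝ} (hxs : (x, s) ∈ triangle T) :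
    w x s = -((1 / 2 : ℝ) • ∫ y, q y * (front w y (s - |x - y|) - front w y (s - x - y))) := by
  obtain ⟨h1, h2, h3⟩ := id hxs
  simp only at h1 h2 h3
  rw [hker x s hxs, ← neg_add', ← smul_add]
  congr 2
  unfold goursatInt
  rw [intervalIntegral.integral_of_le (by linarith), ← integral_indicator measurableSet_Ioc,
    ← integral_add ((integrable_indicator_iff measurableSet_Ioc).2 hq.integrableOn)
    (integrable_goursat_integrand hq hq0 hw hC h1 (h1.trans h2) h3)]
  refine integral_congr_ae (Filter.Eventually.of_forall fun y => ?_)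
  simp only
  rcases lt_or_ge y 0 with hy | hy
  · rw [hq0 y fun h => absurd h.1 (not_le.2 hy), zero_mul, zero_mul, add_zero, indicator_apply]
    rw [hq0 y fun h => absurd h.1 (not_le.2 hy)]
    simp
  · rw [front_sub_front_eq w h1 h2, mul_add]
    congr 1
    simp [indicator_apply]

theorem norm_front_apply_le (hC : ∀ x t, ‖w x t‖ ≤ C) {y s a : ℝ} (hT : 0 ≤ T)
    (hf0 : ∀ t < 0, f t = 0) (ha : 0 ≤ a) (hy : 0 ≤ y) :
    ‖front w y (s - a) (f (T - s))‖ ≤ (1 + C * T) * ‖f (T - s)‖ := by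
  rcases lt_or_ge T s with h | h
  · simp [hf0 (T - s) (by linarith)]
  · exact (ContinuousLinearMap.le_opNorm _ _).trans (mul_le_mul_of_nonneg_right
      (norm_front_le hC hT (by linarith)) (norm_nonneg _))

/-- A delay `a` of the step response becomes the evaluation time `T - a` of the wave. The lower
limit `x` loses nothing: for `s < x ≤ a + y` the front has not reached `y` at time `s - a`. -/
theorem integral_front_shift [CompleteSpace E] (hw : Continuous (Function.uncurry w))
    (hC : ∀ x t, ‖w x t‖ ≤ C)
    (hf : Integrable f) (hf0 : ∀ t < 0, f t = 0) {x y a : ℝ} (ha : x ≤ a + y) :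
    ∫ s in Ioc x T, front w y (s - a) (f (T - s)) = convWave w (prim f) y (T - a) := by
  rw [← integral_front hw hC hf hf0, ← integral_Icc_eq_integral_Ioc,
    ← integral_sub_right_eq_self (fun s => front w y s (f (T - a - s))) a]
  simp_rw [show ∀ s, T - a - (s - a) = T - s from fun s => by ring]
  refine setIntegral_eq_integral_of_forall_compl_eq_zero fun s hs => ?_
  rcases lt_or_ge s x with h | h
  · unfold front
    rw [indicator_of_notMem (notMem_Ici.2 (by linarith))]
    rfl
  · have : T < s := by
      by_contra h'
      exact hs ⟨h, not_lt.1 h'⟩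
    rw [hf0 _ (by linarith), map_zero]

/-- The retarded potential for `w` is convolved with `f`; after Fubini the integral over `s` is
Duhamel's formula at each `y`. The gain is that `x` no longer enters through the kernel but only
through the delays of the wave of `prim f`. -/
theorem integral_kernel_eq_retardedDiff [CompleteSpace E] (hT : 0 ≤ T) (hq : Integrable q)
    (hq0 : ∀ y, y ∉ Icc 0 T → q y = 0)
    (hw : Continuous (Function.uncurry w)) (hC : ∀ x t, ‖w x t‖ ≤ C)
    (hker : ∀ x t, (x, t) ∈ triangle T → w x t =
        -((1 / 2 : ℝ) • ∫ s in ((t - x) / 2)..((t + x) / 2), q s)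
          - (1 / 2 : ℝ) • goursatInt q w x t)
    (hf : Integrable f) (hf0 : ∀ t < 0, f t = 0) {x : ℝ} (hx0 : 0 ≤ x) :
    ∫ s in Ioc x T, w x s (f (T - s)) =
      -((1 / 2 : ℝ) • retardedDiff T q (convWave w (prim f)) x) := by
  have hC0 : 0 ≤ C := (norm_nonneg _).trans (hC 0 0)
  have hfr := stronglyMeasurable_front hw
  set K : ℝ → ℝ → E := fun s y =>
    q y (front w y (s - |x - y|) (f (T - s)) - front w y (s - x - y) (f (T - s))) with hK
  have hb : ∀ s y, ‖K s y‖ ≤ ‖f (T - s)‖ * (2 * (1 + C * T) * ‖q y‖) := by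
    intro s y
    by_cases hy : y ∈ Icc 0 T
    · have e1 := norm_front_apply_le (s := s) hC hT hf0 (abs_nonneg (x - y)) hy.1
      have e2 := norm_front_apply_le (s := s) hC hT hf0 (add_nonneg hx0 hy.1) hy.1
      rw [← sub_sub] at e2
      calc _ ≤ ‖q y‖ * ((1 + C * T) * ‖f (T - s)‖ + (1 + C * T) * ‖f (T - s)‖) :=
            (ContinuousLinearMap.le_opNorm _ _).trans (mul_le_mul_of_nonneg_left
              ((norm_sub_le _ _).trans (add_le_add e1 e2)) (norm_nonneg _))
        _ = _ := by ring
    · simp [hK, hq0 y hy]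
  have hKi : Integrable (Function.uncurry K) ((volume.restrict (Ioc x T)).prod volume) := by
    have hg : Integrable (fun p : ℝ × ℝ => ‖f (T - p.1)‖ * (2 * (1 + C * T) * ‖q p.2‖))
        ((volume.restrict (Ioc x T)).prod volume) :=
      Integrable.mul_prod (hf.comp_sub_left T).norm.integrableOn (hq.norm.const_mul _)
    refine hg.mono' ?_ (Filter.Eventually.of_forall fun p => hb p.1 p.2)
    have hfm : AEStronglyMeasurable (fun p : ℝ × ℝ => f (T - p.1))
        ((volume.restrict (Ioc x T)).prod volume) :=
      (hf.comp_sub_left T).integrableOn.aestronglyMeasurable.comp_fst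
    refine aestronglyMeasurable_clm_apply hq.aestronglyMeasurable.comp_snd
      (AEStronglyMeasurable.sub (aestronglyMeasurable_clm_apply ?_ hfm)
        (aestronglyMeasurable_clm_apply ?_ hfm))
    · exact (hfr.comp_measurable (by fun_prop : Measurable fun p : ℝ × ℝ =>
        (p.2, p.1 - |x - p.2|))).aestronglyMeasurable
    · exact (hfr.comp_measurable (by fun_prop : Measurable fun p : ℝ × ℝ =>
        (p.2, p.1 - x - p.2))).aestronglyMeasurable
  have e1 : ∀ s ∈ Ioc x T, w x s (f (T - s)) = -((1 / 2 : ℝ) • ∫ y, K s y) := by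
    intro s hs
    have hint : Integrable fun y => q y * (front w y (s - |x - y|) - front w y (s - x - y)) := by
      refine (hq.norm.mul_const ((1 + C * T) + (1 + C * T))).mono' ?_
        (Filter.Eventually.of_forall fun y => ?_)
      · refine hq.aestronglyMeasurable.mul (AEStronglyMeasurable.sub ?_ ?_)
        · exact (hfr.comp_measurable (by fun_prop : Measurable fun y : ℝ =>
            (y, s - |x - y|))).aestronglyMeasurable
        · exact (hfr.comp_measurable (by fun_prop : Measurable fun y : ℝ =>
            (y, s - x - y))).aestronglyMeasurable
      · by_cases hy : y ∈ Icc 0 T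
        · refine (norm_mul_le _ _).trans (mul_le_mul_of_nonneg_left
            ((norm_sub_le _ _).trans (add_le_add ?_ ?_)) (norm_nonneg _))
          · exact norm_front_le hC hT (by linarith [abs_nonneg (x - y), hy.1, hs.2])
          · exact norm_front_le hC hT (by linarith [hy.1, hs.2])
        · simp [hq0 y hy]
    rw [kernel_eq_integral_front hq hq0 hw hC hker ⟨hx0, hs.1.le, hs.2⟩, neg_apply, smul_apply,
      ContinuousLinearMap.integral_apply hint]
    rfl
  rw [setIntegral_congr_fun measurableSet_Ioc e1, integral_neg, integral_smul,
    integral_integral_swap hKi]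
  congr 2
  refine integral_congr_ae (Filter.Eventually.of_forall fun y => ?_)
  simp only
  by_cases hy : y ∈ Icc 0 T
  · have hi : ∀ a, 0 ≤ a → Integrable (fun s => front w y (s - a) (f (T - s)))
        (volume.restrict (Ioc x T)) := by
      intro a ha
      refine ((hf.comp_sub_left T).norm.const_mul (1 + C * T)).integrableOn.mono' ?_
        (Filter.Eventually.of_forall fun s => norm_front_apply_le hC hT hf0 ha hy.1)
      refine aestronglyMeasurable_clm_apply ?_ (hf.comp_sub_left T).integrableOn.aestronglyMeasurable
      exact (hfr.comp_measurable (by fun_prop : Measurable fun s : ℝ =>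
            (y, s - a))).aestronglyMeasurable
    have hi1 := hi _ (abs_nonneg (x - y))
    have hi2 := hi _ (add_nonneg hx0 hy.1)
    simp_rw [← sub_sub] at hi2
    simp only [hK]
    rw [(q y).integral_comp_comm (φ := fun s => front w y (s - |x - y|) (f (T - s)) -
      front w y (s - x - y) (f (T - s))) (hi1.sub hi2), integral_sub hi1 hi2,
      integral_front_shift hw hC hf hf0 (by linarith [le_abs_self (x - y)])]
    simp_rw [sub_sub]
    rw [integral_front_shift hw hC hf hf0 (by linarith [hy.1])]
  · simp [hK, hq0 y hy]

end Reflection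

/-! ### Square integrability of retarded potentials. -/

theorem ENNReal.add_sq_le_four_mul (a b : ENNReal) : (a + b) ^ 2 ≤ 4 * (a ^ 2 + b ^ 2) := by
  have h : ∀ c d : ENNReal, c ≤ d → (c + d) ^ 2 ≤ 4 * (c ^ 2 + d ^ 2) := by
    intro c d hcd
    calc (c + d) ^ 2 ≤ (d + d) ^ 2 := by gcongr
      _ = 4 * d ^ 2 := by ring
      _ ≤ _ := by gcongr; exact le_add_self
  rcases le_total a b with hab | hab
  · exact h a b hab
  · rw [add_comm a, add_comm (a ^ 2)]
    exact h b a hab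

theorem ENNReal.le_one_add_sq (a : ENNReal) : a ≤ 1 + a ^ 2 := by
  rcases le_total a 1 with h | h
  · exact h.trans le_self_add
  · refine le_trans ?_ le_add_self
    rw [sq]
    exact le_mul_of_one_le_left' h

section KernelIntegral

variable {E : Type*} [NormedAddCommGroup E] [NormedSpace ℂ E]

theorem memLp_two_of_lintegral_sq_lt_top {F : Type*} [NormedAddCommGroup F] {α : Type*}
    [MeasurableSpace α] {μ : Measure α} {g : α → F}
    (hg : AEStronglyMeasurable g μ) (h : ∫⁻ x, ‖g x‖ₑ ^ 2 ∂μ < ⊤) : MemLp g 2 μ := by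
  refine ⟨hg, ?_⟩
  rw [eLpNorm_lt_top_iff_lintegral_rpow_enorm_lt_top (by norm_num) (by norm_num)]
  simpa using h

theorem lintegral_sq_lt_top_of_memLp_two {F : Type*} [NormedAddCommGroup F] {α : Type*}
    [MeasurableSpace α] {μ : Measure α} {g : α → F} (hg : MemLp g 2 μ) :
    ∫⁻ x, ‖g x‖ₑ ^ 2 ∂μ < ⊤ := by
  have := hg.2
  rw [eLpNorm_lt_top_iff_lintegral_rpow_enorm_lt_top (by norm_num) (by norm_num)] at this
  simpa using this

variable {q : ℝ → E →L[ℂ] E} {T : ℝ} {κ : ℝ → ℝ → E} {D : ENNReal}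

/-- The uniform bound on the `x`-slices in `L₂` controls them in `L₁` by `a ≤ 1 + a²`; integrability
of `q` then handles `y`. This justifies the exchanges of integrals below. -/
theorem integrable_kernel_prod (hq : Integrable q)
    (hq0 : ∀ y, y ∉ Icc 0 T → q y = 0) (hκ : StronglyMeasurable (Function.uncurry κ))
    (hD : D ≠ ⊤) (hκD : ∀ y ∈ Icc 0 T, ∫⁻ x in Icc 0 T, ‖κ x y‖ₑ ^ 2 ≤ D) :
    Integrable (Function.uncurry fun x y => q y (κ x y))
      ((volume.restrict (Icc 0 T)).prod volume) := by
  have hm : AEStronglyMeasurable (Function.uncurry fun x y => q y (κ x y))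
      ((volume.restrict (Icc 0 T)).prod volume) :=
    aestronglyMeasurable_clm_apply hq.aestronglyMeasurable.comp_snd hκ.aestronglyMeasurable
  refine ⟨hm, ?_⟩
  rw [HasFiniteIntegral, lintegral_prod_symm _ hm.enorm]
  have hb : ∀ y, ∫⁻ x in Icc 0 T, ‖q y (κ x y)‖ₑ ≤ ‖q y‖ₑ * (ENNReal.ofReal T + D) := by
    intro y
    by_cases hy : y ∈ Icc 0 T
    · calc ∫⁻ x in Icc 0 T, ‖q y (κ x y)‖ₑ
          ≤ ∫⁻ x in Icc 0 T, ‖q y‖ₑ * (1 + ‖κ x y‖ₑ ^ 2) := by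
            refine lintegral_mono fun x => ((q y).le_opENorm _).trans ?_
            gcongr
            exact ENNReal.le_one_add_sq _
        _ = ‖q y‖ₑ * (ENNReal.ofReal T + ∫⁻ x in Icc 0 T, ‖κ x y‖ₑ ^ 2) := by
            rw [lintegral_const_mul' _ _ (by simp), lintegral_add_left measurable_const]
            simp
        _ ≤ _ := by gcongr; exact hκD y hy
    · simp [hq0 y hy]
  refine (lintegral_mono hb).trans_lt ?_
  rw [lintegral_mul_const' _ _ (by simp [hD])]
  exact ENNReal.mul_lt_top hq.2 (by simp [hD.lt_top])

/-- Cauchy–Schwarz in `y` separates `‖q‖₂²` from the double integral of `‖κ‖²`, which after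
exchanging the order is at most `T · D`. -/
theorem memLp_kernel_integral (hq2 : MemLp q 2) (hq : Integrable q)
    (hq0 : ∀ y, y ∉ Icc 0 T → q y = 0) (hκ : StronglyMeasurable (Function.uncurry κ))
    (hD : D ≠ ⊤) (hκD : ∀ y ∈ Icc 0 T, ∫⁻ x in Icc 0 T, ‖κ x y‖ₑ ^ 2 ≤ D) :
    MemLp (fun x => ∫ y, q y (κ x y)) 2 (volume.restrict (Icc 0 T)) := by
  have hm : AEStronglyMeasurable (Function.uncurry fun x y => q y (κ x y))
      ((volume.restrict (Icc 0 T)).prod volume) :=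
    aestronglyMeasurable_clm_apply hq.aestronglyMeasurable.comp_snd hκ.aestronglyMeasurable
  refine memLp_two_of_lintegral_sq_lt_top hm.integral_prod_right' ?_
  have hb : ∀ x, ‖∫ y, q y (κ x y)‖ₑ ^ 2 ≤
      (∫⁻ y, ‖q y‖ₑ ^ 2) * ∫⁻ y in Icc 0 T, ‖κ x y‖ₑ ^ 2 := by
    intro x
    have h1 : ‖∫ y, q y (κ x y)‖ₑ ≤
        ∫⁻ y in Icc 0 T, ((fun y => ‖q y‖ₑ) * fun y => ‖κ x y‖ₑ) y := by
      refine (enorm_integral_le_lintegral_enorm _).trans ?_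
      rw [← lintegral_indicator measurableSet_Icc]
      refine lintegral_mono fun y => ?_
      by_cases hy : y ∈ Icc 0 T
      · rw [indicator_of_mem hy]
        exact (q y).le_opENorm _
      · simp [hq0 y hy]
    have hκx : StronglyMeasurable (κ x) := hκ.comp_measurable measurable_prodMk_left
    have h2 := ENNReal.lintegral_mul_le_Lp_mul_Lq (volume.restrict (Icc 0 T))
      Real.HolderConjugate.two_two hq.aestronglyMeasurable.enorm.restrict
      hκx.enorm.aemeasurable
    have h3 := pow_le_pow_left₀ zero_le (h1.trans h2) 2
    refine h3.trans ?_
    rw [mul_pow, ← ENNReal.rpow_natCast, ← ENNReal.rpow_mul, ← ENNReal.rpow_natCast,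
      ← ENNReal.rpow_mul]
    simp only [Nat.cast_ofNat, one_div, ne_eq, OfNat.ofNat_ne_zero, not_false_eq_true,
      inv_mul_cancel₀, ENNReal.rpow_one, ENNReal.rpow_ofNat]
    gcongr
    exact Measure.restrict_le_self
  refine (lintegral_mono hb).trans_lt ?_
  have hκm : Measurable (Function.uncurry fun x y => ‖κ x y‖ₑ ^ 2) := hκ.enorm.pow_const 2
  rw [lintegral_const_mul' _ _ (lintegral_sq_lt_top_of_memLp_two hq2).ne,
    lintegral_lintegral_swap hκm.aemeasurable]
  refine ENNReal.mul_lt_top (lintegral_sq_lt_top_of_memLp_two hq2) ?_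
  calc ∫⁻ y in Icc 0 T, ∫⁻ x in Icc 0 T, ‖κ x y‖ₑ ^ 2 ≤ ∫⁻ y in Icc 0 T, D :=
        setLIntegral_mono measurable_const hκD
    _ < ⊤ := by simp [ENNReal.mul_lt_top_iff, hD.lt_top]

/-- A measurable family of causal signals, uniformly square integrable up to time `T`. -/
structure IsCausalFamily (T : ℝ) (k : ℝ → ℝ → E) : Prop where
  stronglyMeasurable : StronglyMeasurable (Function.uncurry k)
  eq_zero : ∀ y ∈ Icc 0 T, ∀ τ < 0, k y τ = 0
  bound : ∃ D : ENNReal, D ≠ ⊤ ∧ ∀ y ∈ Icc 0 T, ∫⁻ τ in Icc 0 T, ‖k y τ‖ₑ ^ 2 ≤ D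

/-- The sum of the direct retarded potential, with the sign of its direction, and the reflected
one at time `T`. -/
noncomputable def retardedSum (T : ℝ) (q : ℝ → E →L[ℂ] E) (k : ℝ → ℝ → E) (x : ℝ) : E :=
  ∫ y, q y ((if x < y then (1 : ℝ) else -1) • k y (T - |x - y|) + k y (T - x - y))

variable {k : ℝ → ℝ → E}

omit [NormedSpace ℂ E] in
theorem lintegral_direct_le {y : ℝ} {D : ENNReal} (hy : y ∈ Icc 0 T)
    (hm : StronglyMeasurable (k y)) (hD : ∫⁻ τ in Icc 0 T, ‖k y τ‖ₑ ^ 2 ≤ D) :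
    ∫⁻ x in Icc 0 T, ‖k y (T - |x - y|)‖ₑ ^ 2 ≤ 2 * D := by
  set g : ℝ → ENNReal := (Icc 0 T).indicator fun τ => ‖k y τ‖ₑ ^ 2 with hg
  have hgm : Measurable g := (hm.enorm.pow_const 2).indicator measurableSet_Icc
  have hgi : ∫⁻ τ, g τ ≤ D := by rwa [hg, lintegral_indicator measurableSet_Icc]
  calc _ ≤ ∫⁻ x in Icc 0 T, (g (T + y - x) + g (x + (T - y))) := by
        refine setLIntegral_mono (by fun_prop) fun x hx => ?_
        -- On either side of `y` the map `x ↦ T - |x-y|` is an isometry; each branch costs at most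
        -- `D`, hence the factor `2`.
        rcases le_total x y with h | h
        · refine le_trans ?_ le_add_self
          rw [hg, indicator_of_mem (by constructor <;> linarith [hx.1, hx.2, hy.2]),
            abs_of_nonpos (by linarith)]
          ring_nf
          rfl
        · refine le_trans ?_ le_self_add
          rw [hg, indicator_of_mem (by constructor <;> linarith [hx.1, hx.2, hy.1]),
            abs_of_nonneg (by linarith)]
          ring_nf
          rfl
    _ ≤ ∫⁻ x, (g (T + y - x) + g (x + (T - y))) := setLIntegral_le_lintegral _ _
    _ = 2 * ∫⁻ τ, g τ := by
        rw [lintegral_add_left (by fun_prop), lintegral_sub_left_eq_self g (T + y),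
          lintegral_add_right_eq_self g (T - y), two_mul]
    _ ≤ _ := by gcongr

omit [NormedSpace ℂ E] in
theorem lintegral_reflected_le {y : ℝ} {D : ENNReal} (hy : y ∈ Icc 0 T)
    (h0 : ∀ τ < 0, k y τ = 0) (hD : ∫⁻ τ in Icc 0 T, ‖k y τ‖ₑ ^ 2 ≤ D) :
    ∫⁻ x in Icc 0 T, ‖k y (T - x - y)‖ₑ ^ 2 ≤ D := by
  set g : ℝ → ENNReal := (Icc 0 T).indicator fun τ => ‖k y τ‖ₑ ^ 2 with hg
  have hgi : ∫⁻ τ, g τ ≤ D := by rwa [hg, lintegral_indicator measurableSet_Icc]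
  calc _ ≤ ∫⁻ x in Icc 0 T, g (T - y - x) := by
        refine setLIntegral_mono' measurableSet_Icc fun x hx => ?_
        rw [sub_right_comm]
        rcases lt_or_ge (T - y - x) 0 with h | h
        · simp [h0 _ h]
        · rw [hg, indicator_of_mem (by constructor <;> linarith [hx.1, hy.1])]
    _ ≤ ∫⁻ x, g (T - y - x) := setLIntegral_le_lintegral _ _
    _ = ∫⁻ τ, g τ := lintegral_sub_left_eq_self g (T - y)
    _ ≤ D := hgi

omit [NormedSpace ℂ E] in
theorem IsCausalFamily.slice (hk : IsCausalFamily T k) (y : ℝ) : StronglyMeasurable (k y) :=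
  hk.stronglyMeasurable.comp_measurable measurable_prodMk_left

omit [NormedSpace ℂ E] in
theorem IsCausalFamily.exists_bound (hk : IsCausalFamily T k) {κ : ℝ → ℝ → E}
    (hκ : ∀ x y, ‖κ x y‖ ≤ ‖k y (T - |x - y|)‖ + ‖k y (T - x - y)‖) :
    ∃ D : ENNReal, D ≠ ⊤ ∧ ∀ y ∈ Icc 0 T, ∫⁻ x in Icc 0 T, ‖κ x y‖ₑ ^ 2 ≤ D := by
  obtain ⟨D, hD, h⟩ := hk.bound
  refine ⟨4 * (2 * D + D), by finiteness, fun y hy => ?_⟩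
  have hm1 : StronglyMeasurable fun x => k y (T - |x - y|) :=
    (hk.slice y).comp_measurable (by fun_prop)
  calc _ ≤ ∫⁻ x in Icc 0 T, 4 * (‖k y (T - |x - y|)‖ₑ ^ 2 + ‖k y (T - x - y)‖ₑ ^ 2) := by
        refine lintegral_mono fun x => le_trans ?_ (ENNReal.add_sq_le_four_mul _ _)
        gcongr
        have := hκ x y
        simp only [← ofReal_norm, ← ENNReal.ofReal_add (norm_nonneg _) (norm_nonneg _)]
        exact ENNReal.ofReal_le_ofReal this
    _ ≤ _ := by
        rw [lintegral_const_mul' _ _ (by simp), lintegral_add_left (hm1.enorm.pow_const 2)]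
        gcongr
        · exact lintegral_direct_le hy (hk.slice y) (h y hy)
        · exact lintegral_reflected_le hy (hk.eq_zero y hy) (h y hy)

theorem integrableOn_of_lintegral_sq_le {F : Type*} [NormedAddCommGroup F] {g : ℝ → F}
    {D : ENNReal} (hD : D ≠ ⊤)
    (hg : StronglyMeasurable g) (h : ∫⁻ x in Icc 0 T, ‖g x‖ₑ ^ 2 ≤ D) :
    IntegrableOn g (Icc 0 T) :=
  (memLp_two_of_lintegral_sq_lt_top hg.aestronglyMeasurable
    (h.trans_lt hD.lt_top)).integrable (by norm_num)

theorem stronglyMeasurable_sumKernel (hk : StronglyMeasurable (Function.uncurry k)) :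
    StronglyMeasurable (Function.uncurry fun x y =>
      (if x < y then (1 : ℝ) else -1) • k y (T - |x - y|) + k y (T - x - y)) := by
  refine StronglyMeasurable.add (StronglyMeasurable.smul
    (f := fun p : ℝ × ℝ => if p.1 < p.2 then (1 : ℝ) else -1) ?_ ?_) ?_
  · exact (Measurable.ite (measurableSet_lt measurable_fst measurable_snd)
      measurable_const measurable_const).stronglyMeasurable
  · exact hk.comp_measurable (by fun_prop : Measurable fun p : ℝ × ℝ => (p.2, T - |p.1 - p.2|))
  · exact hk.comp_measurable (by fun_prop : Measurable fun p : ℝ × ℝ => (p.2, T - p.1 - p.2))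

omit [NormedSpace ℂ E] in
theorem stronglyMeasurable_diffKernel (hk : StronglyMeasurable (Function.uncurry k)) :
    StronglyMeasurable (Function.uncurry fun x y =>
      k y (T - |x - y|) - k y (T - x - y)) := by
  refine StronglyMeasurable.sub ?_ ?_
  · exact hk.comp_measurable (by fun_prop : Measurable fun p : ℝ × ℝ => (p.2, T - |p.1 - p.2|))
  · exact hk.comp_measurable (by fun_prop : Measurable fun p : ℝ × ℝ => (p.2, T - p.1 - p.2))

theorem norm_sumKernel_le (x y : ℝ) :
    ‖(if x < y then (1 : ℝ) else -1) • k y (T - |x - y|) + k y (T - x - y)‖ ≤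
      ‖k y (T - |x - y|)‖ + ‖k y (T - x - y)‖ := by
  refine (norm_add_le _ _).trans ?_
  rw [norm_smul]
  split_ifs <;> simp

theorem IsCausalFamily.memLp_retardedSum (hk : IsCausalFamily T k) (hq2 : MemLp q 2)
    (hq : Integrable q) (hq0 : ∀ y, y ∉ Icc 0 T → q y = 0) :
    MemLp (retardedSum T q k) 2 (volume.restrict (Icc 0 T)) := by
  obtain ⟨D, hD, h⟩ := hk.exists_bound norm_sumKernel_le
  exact memLp_kernel_integral hq2 hq hq0 (stronglyMeasurable_sumKernel hk.stronglyMeasurable) hD h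

theorem IsCausalFamily.memLp_retardedDiff (hk : IsCausalFamily T k) (hq2 : MemLp q 2)
    (hq : Integrable q) (hq0 : ∀ y, y ∉ Icc 0 T → q y = 0) :
    MemLp (retardedDiff T q k) 2 (volume.restrict (Icc 0 T)) := by
  obtain ⟨D, hD, h⟩ := hk.exists_bound fun x y => norm_sub_le (k y (T - |x - y|)) (k y (T - x - y))
  exact memLp_kernel_integral hq2 hq hq0 (stronglyMeasurable_diffKernel hk.stronglyMeasurable) hD h

end KernelIntegral

/-! ### Differentiating retarded potentials in space. -/

section PathIntegral

variable {E : Type*} [NormedAddCommGroup E] [NormedSpace ℂ E]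
variable {q : ℝ → E →L[ℂ] E} {T : ℝ} {k P : ℝ → ℝ → E}

omit [NormedSpace ℂ E] in
theorem IsCausalFamily.integrableOn_Iic (hk : IsCausalFamily T k) {y : ℝ} (hy : y ∈ Icc 0 T) :
    IntegrableOn (k y) (Iic T) := by
  obtain ⟨D, hD, h⟩ := hk.bound
  have h1 : IntegrableOn (k y) (Icc 0 T) := integrableOn_of_lintegral_sq_le hD (hk.slice y) (h y hy)
  have h2 : IntegrableOn (k y) (Iio 0) :=
    integrableOn_zero.congr_fun (fun τ hτ => (hk.eq_zero y hy τ hτ).symm) measurableSet_Iio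
  refine (h2.union h1).mono_set fun τ hτ => ?_
  rcases lt_or_ge τ 0 with h0 | h0
  · exact Or.inl h0
  · exact Or.inr ⟨h0, hτ⟩

omit [NormedSpace ℂ E] in
theorem IsCausalFamily.intervalIntegrable (hk : IsCausalFamily T k) {y : ℝ} (hy : y ∈ Icc 0 T)
    {a b : ℝ} (ha : a ≤ T) (hb : b ≤ T) : IntervalIntegrable (k y) volume a b :=
  intervalIntegrable_iff.2 ((hk.integrableOn_Iic hy).mono_set fun _ hτ => hτ.2.trans (max_le ha hb))

omit [NormedSpace ℂ E] in
theorem IsCausalFamily.integrableOn_direct (hk : IsCausalFamily T k) {y : ℝ} (hy : y ∈ Icc 0 T) :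
    IntegrableOn (fun x => k y (T - |x - y|)) (Icc 0 T) := by
  obtain ⟨D, hD, h⟩ := hk.bound
  exact integrableOn_of_lintegral_sq_le (D := 2 * D) (by finiteness)
    ((hk.slice y).comp_measurable (by fun_prop)) (lintegral_direct_le hy (hk.slice y) (h y hy))

omit [NormedSpace ℂ E] in
theorem IsCausalFamily.integrableOn_reflected (hk : IsCausalFamily T k) {y : ℝ}
    (hy : y ∈ Icc 0 T) : IntegrableOn (fun x => k y (T - x - y)) (Icc 0 T) := by
  obtain ⟨D, hD, h⟩ := hk.bound
  exact integrableOn_of_lintegral_sq_le hD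
    ((hk.slice y).comp_measurable (by fun_prop)) (lintegral_reflected_le hy (hk.eq_zero y hy) (h y hy))

/-- `P` is the time primitive of the family `k` up to time `T`. -/
def IsTimePrimitive (T : ℝ) (P k : ℝ → ℝ → E) : Prop :=
  ∀ y ∈ Icc 0 T, ∀ τ ≤ T, P y τ = ∫ σ in (0 : ℝ)..τ, k y σ

theorem IsTimePrimitive.sub (hP : IsTimePrimitive T P k) (hk : IsCausalFamily T k) {y a b : ℝ}
    (hy : y ∈ Icc 0 T) (ha : a ≤ T) (hb : b ≤ T) : P y b - P y a = ∫ σ in a..b, k y σ := by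
  have h0 : (0 : ℝ) ≤ T := hy.1.trans hy.2
  rw [hP y hy b hb, hP y hy a ha, intervalIntegral.integral_interval_sub_left
    (hk.intervalIntegrable hy h0 hb) (hk.intervalIntegrable hy h0 ha)]

theorem IsTimePrimitive.integral_direct_of_le (hP : IsTimePrimitive T P k)
    (hk : IsCausalFamily T k) {x y : ℝ} (hy : y ∈ Icc 0 T) (hx : 0 ≤ x) (hxy : x ≤ y) :
    ∫ x' in (0 : ℝ)..x, k y (T - |x' - y|) = P y (T - |x - y|) - P y (T - y) := by
  have e : ∫ x' in (0 : ℝ)..x, k y (T - |x' - y|) = ∫ x' in (0 : ℝ)..x, k y (x' + (T - y)) := by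
    refine intervalIntegral.integral_congr fun x' hx' => ?_
    rw [uIcc_of_le hx] at hx'
    rw [abs_of_nonpos (by linarith [hx'.2])]
    congr 1
    ring
  rw [e, intervalIntegral.integral_comp_add_right, abs_of_nonpos (by linarith),
    hP.sub hk hy (by linarith [hy.1]) (by linarith)]
  congr 1 <;> ring

theorem IsTimePrimitive.integral_direct_of_ge (hP : IsTimePrimitive T P k)
    (hk : IsCausalFamily T k) {x y : ℝ} (hy : y ∈ Icc 0 T) (hxy : y ≤ x) :
    ∫ x' in y..x, k y (T - |x' - y|) = P y T - P y (T - |x - y|) := by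
  have e : ∫ x' in y..x, k y (T - |x' - y|) = ∫ x' in y..x, k y (T + y - x') := by
    refine intervalIntegral.integral_congr fun x' hx' => ?_
    rw [uIcc_of_le hxy] at hx'
    rw [abs_of_nonneg (by linarith [hx'.1])]
    congr 1
    ring
  rw [e, intervalIntegral.integral_comp_sub_left, abs_of_nonneg (by linarith),
    hP.sub hk hy (by linarith) le_rfl]
  congr 1 <;> ring

theorem IsTimePrimitive.integral_reflected (hP : IsTimePrimitive T P k)
    (hk : IsCausalFamily T k) {x y : ℝ} (hy : y ∈ Icc 0 T) (hx : 0 ≤ x) :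
    ∫ x' in (0 : ℝ)..x, k y (T - x' - y) = P y (T - y) - P y (T - x - y) := by
  simp_rw [sub_right_comm T _ y]
  rw [intervalIntegral.integral_comp_sub_left, sub_zero,
    hP.sub hk hy (by linarith [hy.1]) (by linarith [hy.1])]

omit [NormedSpace ℂ E] in
theorem IsCausalFamily.intervalIntegrable_direct (hk : IsCausalFamily T k) {a b y : ℝ}
    (hy : y ∈ Icc 0 T) (ha : a ∈ Icc 0 T) (hb : b ∈ Icc 0 T) :
    IntervalIntegrable (fun x => k y (T - |x - y|)) volume a b :=
  ((hk.integrableOn_direct hy).mono_set (uIcc_subset_Icc ha hb)).intervalIntegrable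

omit [NormedSpace ℂ E] in
theorem IsCausalFamily.intervalIntegrable_reflected (hk : IsCausalFamily T k) {a b y : ℝ}
    (hy : y ∈ Icc 0 T) (ha : a ∈ Icc 0 T) (hb : b ∈ Icc 0 T) :
    IntervalIntegrable (fun x => k y (T - x - y)) volume a b :=
  ((hk.integrableOn_reflected hy).mono_set (uIcc_subset_Icc ha hb)).intervalIntegrable

/-- Away from `x = y` the signed direct term has derivative `k y (T - |x-y|)` on both sides. At `x =
y` its sign flips while the value is `P y T`, so a jump of `-2 P y T` has to be recorded. -/
theorem IsTimePrimitive.integral_direct (hP : IsTimePrimitive T P k)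
    (hk : IsCausalFamily T k) {x y : ℝ} (hy : y ∈ Icc 0 T) (hx : x ∈ Icc 0 T) :
    (if x < y then (1 : ℝ) else -1) • P y (T - |x - y|) = P y (T - y) +
      (∫ x' in (0 : ℝ)..x, k y (T - |x' - y|)) - (Iic x).indicator (fun y => (2 : ℝ) • P y T) y := by
  rcases lt_or_ge x y with h | h
  · rw [hP.integral_direct_of_le hk hy hx.1 h.le, if_pos h, indicator_of_notMem (by simpa using h)]
    simp
  · have h0T : (0 : ℝ) ∈ Icc 0 T := ⟨le_rfl, hy.1.trans hy.2⟩
    rw [← intervalIntegral.integral_add_adjacent_intervals (hk.intervalIntegrable_direct hy h0T hy)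
      (hk.intervalIntegrable_direct hy hy hx), hP.integral_direct_of_le hk hy hy.1 le_rfl,
      hP.integral_direct_of_ge hk hy h, if_neg (not_lt.2 h), indicator_of_mem (mem_Iic.2 h)]
    simp only [sub_self, abs_zero, sub_zero, neg_smul, one_smul, two_smul]
    abel

/-- Without the sign the direct term is continuous across `x = y`, so only the two one-sided
derivatives, of opposite signs, appear. -/
theorem IsTimePrimitive.integral_signed_direct (hP : IsTimePrimitive T P k)
    (hk : IsCausalFamily T k) {x y : ℝ} (hy : y ∈ Icc 0 T) (hx : x ∈ Icc 0 T) :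
    IntervalIntegrable (fun x' => (if x' < y then (1 : ℝ) else -1) • k y (T - |x' - y|))
        volume 0 x ∧
    ∫ x' in (0 : ℝ)..x, (if x' < y then (1 : ℝ) else -1) • k y (T - |x' - y|) =
      P y (T - |x - y|) - P y (T - y) := by
  have h1 : ∀ x ≤ y, 0 ≤ x →
      IntervalIntegrable (fun x' => (if x' < y then (1 : ℝ) else -1) • k y (T - |x' - y|))
        volume 0 x ∧
      ∫ x' in (0 : ℝ)..x, (if x' < y then (1 : ℝ) else -1) • k y (T - |x' - y|) =
      P y (T - |x - y|) - P y (T - y) := by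
    intro x hxy hx0
    have hae : ∀ᵐ x' ∂volume, x' ∈ uIoc 0 x →
        k y (T - |x' - y|) = (if x' < y then (1 : ℝ) else -1) • k y (T - |x' - y|) := by
      -- The point `x' = y`, where the chosen sign is `-1`, is a null set.
      filter_upwards [(measure_eq_zero_iff_ae_notMem.1 (measure_singleton (μ := volume) y))] with x' h hx'
      rw [uIoc_of_le hx0] at hx'
      rw [if_pos (lt_of_le_of_ne (hx'.2.trans hxy) h), one_smul]
    constructor
    · refine (hk.intervalIntegrable_direct hy ⟨le_rfl, hy.1.trans hy.2⟩
        ⟨hx0, hxy.trans hy.2⟩).congr_ae ?_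
      exact (ae_restrict_iff' measurableSet_uIoc).2 hae
    · rw [← hP.integral_direct_of_le hk hy hx0 hxy]
      refine (intervalIntegral.integral_congr_ae hae).symm
  rcases le_total x y with h | h
  · exact h1 x h hx.1
  · have hcongr : ∀ x' ∈ uIoc y x, -k y (T - |x' - y|) =
        (if x' < y then (1 : ℝ) else -1) • k y (T - |x' - y|) := by
      intro x' hx'
      rw [uIoc_of_le h] at hx'
      rw [if_neg (not_lt.2 hx'.1.le), neg_one_smul]
    have hi : IntervalIntegrable (fun x' =>
        (if x' < y then (1 : ℝ) else -1) • k y (T - |x' - y|)) volume y x :=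
      ((hk.intervalIntegrable_direct hy hy hx).neg).congr hcongr
    refine ⟨(h1 y le_rfl hy.1).1.trans hi, ?_⟩
    rw [← intervalIntegral.integral_add_adjacent_intervals (h1 y le_rfl hy.1).1 hi,
      (h1 y le_rfl hy.1).2, ← intervalIntegral.integral_congr_ae (Filter.Eventually.of_forall hcongr),
      intervalIntegral.integral_neg, hP.integral_direct_of_ge hk hy h]
    simp only [sub_self, abs_zero, sub_zero]
    abel

theorem integral_kernel_swap [CompleteSpace E] {κ : ℝ → ℝ → E} (hq : Integrable q)
    (hq0 : ∀ y, y ∉ Icc 0 T → q y = 0) (hκ : StronglyMeasurable (Function.uncurry κ))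
    {D : ENNReal} (hD : D ≠ ⊤) (hκD : ∀ y ∈ Icc 0 T, ∫⁻ x in Icc 0 T, ‖κ x y‖ₑ ^ 2 ≤ D)
    {x : ℝ} (hx : x ∈ Icc 0 T) :
    Integrable (fun y => q y (∫ x' in (0 : ℝ)..x, κ x' y)) ∧
    ∫ y, q y (∫ x' in (0 : ℝ)..x, κ x' y) = ∫ x' in (0 : ℝ)..x, ∫ y, q y (κ x' y) := by
  have hsub : Ioc 0 x ⊆ Icc 0 T := fun s hs => ⟨hs.1.le, hs.2.trans hx.2⟩
  have hi := integrable_kernel_prod hq hq0 hκ hD hκD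
  have hi' : Integrable (Function.uncurry fun x y => q y (κ x y))
      ((volume.restrict (Ioc 0 x)).prod volume) :=
    hi.mono_measure (Measure.prod_mono (Measure.restrict_mono hsub le_rfl) le_rfl)
  have e : ∀ y, q y (∫ x' in (0 : ℝ)..x, κ x' y) = ∫ x' in Ioc 0 x, q y (κ x' y) := by
    intro y
    rw [intervalIntegral.integral_of_le hx.1]
    by_cases hy : y ∈ Icc 0 T
    · refine (ContinuousLinearMap.integral_comp_comm _ ?_).symm
      exact (integrableOn_of_lintegral_sq_le hD (hκ.comp_measurable measurable_prodMk_right)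
        (hκD y hy)).mono_set hsub
    · simp [hq0 y hy]
  simp_rw [e]
  refine ⟨hi'.integral_prod_right, ?_⟩
  rw [intervalIntegral.integral_of_le hx.1]
  exact (integral_integral_swap hi').symm

/-- An `x`-derivative of the delays turns `P` into `k` and the difference into the signed sum. No
constant occurs, since at `x = 0` the direct and the reflected signals coincide. -/
theorem retardedDiff_eq_integral [CompleteSpace E] (hP : IsTimePrimitive T P k)
    (hk : IsCausalFamily T k) (hq : Integrable q) (hq0 : ∀ y, y ∉ Icc 0 T → q y = 0)
    {x : ℝ} (hx : x ∈ Icc 0 T) :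
    retardedDiff T q P x = ∫ x' in (0 : ℝ)..x, retardedSum T q k x' := by
  obtain ⟨D, hD, h⟩ := hk.exists_bound (norm_sumKernel_le (T := T) (k := k))
  unfold retardedSum retardedDiff
  rw [← (integral_kernel_swap hq hq0 (stronglyMeasurable_sumKernel hk.stronglyMeasurable)
    hD h hx).2]
  refine integral_congr_ae (Filter.Eventually.of_forall fun y => ?_)
  simp only
  by_cases hy : y ∈ Icc 0 T
  · have h0T : (0 : ℝ) ∈ Icc 0 T := ⟨le_rfl, hy.1.trans hy.2⟩
    obtain ⟨hi, hs⟩ := hP.integral_signed_direct hk hy hx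
    rw [intervalIntegral.integral_add hi (hk.intervalIntegrable_reflected hy h0T hx),
      hs, hP.integral_reflected hk hy hx.1]
    congr 1
    abel
  · simp [hq0 y hy]

theorem IsTimePrimitive.exists_norm_le (hP : IsTimePrimitive T P k) (hk : IsCausalFamily T k) :
    ∃ M : ℝ, 0 ≤ M ∧ ∀ y ∈ Icc 0 T, ∀ τ ≤ T, ‖P y τ‖ ≤ M := by
  obtain ⟨D, hD, h⟩ := hk.bound
  refine ⟨(ENNReal.ofReal T + D).toReal, ENNReal.toReal_nonneg, fun y hy τ hτ => ?_⟩
  have h0T : (0 : ℝ) ≤ T := hy.1.trans hy.2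
  rw [hP y hy τ hτ, intervalIntegral.norm_intervalIntegral_eq, ← toReal_enorm]
  refine ENNReal.toReal_mono (by finiteness) ((enorm_integral_le_lintegral_enorm _).trans ?_)
  calc ∫⁻ σ in uIoc 0 τ, ‖k y σ‖ₑ ≤ ∫⁻ σ in Icc 0 T, (1 + ‖k y σ‖ₑ ^ 2) := by
        rw [← lintegral_indicator measurableSet_uIoc, ← lintegral_indicator measurableSet_Icc]
        refine lintegral_mono fun σ => ?_
        by_cases hσ : σ ∈ uIoc 0 τ
        · rw [indicator_of_mem hσ]
          rcases lt_or_ge σ 0 with h0 | h0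
          · simp [hk.eq_zero y hy σ h0]
          · rw [indicator_of_mem (show σ ∈ Icc 0 T from ⟨h0, hσ.2.trans (max_le h0T hτ)⟩)]
            exact ENNReal.le_one_add_sq _
        · rw [indicator_of_notMem hσ]
          exact zero_le
    _ ≤ _ := by
        rw [lintegral_add_left measurable_const]
        gcongr
        · simp
        · exact h y hy

theorem IsTimePrimitive.integrable_clm_apply (hP : IsTimePrimitive T P k)
    (hPm : StronglyMeasurable (Function.uncurry P)) (hk : IsCausalFamily T k) (hq : Integrable q)
    (hq0 : ∀ y, y ∉ Icc 0 T → q y = 0) {τ : ℝ → ℝ} (hτm : Measurable τ)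
    (hτ : ∀ y ∈ Icc 0 T, τ y ≤ T) : Integrable fun y => q y (P y (τ y)) := by
  obtain ⟨M, -, hM⟩ := hP.exists_norm_le hk
  refine (hq.norm.mul_const M).mono' ?_ (Filter.Eventually.of_forall fun y => ?_)
  · exact aestronglyMeasurable_clm_apply hq.aestronglyMeasurable
      (hPm.comp_measurable (measurable_id.prodMk hτm)).aestronglyMeasurable
  · by_cases hy : y ∈ Icc 0 T
    · exact (ContinuousLinearMap.le_opNorm _ _).trans
        (mul_le_mul_of_nonneg_left (hM y hy _ (hτ y hy)) (norm_nonneg _))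
    · simp [hq0 y hy]

/-- The second differentiation: the regular part returns to a difference of delays, while the jump
of the signed direct term at `y = x`, integrated against `q`, becomes the local term `-2 q(x)
P(x,T)`. -/
theorem retardedSum_eq_integral [CompleteSpace E] (hP : IsTimePrimitive T P k)
    (hPm : StronglyMeasurable (Function.uncurry P))
    (hk : IsCausalFamily T k) (hq : Integrable q) (hq0 : ∀ y, y ∉ Icc 0 T → q y = 0) :
    ∃ c : E, ∀ x ∈ Icc 0 T, retardedSum T q P x = c + ∫ x' in (0 : ℝ)..x,
      (retardedDiff T q k x' - (2 : ℝ) • q x' (P x' T)) := by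
  -- The value at `x = 0`, where both signals have delay `y`.
  refine ⟨∫ y, (2 : ℝ) • q y (P y (T - y)), fun x hx => ?_⟩
  obtain ⟨D, hD, h⟩ := hk.exists_bound fun x y =>
    norm_sub_le (k y (T - |x - y|)) (k y (T - x - y))
  have hm := stronglyMeasurable_diffKernel (T := T) hk.stronglyMeasurable
  obtain ⟨hi, hswap⟩ := integral_kernel_swap hq hq0 hm hD h hx
  have h1 : Integrable fun y => (2 : ℝ) • q y (P y (T - y)) :=
    (hP.integrable_clm_apply hPm hk hq hq0 (by fun_prop)
      (fun y hy => by linarith [hy.1])).smul (2 : ℝ)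
  have h2 : Integrable fun y => (2 : ℝ) • q y (P y T) :=
    (hP.integrable_clm_apply hPm hk hq hq0 measurable_const (fun _ _ => le_rfl)).smul (2 : ℝ)
  have h3 : Integrable ((Iic x).indicator fun y => (2 : ℝ) • q y (P y T)) :=
    h2.indicator measurableSet_Iic
  have hd : IntervalIntegrable (retardedDiff T q k) volume 0 x := by
    have hp := (integrable_kernel_prod hq hq0 hm hD h).integral_prod_left
    exact (IntegrableOn.mono_set hp (uIcc_subset_Icc ⟨le_rfl, hx.1.trans hx.2⟩ hx)).intervalIntegrable
  have e : ∀ y, q y ((if x < y then (1 : ℝ) else -1) • P y (T - |x - y|) + P y (T - x - y)) =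
      (2 : ℝ) • q y (P y (T - y)) +
        q y (∫ x' in (0 : ℝ)..x, (k y (T - |x' - y|) - k y (T - x' - y))) -
        (Iic x).indicator (fun y => (2 : ℝ) • q y (P y T)) y := by
    intro y
    by_cases hy : y ∈ Icc 0 T
    · have h0T : (0 : ℝ) ∈ Icc 0 T := ⟨le_rfl, hy.1.trans hy.2⟩
      have e1 : (Iic x).indicator (fun y => (2 : ℝ) • q y (P y T)) y =
          q y ((Iic x).indicator (fun y => (2 : ℝ) • P y T) y) := by
        by_cases hyx : y ∈ Iic x
        · rw [indicator_of_mem hyx, indicator_of_mem hyx,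
            map_real_smul (q y) (q y).continuous]
        · rw [indicator_of_notMem hyx, indicator_of_notMem hyx, map_zero]
      rw [hP.integral_direct hk hy hx, intervalIntegral.integral_sub
        (hk.intervalIntegrable_direct hy h0T hx) (hk.intervalIntegrable_reflected hy h0T hx),
        hP.integral_reflected hk hy hx.1, e1, two_smul, ← map_add, ← map_add, ← map_sub]
      congr 1
      abel
    · simp [hq0 y hy, indicator_apply]
  have e2 : ∫ y, (Iic x).indicator (fun y => (2 : ℝ) • q y (P y T)) y =
      ∫ y in (0 : ℝ)..x, (2 : ℝ) • q y (P y T) := by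
    rw [integral_indicator measurableSet_Iic, intervalIntegral.integral_of_le hx.1,
      ← integral_Icc_eq_integral_Ioc]
    refine setIntegral_eq_of_subset_of_forall_sdiff_eq_zero measurableSet_Iic
      (fun y hy => hy.2) fun y hy => ?_
    rw [hq0 y fun h => hy.2 ⟨h.1, hy.1⟩]
    simp
  have h12 : Integrable fun y => (2 : ℝ) • q y (P y (T - y)) +
      q y (∫ x' in (0 : ℝ)..x, (k y (T - |x' - y|) - k y (T - x' - y))) := h1.add hi
  unfold retardedSum
  simp_rw [e]
  rw [integral_sub h12 h3, integral_add h1 hi, hswap, e2,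
    intervalIntegral.integral_sub hd h2.intervalIntegrable, add_sub_assoc]
  rfl

end PathIntegral

/-! ### Weak derivatives and primitives. -/

theorem memLp_of_continuousOn_Icc {F : Type*} [NormedAddCommGroup F] {a b : ℝ}
    {p : ENNReal} {g : ℝ → F} (hg : ContinuousOn g (Icc a b)) :
    MemLp g p (volume.restrict (Icc a b)) := by
  obtain ⟨C, hC⟩ := isCompact_Icc.exists_bound_of_continuousOn hg
  exact MemLp.of_bound (hg.aestronglyMeasurable measurableSet_Icc) C
    ((ae_restrict_iff' measurableSet_Icc).2 (Filter.Eventually.of_forall hC))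

section WeakDeriv

variable {T : ℝ} {n : ℕ}

theorem L2Space.integrable (f : L2Space T n) :
    Integrable f (volume.restrict (Icc (0 : ℝ) T)) :=
  (Lp.memLp f).integrable (by norm_num)

/-- Integration by parts through Fubini: the weight of `g s` is `∫_s^T φ' = -φ(s)`, and the constant
drops out because `φ` vanishes at both ends. -/
theorem isWeakDeriv_of_ae_eq_primitive {f g : L2Space T n} {c : EuclideanSpace ℂ (Fin n)}
    (h : ∀ᵐ x ∂volume.restrict (Icc 0 T), f x = c + ∫ s in (0 : ℝ)..x, g s) :
    IsWeakDeriv f g := by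
  intro φ hφ hc hs
  rcases le_or_gt T 0 with hT | hT
  · have : φ = 0 := by
      rw [Ioo_eq_empty_of_le hT, subset_empty_iff, tsupport_eq_empty_iff] at hs
      exact hs
    simp [this]
  have hd : Continuous (deriv φ) := hφ.continuous_deriv (by simp)
  have hφ0 : φ 0 = 0 := image_eq_zero_of_notMem_tsupport fun h => lt_irrefl _ (hs h).1
  have hφT : φ T = 0 := image_eq_zero_of_notMem_tsupport fun h => lt_irrefl _ (hs h).2
  have hftc : ∀ a b, ∫ x in a..b, deriv φ x = φ b - φ a := fun a b =>
    intervalIntegral.integral_deriv_eq_sub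
      (fun x _ => (hφ.differentiable (by simp)) x) (hd.intervalIntegrable _ _)
  have hgi : Integrable g (volume.restrict (Ioc 0 T)) :=
    IntegrableOn.mono_set g.integrable Ioc_subset_Icc_self
  have hprod : Integrable (Function.uncurry fun x s => deriv φ x • g s)
      ((volume.restrict (Ioc 0 T)).prod (volume.restrict (Ioc 0 T))) :=
    Integrable.smul_prod hd.integrableOn_Ioc hgi
  have hin : ∀ x ∈ Ioc 0 T, deriv φ x • (c + ∫ s in (0 : ℝ)..x, g s) =
      deriv φ x • c + ∫ s in Ioc 0 x, deriv φ x • g s := by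
    intro x hx
    rw [smul_add, intervalIntegral.integral_of_le hx.1.le, integral_smul]
  have hint2 : Integrable (fun x => ∫ s in Ioc 0 x, deriv φ x • g s)
      (volume.restrict (Ioc 0 T)) := by
    have hcont : ContinuousOn (fun x => deriv φ x • ∫ s in (0 : ℝ)..x, g s) (Icc 0 T) := by
      refine hd.continuousOn.smul ?_
      have := intervalIntegral.continuousOn_primitive_interval (a := 0) (b := T) (f := g)
        (μ := volume) (by rw [uIcc_of_le hT.le]; exact g.integrable)
      rwa [uIcc_of_le hT.le] at this
    refine ((hcont.integrableOn_compact isCompact_Icc).mono_set Ioc_subset_Icc_self).congr ?_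
    refine (ae_restrict_iff' measurableSet_Ioc).2 (Filter.Eventually.of_forall fun x hx => ?_)
    simp only
    rw [intervalIntegral.integral_of_le hx.1.le, integral_smul]
  have e1 : ∫ x in Icc 0 T, deriv φ x • f x
      = ∫ x in Ioc 0 T, (deriv φ x • c + ∫ s in Ioc 0 x, deriv φ x • g s) := by
    rw [← setIntegral_congr_fun measurableSet_Ioc hin, ← integral_Icc_eq_integral_Ioc]
    refine integral_congr_ae ?_
    filter_upwards [h] with x hx
    rw [hx]
  have hint1 : Integrable (fun x => deriv φ x • c) (volume.restrict (Ioc 0 T)) :=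
    (hd.smul continuous_const).integrableOn_Ioc
  rw [e1, integral_add hint1 hint2,
    integral_smul_const, ← intervalIntegral.integral_of_le hT.le, hftc, hφ0, hφT, sub_zero,
    zero_smul, zero_add, integral_triangle_swap hprod, integral_Icc_eq_integral_Ioc,
    ← integral_neg]
  refine setIntegral_congr_fun measurableSet_Ioc fun s hs => ?_
  rw [integral_smul_const, ← intervalIntegral.integral_of_le hs.2, hftc, hφT, zero_sub, neg_smul]

theorem IsWeakDeriv.neg {f g : L2Space T n} (h : IsWeakDeriv f g) : IsWeakDeriv (-f) (-g) := by
  simpa using h.smul (-1)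

theorem IsWeakDeriv.sub {f g f' g' : L2Space T n} (h : IsWeakDeriv f g) (h' : IsWeakDeriv f' g') :
    IsWeakDeriv (f - f') (g - g') := by
  simpa [sub_eq_add_neg] using h.add h'.neg

theorem eq_zero_of_integral_test {f : L2Space T n}
    (h : ∀ φ : ℝ → ℝ, ContDiff ℝ ∞ φ → HasCompactSupport φ → tsupport φ ⊆ Ioo 0 T →
      ∫ x in Icc 0 T, φ x • f x = 0) : ∀ᵐ x ∂volume.restrict (Icc 0 T), f x = 0 := by
  have h1 := isOpen_Ioo.ae_eq_zero_of_integral_contDiff_smul_eq_zero (U := Ioo 0 T)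
    (μ := volume.restrict (Icc 0 T)) (f := f)
    (f.integrable.locallyIntegrable.locallyIntegrableOn _) h
  have h2 : ∀ᵐ x ∂volume.restrict (Icc 0 T), x ∈ Ioo 0 T := by
    rw [restrict_Ioo_eq_restrict_Icc.symm]
    exact ae_restrict_mem measurableSet_Ioo
  filter_upwards [h1, h2] with x h1 h2 using h1 h2

theorem IsWeakDeriv.unique {f g g' : L2Space T n} (h : IsWeakDeriv f g) (h' : IsWeakDeriv f g') :
    g = g' := by
  rw [← sub_eq_zero, Lp.eq_zero_iff_ae_eq_zero]
  refine eq_zero_of_integral_test fun φ hφ hc hs => ?_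
  have := h.sub h' φ hφ hc hs
  rw [sub_self] at this
  have h0 := IsWeakDeriv.zero (T := T) (n := n)
  have e : ∫ x in Icc 0 T, deriv φ x • (0 : L2Space T n) x = 0 := by
    refine integral_eq_zero_of_ae ?_
    filter_upwards [Lp.coeFn_zero (EuclideanSpace ℂ (Fin n)) 2
      (volume.restrict (Icc (0 : ℝ) T))] with x hx
    rw [hx]
    simp
  rw [e] at this
  exact neg_eq_zero.1 this.symm

/-- A smooth function supported in the open interval with vanishing integral is the derivative of
a smooth function supported there. -/
theorem exists_deriv_eq_of_integral_eq_zero {η : ℝ → ℝ} (hη : ContDiff ℝ ∞ η)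
    (hc : HasCompactSupport η) (hs : tsupport η ⊆ Ioo 0 T) (h0 : ∫ x, η x = 0) :
    ∃ φ : ℝ → ℝ, ContDiff ℝ ∞ φ ∧ HasCompactSupport φ ∧ tsupport φ ⊆ Ioo 0 T ∧ deriv φ = η := by
  rcases (tsupport η).eq_empty_or_nonempty with he | hne
  · have : η = 0 := tsupport_eq_empty_iff.1 he
    exact ⟨0, contDiff_const, HasCompactSupport.zero, by simp [tsupport], by simp [this]⟩
  obtain ⟨a, ha⟩ := hc.isCompact.exists_isLeast hne
  obtain ⟨b, hb⟩ := hc.isCompact.exists_isGreatest hne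
  have hη0 : ∀ x, x ∉ Icc a b → η x = 0 := fun x hx =>
    image_eq_zero_of_notMem_tsupport fun h => hx ⟨ha.2 h, hb.2 h⟩
  set φ : ℝ → ℝ := fun x => ∫ s in a..x, η s with hφ
  have hder : ∀ x, HasDerivAt φ (η x) x := fun x =>
    intervalIntegral.integral_hasDerivAt_right (hη.continuous.intervalIntegrable _ _)
      (hη.continuous.stronglyMeasurableAtFilter _ _) hη.continuous.continuousAt
  have hd : deriv φ = η := funext fun x => (hder x).deriv
  have hφ0 : ∀ x, x ∉ Icc a b → φ x = 0 := by
    intro x hx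
    rcases lt_or_ge x a with h | h
    · simp only [hφ]
      rw [intervalIntegral.integral_of_ge h.le, integral_Ioc_eq_integral_Ioo,
        setIntegral_congr_fun measurableSet_Ioo (g := fun _ => (0 : ℝ))
        fun s hs => hη0 s fun h' => absurd h'.1 (not_le.2 hs.2)]
      simp
    · have hbx : b < x := by
        by_contra h'
        exact hx ⟨h, not_lt.1 h'⟩
      simp only [hφ]
      rw [intervalIntegral.integral_of_le h, ← integral_Icc_eq_integral_Ioc, ← h0]
      refine setIntegral_eq_integral_of_forall_compl_eq_zero fun s hs => hη0 s fun h' => ?_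
      exact hs ⟨h'.1, h'.2.trans hbx.le⟩
  have hsub : tsupport φ ⊆ Icc a b :=
    closure_minimal (fun x hx => by
      by_contra h
      exact hx (hφ0 x h)) isClosed_Icc
  refine ⟨φ, ?_, HasCompactSupport.of_support_subset_isCompact isCompact_Icc
    ((subset_tsupport φ).trans hsub), hsub.trans ?_, hd⟩
  · rw [contDiff_infty_iff_deriv]
    exact ⟨fun x => (hder x).differentiableAt, by rwa [hd]⟩
  · exact fun x hx => ⟨(hs ha.1).1.trans_le hx.1, hx.2.trans_lt (hs hb.1).2⟩

/-- The du Bois-Reymond lemma. Subtracting the right multiple of a fixed bump of mass one makes any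
test function a derivative of a test function, which `f` annihilates; the constant is the mean of
`f` against the bump. -/
theorem IsWeakDeriv.ae_eq_const (hT : 0 < T) {f : L2Space T n} (h : IsWeakDeriv f 0) :
    ∃ c, ∀ᵐ x ∂volume.restrict (Icc 0 T), f x = c := by
  -- Centre `T/2` and outer radius `T/4` keep the support inside `(0,T)`.
  let β : ContDiffBump (T / 2) := ⟨T / 8, T / 4, by positivity, by linarith⟩
  set φ₀ : ℝ → ℝ := β.normed volume with hφ₀
  have hφ₀s : ContDiff ℝ ∞ φ₀ := β.contDiff_normed
  have hφ₀c : HasCompactSupport φ₀ := β.hasCompactSupport_normed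
  have hφ₀t : tsupport φ₀ ⊆ Ioo 0 T := by
    rw [hφ₀, β.tsupport_normed_eq, Real.closedBall_eq_Icc]
    intro x hx
    have h1 : T / 2 - T / 4 ≤ x := hx.1
    have h2 : x ≤ T / 2 + T / 4 := hx.2
    exact ⟨by linarith, by linarith⟩
  have hφ₀i : ∫ x, φ₀ x = 1 := β.integral_normed
  set c := ∫ x in Icc 0 T, φ₀ x • f x with hcdef
  refine ⟨c, ?_⟩
  set g : L2Space T n := f - (memLp_const c).toLp (fun _ : ℝ => c) with hg
  have hgf : ∀ᵐ x ∂volume.restrict (Icc 0 T), g x = f x - c := by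
    filter_upwards [Lp.coeFn_sub f ((memLp_const c).toLp (fun _ : ℝ => c)),
      (memLp_const (μ := volume.restrict (Icc 0 T)) (p := 2) c).coeFn_toLp] with x h1 h2
    rw [hg, h1, Pi.sub_apply, h2]
  have hg0 : ∀ᵐ x ∂volume.restrict (Icc 0 T), g x = 0 := by
    refine eq_zero_of_integral_test fun ψ hψ hψc hψs => ?_
    have hψi : Integrable ψ := hψ.continuous.integrable_of_hasCompactSupport hψc
    have hφ₀int : Integrable φ₀ := hφ₀s.continuous.integrable_of_hasCompactSupport hφ₀c
    set m := ∫ x, ψ x with hm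
    have hsupp : tsupport (fun x => ψ x - m * φ₀ x) ⊆ tsupport ψ ∪ tsupport φ₀ := by
      refine closure_minimal (fun x hx => ?_)
        ((isClosed_tsupport _).union (isClosed_tsupport _))
      by_contra h'
      rw [mem_union, not_or] at h'
      exact hx (by simp [image_eq_zero_of_notMem_tsupport h'.1,
        image_eq_zero_of_notMem_tsupport h'.2])
    obtain ⟨φ, h1, h2, h3, h4⟩ := exists_deriv_eq_of_integral_eq_zero (T := T)
      (η := fun x => ψ x - m * φ₀ x) (hψ.sub (contDiff_const.mul hφ₀s))
      (HasCompactSupport.of_support_subset_isCompact (hψc.isCompact.union hφ₀c.isCompact)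
        ((subset_tsupport _).trans hsupp)) (hsupp.trans (union_subset hψs hφ₀t))
      (by rw [integral_sub hψi (hφ₀int.const_mul _), integral_const_mul, hφ₀i, mul_one, sub_self])
    have h5 := h φ h1 h2 h3
    have e0 : ∫ x in Icc 0 T, φ x • (0 : L2Space T n) x = 0 := by
      refine integral_eq_zero_of_ae ?_
      filter_upwards [Lp.coeFn_zero (EuclideanSpace ℂ (Fin n)) 2
        (volume.restrict (Icc (0 : ℝ) T))] with x hx
      rw [hx]
      simp
    rw [e0, neg_zero, h4] at h5
    simp_rw [sub_smul, mul_smul] at h5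
    have hmi : Integrable (fun x => m • φ₀ x • f x) (volume.restrict (Icc 0 T)) :=
      (integrable_test_smul hφ₀s.continuous hφ₀c f).smul m
    rw [integral_sub (integrable_test_smul hψ.continuous hψc f) hmi, integral_smul, ← hcdef] at h5
    have e1 : ∫ x in Icc 0 T, ψ x • g x = ∫ x in Icc 0 T, (ψ x • f x - ψ x • c) := by
      refine integral_congr_ae ?_
      filter_upwards [hgf] with x hx
      rw [hx, smul_sub]
    have e2 : ∫ x in Icc 0 T, ψ x = m := by
      refine setIntegral_eq_integral_of_forall_compl_eq_zero fun x hx => ?_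
      exact image_eq_zero_of_notMem_tsupport fun h' => hx (Ioo_subset_Icc_self (hψs h'))
    rw [e1, integral_sub (integrable_test_smul hψ.continuous hψc f)
      (hψi.integrableOn.smul_const c), integral_smul_const, e2, h5]
  filter_upwards [hgf, hg0] with x h1 h2
  rw [← sub_eq_zero, ← h1, h2]

theorem memLp_primitive (g : L2Space T n) :
    MemLp (fun x => ∫ s in (0 : ℝ)..x, g s) 2 (volume.restrict (Icc (0 : ℝ) T)) := by
  rcases lt_or_ge T 0 with hT | hT
  · simp [Icc_eq_empty_of_lt hT]
  have := intervalIntegral.continuousOn_primitive_interval (a := 0) (b := T) (f := g)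
    (μ := volume) (by rw [uIcc_of_le hT]; exact g.integrable)
  rw [uIcc_of_le hT] at this
  exact memLp_of_continuousOn_Icc this

theorem IsWeakDeriv.ae_eq_primitive (hT : 0 < T) {f g : L2Space T n} (h : IsWeakDeriv f g) :
    ∃ c, ∀ᵐ x ∂volume.restrict (Icc 0 T), f x = c + ∫ s in (0 : ℝ)..x, g s := by
  set P : L2Space T n := (memLp_primitive g).toLp with hP
  have hPae : ∀ᵐ x ∂volume.restrict (Icc 0 T), P x = ∫ s in (0 : ℝ)..x, g s :=
    (memLp_primitive g).coeFn_toLp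
  have hPg : IsWeakDeriv P g := isWeakDeriv_of_ae_eq_primitive (c := 0) (by simpa using hPae)
  obtain ⟨c, hc⟩ := IsWeakDeriv.ae_eq_const hT (by simpa using h.sub hPg : IsWeakDeriv (f - P) 0)
  refine ⟨c, ?_⟩
  filter_upwards [hPae, hc, Lp.coeFn_sub f P] with x h1 h2 h3
  rw [← h1, ← h2, h3, Pi.sub_apply, sub_add_cancel]

end WeakDeriv

/-! ### Time reversal. -/

section Reflect

variable {T : ℝ} {n : ℕ}

theorem measurePreserving_reflect (T : ℝ) : MeasurePreserving (fun x : ℝ => T - x)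
    (volume.restrict (Icc 0 T)) (volume.restrict (Icc 0 T)) := by
  have h := (Measure.measurePreserving_sub_left (volume : Measure ℝ) T).restrict_preimage
    (measurableSet_Icc (a := (0 : ℝ)) (b := T))
  rwa [preimage_const_sub_Icc, sub_self, sub_zero] at h

/-- Time reversal `f ↦ f(T - ·)` in `L₂`. -/
noncomputable def reflectL2 (T : ℝ) (n : ℕ) : L2Space T n →L[ℂ] L2Space T n :=
  (Lp.compMeasurePreservingₗᵢ ℂ (fun x : ℝ => T - x)
    (measurePreserving_reflect T)).toContinuousLinearMap

theorem reflectL2_ae (f : L2Space T n) :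
    ∀ᵐ x ∂volume.restrict (Icc 0 T), reflectL2 T n f x = f (T - x) :=
  Lp.coeFn_compMeasurePreserving f (measurePreserving_reflect T)

theorem reflectL2_reflectL2 (f : L2Space T n) : reflectL2 T n (reflectL2 T n f) = f := by
  refine Lp.ext ?_
  have h := (measurePreserving_reflect T).quasiMeasurePreserving.ae (reflectL2_ae f)
  filter_upwards [reflectL2_ae (reflectL2 T n f), h] with x h1 h2
  rw [h1, h2, sub_sub_cancel]

theorem integral_reflect (g : ℝ → EuclideanSpace ℂ (Fin n)) :
    ∫ x in Icc 0 T, g (T - x) = ∫ x in Icc 0 T, g x :=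
  (measurePreserving_reflect T).integral_comp
    (Homeomorph.subLeft T).measurableEmbedding g

theorem IsWeakDeriv.reflect {f g : L2Space T n} (h : IsWeakDeriv f g) :
    IsWeakDeriv (reflectL2 T n f) (-reflectL2 T n g) := by
  intro φ hφ hc hs
  set ψ : ℝ → ℝ := fun x => φ (T - x) with hψ
  have hψd : ∀ x, deriv ψ x = -deriv φ (T - x) := fun x => deriv_comp_const_sub _ _ _
  have hψs : ContDiff ℝ ∞ ψ := hφ.comp (contDiff_const.sub contDiff_id)
  have hψc : HasCompactSupport ψ := hc.comp_homeomorph (Homeomorph.subLeft T)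
  have hψt : tsupport ψ ⊆ Ioo 0 T := by
    intro x hx
    have : T - x ∈ tsupport φ := by
      have := tsupport_comp_subset_preimage φ (f := fun x : ℝ => T - x) (by fun_prop) hx
      exact this
    have := hs this
    exact ⟨by linarith [this.2], by linarith [this.1]⟩
  have h0 := h ψ hψs hψc hψt
  have e1 : ∫ x in Icc 0 T, deriv φ x • reflectL2 T n f x = -∫ x in Icc 0 T, deriv ψ x • f x := by
    rw [← integral_neg, ← integral_reflect fun x => -(deriv ψ x • f x)]
    refine integral_congr_ae ?_
    filter_upwards [reflectL2_ae f] with x hx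
    rw [hx, hψd, sub_sub_cancel, neg_smul, neg_neg]
  have e2 : ∫ x in Icc 0 T, φ x • (-reflectL2 T n g : L2Space T n) x
      = -∫ x in Icc 0 T, ψ x • g x := by
    rw [← integral_neg, ← integral_reflect fun x => -(ψ x • g x)]
    refine integral_congr_ae ?_
    filter_upwards [reflectL2_ae g, Lp.coeFn_neg (reflectL2 T n g)] with x hx hx'
    rw [hx', Pi.neg_apply, hx, hψ, smul_neg]
    simp
  rw [e1, e2, h0]

end Reflect

/-! ### The Volterra operator in `L₂`. -/

section Volterra

variable {T : ℝ} {n : ℕ}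

theorem exists_integral_norm_le (T : ℝ) (n : ℕ) : ∃ K : ℝ, 0 ≤ K ∧
    ∀ g : L2Space T n, ∫ x in Icc 0 T, ‖g x‖ ≤ K * ‖g‖ := by
  set c : ENNReal := (volume.restrict (Icc (0 : ℝ) T)) univ ^
    (1 / (1 : ENNReal).toReal - 1 / (2 : ENNReal).toReal) with hc
  have hcfin : c ≠ ⊤ := ENNReal.rpow_ne_top_of_nonneg (by norm_num) (by simp)
  refine ⟨c.toReal, ENNReal.toReal_nonneg, fun g => ?_⟩
  have h := eLpNorm_le_eLpNorm_mul_rpow_measure_univ (μ := volume.restrict (Icc (0 : ℝ) T))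
    (p := 1) (q := 2) (by norm_num) (Lp.aestronglyMeasurable g)
  rw [eLpNorm_one_eq_lintegral_enorm] at h
  rw [integral_norm_eq_lintegral_enorm (Lp.aestronglyMeasurable g), Lp.norm_def, mul_comm,
    ← ENNReal.toReal_mul]
  exact ENNReal.toReal_mono (ENNReal.mul_ne_top (Lp.eLpNorm_ne_top g) hcfin) h

theorem exists_norm_le_of_ae_bound (T : ℝ) (n : ℕ) : ∃ K : ℝ, 0 ≤ K ∧
    ∀ (g : L2Space T n) (M : ℝ), 0 ≤ M → (∀ᵐ x ∂volume.restrict (Icc 0 T), ‖g x‖ ≤ M) →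
      ‖g‖ ≤ K * M :=
  ⟨_, by positivity, fun _ _ hM h => Lp.norm_le_of_ae_bound hM h⟩

variable {w : ℝ → ℝ → EuclideanSpace ℂ (Fin n) →L[ℂ] EuclideanSpace ℂ (Fin n)} {C : ℝ}

theorem stronglyMeasurable_volterra (hw : Continuous (Function.uncurry w))
    {g : ℝ → EuclideanSpace ℂ (Fin n)} (hg : StronglyMeasurable g) (T : ℝ) :
    StronglyMeasurable fun x => ∫ s in Ioc x T, w x s (g s) := by
  have hS : MeasurableSet {z : ℝ × ℝ | z.1 < z.2 ∧ z.2 ≤ T} :=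
    MeasurableSet.inter (measurableSet_lt measurable_fst measurable_snd)
      (measurableSet_le measurable_snd measurable_const)
  have hm : StronglyMeasurable fun z : ℝ × ℝ => w z.1 z.2 (g z.2) :=
    isBoundedBilinearMap_apply.continuous.comp_stronglyMeasurable
      (hw.stronglyMeasurable.prodMk (hg.comp_measurable measurable_snd))
  have e : (fun x => ∫ s in Ioc x T, w x s (g s)) = fun x => ∫ s,
      {z : ℝ × ℝ | z.1 < z.2 ∧ z.2 ≤ T}.indicator (fun z => w z.1 z.2 (g z.2)) (x, s) := by
    funext x
    rw [← integral_indicator measurableSet_Ioc]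
    rfl
  rw [e]
  exact (hm.indicator hS).integral_prod_right' (ν := volume)

theorem integrableOn_volterra_integrand (hw : Continuous (Function.uncurry w))
    (hC : ∀ x t, ‖w x t‖ ≤ C) (g : L2Space T n) {x : ℝ} (hx : 0 ≤ x) :
    IntegrableOn (fun s => w x s (g s)) (Ioc x T) := by
  have hg : IntegrableOn g (Ioc x T) := IntegrableOn.mono_set g.integrable
    fun s hs => ⟨hx.trans hs.1.le, hs.2⟩
  refine (hg.norm.const_mul C).mono' (aestronglyMeasurable_clm_apply
    (hw.comp (Continuous.prodMk_right x)).aestronglyMeasurable hg.aestronglyMeasurable) ?_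
  exact Filter.Eventually.of_forall fun s => (ContinuousLinearMap.le_opNorm _ _).trans
    (mul_le_mul_of_nonneg_right (hC _ _) (norm_nonneg _))

theorem norm_volterra_le (hC : ∀ x t, ‖w x t‖ ≤ C) (g : L2Space T n) {x : ℝ} (hx : 0 ≤ x) :
    ‖∫ s in Ioc x T, w x s (g s)‖ ≤ C * ∫ s in Ioc x T, ‖g s‖ := by
  have hg : IntegrableOn g (Ioc x T) := IntegrableOn.mono_set g.integrable
    fun s hs => ⟨hx.trans hs.1.le, hs.2⟩
  rw [← integral_const_mul]
  refine norm_integral_le_of_norm_le (hg.norm.const_mul C) (Filter.Eventually.of_forall fun s => ?_)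
  exact (ContinuousLinearMap.le_opNorm _ _).trans
    (mul_le_mul_of_nonneg_right (hC _ _) (norm_nonneg _))

theorem norm_volterra_le' (hC : ∀ x t, ‖w x t‖ ≤ C) (g : L2Space T n) {x : ℝ} (hx : 0 ≤ x) :
    ‖∫ s in Ioc x T, w x s (g s)‖ ≤ C * ∫ s in Icc 0 T, ‖g s‖ := by
  refine (norm_volterra_le hC g hx).trans (mul_le_mul_of_nonneg_left ?_
    ((norm_nonneg _).trans (hC 0 0)))
  exact setIntegral_mono_set g.integrable.norm (Filter.Eventually.of_forall fun _ => norm_nonneg _)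
    (LE.le.eventuallyLE (show Ioc x T ⊆ Icc 0 T from fun s hs => ⟨hx.trans hs.1.le, hs.2⟩))

theorem memLp_volterra (hw : Continuous (Function.uncurry w)) (hC : ∀ x t, ‖w x t‖ ≤ C)
    (g : L2Space T n) :
    MemLp (fun x => ∫ s in Ioc x T, w x s (g s)) 2 (volume.restrict (Icc 0 T)) := by
  refine MemLp.of_bound
    (stronglyMeasurable_volterra hw (Lp.stronglyMeasurable g) T).aestronglyMeasurable
    (C * ∫ s in Icc 0 T, ‖g s‖) ((ae_restrict_iff' measurableSet_Icc).2
    (Filter.Eventually.of_forall fun x hx => norm_volterra_le' hC g hx.1))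

/-- The Volterra operator `g ↦ ∫ₓᵀ w(x,s) g(s) ds` in `L₂`. -/
noncomputable def volterraL2 (T : ℝ) (hw : Continuous (Function.uncurry w))
    (hC : ∀ x t, ‖w x t‖ ≤ C) : L2Space T n →L[ℂ] L2Space T n :=
  LinearMap.mkContinuous
    { toFun := fun g => (memLp_volterra hw hC g).toLp
      map_add' := by
        intro g g'
        refine Lp.ext ?_
        filter_upwards [(memLp_volterra hw hC (g + g')).coeFn_toLp,
          (memLp_volterra hw hC g).coeFn_toLp, (memLp_volterra hw hC g').coeFn_toLp,
          Lp.coeFn_add (memLp_volterra hw hC g).toLp (memLp_volterra hw hC g').toLp,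
          ae_restrict_mem measurableSet_Icc] with x h1 h2 h3 h4 hx
        rw [h1, h4, Pi.add_apply, h2, h3, ← integral_add
          (integrableOn_volterra_integrand hw hC g hx.1)
          (integrableOn_volterra_integrand hw hC g' hx.1)]
        refine integral_congr_ae ?_
        filter_upwards [ae_restrict_of_ae_restrict_of_subset
          (fun s hs => ⟨hx.1.trans hs.1.le, hs.2⟩ : Ioc x T ⊆ Icc 0 T) (Lp.coeFn_add g g')]
          with s hs
        rw [hs, Pi.add_apply, map_add]
      map_smul' := by
        intro c g
        refine Lp.ext ?_
        filter_upwards [(memLp_volterra hw hC (c • g)).coeFn_toLp,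
          (memLp_volterra hw hC g).coeFn_toLp, Lp.coeFn_smul c (memLp_volterra hw hC g).toLp,
          ae_restrict_mem measurableSet_Icc] with x h1 h2 h3 hx
        rw [h1, RingHom.id_apply, h3, Pi.smul_apply, h2, ← integral_smul]
        refine integral_congr_ae ?_
        filter_upwards [ae_restrict_of_ae_restrict_of_subset
          (fun s hs => ⟨hx.1.trans hs.1.le, hs.2⟩ : Ioc x T ⊆ Icc 0 T) (Lp.coeFn_smul c g)]
          with s hs
        rw [hs, Pi.smul_apply, map_smul] }
    ((exists_norm_le_of_ae_bound T n).choose * (C * (exists_integral_norm_le T n).choose))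
    (by
      intro g
      have h1 := (exists_norm_le_of_ae_bound T n).choose_spec
      have h2 := (exists_integral_norm_le T n).choose_spec
      have hC0 : 0 ≤ C := (norm_nonneg _).trans (hC 0 0)
      rw [mul_assoc]
      refine h1.2 _ _ (mul_nonneg (mul_nonneg hC0 h2.1) (norm_nonneg _)) ?_
      filter_upwards [(memLp_volterra hw hC g).coeFn_toLp,
        ae_restrict_mem measurableSet_Icc] with x hx1 hx
      simp only [LinearMap.coe_mk, AddHom.coe_mk]
      rw [hx1, mul_assoc]
      exact (norm_volterra_le' hC g hx.1).trans (mul_le_mul_of_nonneg_left (h2.2 g) hC0))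

theorem volterraL2_ae (hw : Continuous (Function.uncurry w)) (hC : ∀ x t, ‖w x t‖ ≤ C)
    (g : L2Space T n) : ∀ᵐ x ∂volume.restrict (Icc 0 T),
      volterraL2 T hw hC g x = ∫ s in Ioc x T, w x s (g s) :=
  (memLp_volterra hw hC g).coeFn_toLp

/-- The first application turns the `L₂` function into a bounded one, controlled by its `L₁` norm.
Each further application integrates the pointwise bound over `(x,T]`; this is why the exponent is `k
+ 1` on the operator but `k` on `T - x`. -/
theorem norm_volterraL2_pow_le (hw : Continuous (Function.uncurry w)) (hC : ∀ x t, ‖w x t‖ ≤ C)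
    (g : L2Space T n) (k : ℕ) : ∀ᵐ x ∂volume.restrict (Icc 0 T),
      ‖(volterraL2 T hw hC ^ (k + 1)) g x‖ ≤
        C ^ (k + 1) * (∫ s in Icc 0 T, ‖g s‖) * ((T - x) ^ k / k.factorial) := by
  have hC0 : 0 ≤ C := (norm_nonneg _).trans (hC 0 0)
  induction k with
  | zero =>
    filter_upwards [volterraL2_ae hw hC g, ae_restrict_mem measurableSet_Icc] with x h1 hx
    simp only [zero_add, pow_one, pow_zero, Nat.factorial_zero, Nat.cast_one, div_one, mul_one]
    rw [h1]
    exact norm_volterra_le' hC g hx.1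
  | succ k ih =>
    filter_upwards [volterraL2_ae hw hC ((volterraL2 T hw hC ^ (k + 1)) g),
      ae_restrict_mem measurableSet_Icc] with x h1 hx
    rw [pow_succ', mul_apply_eq_comp, h1]
    refine (norm_volterra_le hC _ hx.1).trans ?_
    have hsub : Ioc x T ⊆ Icc 0 T := fun s hs => ⟨hx.1.trans hs.1.le, hs.2⟩
    have hcont : Continuous fun s : ℝ =>
      C ^ (k + 1) * (∫ s in Icc 0 T, ‖g s‖) * ((T - s) ^ k / k.factorial) := by fun_prop
    calc _ ≤ C * ∫ s in Ioc x T,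
          C ^ (k + 1) * (∫ s in Icc 0 T, ‖g s‖) * ((T - s) ^ k / k.factorial) := by
          refine mul_le_mul_of_nonneg_left (integral_mono_ae
            (IntegrableOn.mono_set (L2Space.integrable _).norm hsub)
            hcont.integrableOn_Ioc (ae_restrict_of_ae_restrict_of_subset hsub ih)) hC0
      _ = _ := by
          rw [← intervalIntegral.integral_of_le hx.2, intervalIntegral.integral_const_mul,
            intervalIntegral.integral_div,
            intervalIntegral.integral_comp_sub_left (fun s => s ^ k), integral_pow,
            Nat.factorial_succ]
          push_cast
          field_simp
          ring

theorem isUnit_one_add_volterraL2 (hT : 0 ≤ T) (hw : Continuous (Function.uncurry w))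
    (hC : ∀ x t, ‖w x t‖ ≤ C) : IsUnit (1 + volterraL2 T hw hC) := by
  have hC0 : 0 ≤ C := (norm_nonneg _).trans (hC 0 0)
  obtain ⟨K, hK0, hK⟩ := exists_norm_le_of_ae_bound T n
  obtain ⟨L, hL0, hL⟩ := exists_integral_norm_le T n
  refine isUnit_one_add_of_norm_pow_le (C := K * (C * L)) (D := C * T) fun k => ?_
  refine ContinuousLinearMap.opNorm_le_bound _ (by positivity) fun g => ?_
  have h := hK ((volterraL2 T hw hC ^ (k + 1)) g) (C ^ (k + 1) * (L * ‖g‖) * (T ^ k / k.factorial))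
    (by positivity) ?_
  · refine h.trans (le_of_eq ?_)
    ring
  · filter_upwards [norm_volterraL2_pow_le hw hC g k, ae_restrict_mem measurableSet_Icc] with x h1 hx
    refine h1.trans ?_
    have : 0 ≤ T - x := by linarith [hx.2]
    gcongr
    · exact hL g
    · linarith [hx.1]

end Volterra

/-! ### Waves as causal families and their time primitives. -/

section Causal

variable {E : Type*} [NormedAddCommGroup E] [NormedSpace ℂ E]
variable {w : ℝ → ℝ → E →L[ℂ] E} {C T : ℝ} {f : ℝ → E}

theorem lintegral_convWave_sq_le (hC : ∀ x t, ‖w x t‖ ≤ C) (hfm : StronglyMeasurable f)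
    (hf : Integrable f) (y : ℝ) :
    ∫⁻ τ in Icc 0 T, ‖convWave w f y τ‖ₑ ^ 2 ≤
      4 * ((∫⁻ s, ‖f s‖ₑ ^ 2) + ENNReal.ofReal (C * ∫ s, ‖f s‖) ^ 2 * ENNReal.ofReal T) := by
  have hm : Measurable fun τ => ‖f τ‖ₑ ^ 2 := hfm.enorm.pow_const 2
  calc _ ≤ ∫⁻ τ in Icc 0 T, 4 * (‖f (τ - y)‖ₑ ^ 2 +
        ENNReal.ofReal (C * ∫ s, ‖f s‖) ^ 2) := by
        refine lintegral_mono fun τ => le_trans ?_ (ENNReal.add_sq_le_four_mul _ _)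
        gcongr
        refine (enorm_add_le _ _).trans ?_
        gcongr
        rw [← ofReal_norm]
        exact ENNReal.ofReal_le_ofReal (norm_convWave_integral_le hC hf y τ)
    _ ≤ _ := by
        rw [lintegral_const_mul' _ _ (by simp), lintegral_add_right _ measurable_const]
        refine mul_le_mul_right (add_le_add ?_ (by simp)) _
        refine (setLIntegral_le_lintegral _ _).trans (le_of_eq ?_)
        exact lintegral_sub_right_eq_self (fun s => ‖f s‖ₑ ^ 2) y

theorem isCausalFamily_convWave (hw : Continuous (Function.uncurry w)) (hC : ∀ x t, ‖w x t‖ ≤ C)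
    (hfm : StronglyMeasurable f) (hf : Integrable f) (hf2 : ∫⁻ s, ‖f s‖ₑ ^ 2 < ⊤)
    (hf0 : ∀ t < 0, f t = 0) : IsCausalFamily T (convWave w f) where
  stronglyMeasurable := stronglyMeasurable_convWave hw hfm
  eq_zero := fun y hy τ hτ => convWave_of_lt w hf0 (hτ.trans_le hy.1)
  bound := ⟨_, by finiteness, fun y _ => lintegral_convWave_sq_le hC hfm hf y⟩

theorem isTimePrimitive_convWave [CompleteSpace E] (hw : Continuous (Function.uncurry w))
    (hC : ∀ x t, ‖w x t‖ ≤ C)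
    (hfm : StronglyMeasurable f) (hf : Integrable f) (hf0 : ∀ t < 0, f t = 0) :
    IsTimePrimitive T (convWave w (prim f)) (convWave w f) := fun _ hy τ _ =>
  (integral_convWave hw hC hfm hf hf0 hy.1 τ).symm

omit [NormedSpace ℂ E] in
theorem IsCausalFamily.add {k k' : ℝ → ℝ → E} (hk : IsCausalFamily T k)
    (hk' : IsCausalFamily T k') : IsCausalFamily T fun y τ => k y τ + k' y τ where
  stronglyMeasurable := hk.stronglyMeasurable.add hk'.stronglyMeasurable
  eq_zero := fun y hy τ hτ => by rw [hk.eq_zero y hy τ hτ, hk'.eq_zero y hy τ hτ, add_zero]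
  bound := by
    obtain ⟨D, hD, h⟩ := hk.bound
    obtain ⟨D', hD', h'⟩ := hk'.bound
    refine ⟨4 * (D + D'), by finiteness, fun y hy => ?_⟩
    calc _ ≤ ∫⁻ τ in Icc 0 T, 4 * (‖k y τ‖ₑ ^ 2 + ‖k' y τ‖ₑ ^ 2) := by
          refine lintegral_mono fun τ => le_trans ?_ (ENNReal.add_sq_le_four_mul _ _)
          gcongr
          exact enorm_add_le _ _
      _ ≤ _ := by
          rw [lintegral_const_mul' _ _ (by simp),
            lintegral_add_left ((hk.slice y).enorm.pow_const 2)]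
          gcongr
          · exact h y hy
          · exact h' y hy

theorem IsTimePrimitive.add {P P' k k' : ℝ → ℝ → E} (hP : IsTimePrimitive T P k)
    (hP' : IsTimePrimitive T P' k') (hk : IsCausalFamily T k) (hk' : IsCausalFamily T k') :
    IsTimePrimitive T (fun y τ => P y τ + P' y τ) fun y τ => k y τ + k' y τ := by
  intro y hy τ hτ
  have h0 : (0 : ℝ) ≤ T := hy.1.trans hy.2
  simp only
  rw [hP y hy τ hτ, hP' y hy τ hτ, intervalIntegral.integral_add
    (hk.intervalIntegrable hy h0 hτ) (hk'.intervalIntegrable hy h0 hτ)]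

/-- This family is the time derivative of the continuous part `timeIntegral w y τ c` of the step
response; the step itself is treated separately. -/
theorem isCausalFamily_kernel (hw : Continuous (Function.uncurry w)) (hC : ∀ x t, ‖w x t‖ ≤ C)
    (c : E) : IsCausalFamily T fun y τ => (Ioi y).indicator (fun σ => w y σ c) τ where
  stronglyMeasurable := by
    have h : StronglyMeasurable fun p : ℝ × ℝ => w p.1 p.2 c :=
      (hw.clm_apply continuous_const).stronglyMeasurable
    exact h.indicator (measurableSet_lt measurable_fst measurable_snd)
  eq_zero := fun y hy τ hτ => indicator_of_notMem (by simpa using hτ.le.trans hy.1) _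
  bound := by
    refine ⟨ENNReal.ofReal (C * ‖c‖) ^ 2 * ENNReal.ofReal T, by finiteness, fun y hy => ?_⟩
    calc _ ≤ ∫⁻ τ in Icc 0 T, ENNReal.ofReal (C * ‖c‖) ^ 2 := by
          refine lintegral_mono fun τ => ?_
          gcongr
          rw [← ofReal_norm]
          refine ENNReal.ofReal_le_ofReal ((norm_indicator_le_norm_self _ _).trans ?_)
          exact (ContinuousLinearMap.le_opNorm _ _).trans
            (mul_le_mul_of_nonneg_right (hC _ _) (norm_nonneg _))
      _ ≤ _ := by simp

theorem isTimePrimitive_timeIntegral [CompleteSpace E] (hw : Continuous (Function.uncurry w))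
    (c : E) : IsTimePrimitive T (fun y τ => timeIntegral w y τ c)
      fun y τ => (Ioi y).indicator (fun σ => w y σ c) τ := by
  intro y hy τ _
  have hwy : Continuous (w y) := hw.comp (Continuous.prodMk_right y)
  simp only
  rcases le_total τ y with h | h
  · rw [timeIntegral_of_le w h, zero_apply]
    symm
    rw [intervalIntegral.integral_congr (g := fun _ => 0) fun σ hσ => ?_]
    · simp
    · have : σ ≤ y := hσ.2.trans (max_le hy.1 h)
      exact indicator_of_notMem (by simpa using this) _
  · rw [timeIntegral_of_ge w h, intervalIntegral.integral_of_le (hy.1.trans h),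
      setIntegral_indicator measurableSet_Ioi, intervalIntegral.integral_of_le h,
      ContinuousLinearMap.integral_apply hwy.integrableOn_Ioc]
    congr 2
    ext σ
    simp only [mem_inter_iff, mem_Ioc, mem_Ioi]
    exact ⟨fun h => ⟨⟨hy.1.trans_lt h.1, h.2⟩, h.1⟩, fun h => ⟨h.2, h.1.2⟩⟩

/-- The wave of a control of class `H¹` splits into the step part and a time primitive. -/
theorem convWave_eq_step_add [CompleteSpace E] (hw : Continuous (Function.uncurry w)) {g : ℝ → E}
    (hg : Integrable g) (hg0 : ∀ t < 0, g t = 0) (c : E) {y τ : ℝ} (hy : y ∈ Icc 0 T) (hτ : τ ≤ T) :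
    convWave w ((Icc 0 T).indicator fun t => c + prim g t) y τ =
      (Ici y).indicator (fun _ => c) τ + (timeIntegral w y τ c + convWave w (prim g) y τ) := by
  have hwy : Continuous (w y) := hw.comp (Continuous.prodMk_right y)
  rcases lt_or_ge τ y with h | h
  · rw [convWave_of_lt w (fun t ht => indicator_of_notMem (fun h' => absurd h'.1 (not_le.2 ht)) _) h,
      convWave_of_lt w (fun t ht => prim_of_nonpos hg0 ht.le) h, timeIntegral_of_le w h.le,
      indicator_of_notMem (notMem_Ici.2 h)]
    simp
  · have hi : ∀ s ∈ Icc y τ, (Icc 0 T).indicator (fun t => c + prim g t) (τ - s) =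
        c + prim g (τ - s) := fun s hs =>
      indicator_of_mem (show τ - s ∈ Icc 0 T from
        ⟨by linarith [hs.2], by linarith [hs.1, hy.1]⟩) _
    unfold convWave
    rw [hi y ⟨le_rfl, h⟩, indicator_of_mem (mem_Ici.2 h),
      setIntegral_congr_fun (g := fun s => w y s c + w y s (prim g (τ - s))) measurableSet_Ioc
      fun s hs => by
        simp only
        rw [hi s ⟨hs.1.le, hs.2⟩, map_add]]
    have h1 : IntegrableOn (fun s => w y s c) (Ioc y τ) :=
      (hwy.clm_apply continuous_const).integrableOn_Ioc
    have h2 : IntegrableOn (fun s => w y s (prim g (τ - s))) (Ioc y τ) :=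
      (hwy.clm_apply ((continuous_prim hg).comp (continuous_const.sub
        continuous_id))).integrableOn_Ioc
    rw [integral_add h1 h2, timeIntegral_of_ge w h, intervalIntegral.integral_of_le h,
      ContinuousLinearMap.integral_apply hwy.integrableOn_Ioc]
    abel

end Causal

/-! ### The potential of a pure step. -/

section StepPart

variable {E : Type*} [NormedAddCommGroup E] [NormedSpace ℂ E]
variable {q : ℝ → E →L[ℂ] E} {T : ℝ}

theorem memLp_two_comp_affine {F : Type*} [NormedAddCommGroup F] {g : ℝ → F} (hgm : StronglyMeasurable g)
    (hg : MemLp g 2) (a : ℝ) {b : ℝ} (hb : b ≠ 0) : MemLp (fun s => g (a + s / b)) 2 := by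
  have hm : StronglyMeasurable fun s => g (a + s / b) := hgm.comp_measurable (by fun_prop)
  rw [memLp_two_iff_integrable_sq_norm hm.aestronglyMeasurable]
  exact (((memLp_two_iff_integrable_sq_norm hgm.aestronglyMeasurable).1 hg).comp_add_left
    a).comp_div hb

/-- A step is not the time primitive of an `L₂` family, so its potential is computed by hand: it
equals the integral of `q c` up to `(T+x)/2`, minus twice that up to `x`, plus that up to `(T-x)/2`.
Its derivative consists of values of `q c` at these three points. -/
theorem retardedSum_step [CompleteSpace E] (hq : Integrable q) (hq0 : ∀ y, y ∉ Icc 0 T → q y = 0)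
    (c : E) {x : ℝ} (hx : x ∈ Icc 0 T) :
    retardedSum T q (fun y τ => (Ici y).indicator (fun _ => c) τ) x =
      ((2 : ℝ) • ∫ s in (0 : ℝ)..(T / 2), q s c) + ∫ s in (0 : ℝ)..x,
        ((1 / 2 : ℝ) • q (T / 2 + s / 2) c - (2 : ℝ) • q s c - (1 / 2 : ℝ) • q (T / 2 + s / -2) c) := by
  have hqc : Integrable fun y => q y c := hq.apply_continuousLinearMap c
  have hI : ∀ a, 0 ≤ a → ∫ y, (Iic a).indicator (fun y => q y c) y = ∫ y in (0 : ℝ)..a, q y c := by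
    intro a ha
    rw [integral_indicator measurableSet_Iic, intervalIntegral.integral_of_le ha,
      ← integral_Icc_eq_integral_Ioc]
    refine setIntegral_eq_of_subset_of_forall_sdiff_eq_zero measurableSet_Iic
      (fun y hy => hy.2) fun y hy => ?_
    rw [hq0 y fun h => hy.2 ⟨h.1, hy.1⟩, zero_apply]
  have hint : ∀ a, Integrable ((Iic a).indicator fun y => q y c) := fun a =>
    hqc.indicator measurableSet_Iic
  have e : ∀ y, q y ((if x < y then (1 : ℝ) else -1) • (Ici y).indicator (fun _ => c) (T - |x - y|) +
      (Ici y).indicator (fun _ => c) (T - x - y)) =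
      (Iic ((T + x) / 2)).indicator (fun y => q y c) y -
        (2 : ℝ) • (Iic x).indicator (fun y => q y c) y +
        (Iic ((T - x) / 2)).indicator (fun y => q y c) y := by
    intro y
    by_cases hy : y ∈ Icc 0 T
    · have h3 : T - x - y ∈ Ici y ↔ y ∈ Iic ((T - x) / 2) := by
        simp only [mem_Ici, mem_Iic]
        constructor <;> intro h <;> linarith
      have h3' : q y ((Ici y).indicator (fun _ => c) (T - x - y)) =
          (Iic ((T - x) / 2)).indicator (fun y => q y c) y := by
        by_cases h : T - x - y ∈ Ici y
        · rw [indicator_of_mem h, indicator_of_mem (h3.1 h)]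
        · rw [indicator_of_notMem h, indicator_of_notMem (fun h' => h (h3.2 h')), map_zero]
      rw [map_add, h3']
      congr 1
      rcases lt_or_ge x y with h | h
      · rw [if_pos h, one_smul, indicator_of_notMem (s := Iic x) (by simpa using h), smul_zero,
          sub_zero, abs_of_neg (by linarith)]
        have h4 : T - -(x - y) ∈ Ici y ↔ y ∈ Iic ((T + x) / 2) := by
          simp only [mem_Ici, mem_Iic]
          constructor <;> intro h <;> linarith
        by_cases h' : T - -(x - y) ∈ Ici y
        · rw [indicator_of_mem h', indicator_of_mem (h4.1 h')]
        · rw [indicator_of_notMem h', indicator_of_notMem (fun h'' => h' (h4.2 h'')), map_zero]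
      · rw [if_neg (not_lt.2 h), abs_of_nonneg (by linarith),
          indicator_of_mem (show T - (x - y) ∈ Ici y from by
            simp only [mem_Ici]; linarith [hx.2]),
          indicator_of_mem (show y ∈ Iic ((T + x) / 2) from by
            simp only [mem_Iic]; linarith [hx.2]),
          indicator_of_mem (mem_Iic.2 h), neg_one_smul, map_neg, two_smul]
        abel
    · simp [hq0 y hy, indicator_apply]
  have hT : 0 ≤ T := hx.1.trans hx.2
  have hii : ∀ a b, IntervalIntegrable (fun y => q y c) volume a b := fun a b =>
    hqc.intervalIntegrable
  have h1 : Integrable fun s => (1 / 2 : ℝ) • q (T / 2 + s / 2) c :=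
    ((hqc.comp_add_left (T / 2)).comp_div two_ne_zero).smul (1 / 2 : ℝ)
  have h2 : Integrable fun s => (1 / 2 : ℝ) • q (T / 2 + s / -2) c :=
    ((hqc.comp_add_left (T / 2)).comp_div (R := -2) (by norm_num)).smul (1 / 2 : ℝ)
  have h3 : Integrable fun s => (2 : ℝ) • q s c := hqc.smul (2 : ℝ)
  have h12 : Integrable fun y => (Iic ((T + x) / 2)).indicator (fun y => q y c) y -
        (2 : ℝ) • (Iic x).indicator (fun y => q y c) y := (hint _).sub ((hint x).smul (2 : ℝ))
  have hx2 : Integrable fun y => (2 : ℝ) • (Iic x).indicator (fun y => q y c) y :=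
    (hint x).smul (2 : ℝ)
  have h13 : IntervalIntegrable (fun s => (1 / 2 : ℝ) • q (T / 2 + s / 2) c - (2 : ℝ) • q s c)
      volume 0 x := (h1.sub h3).intervalIntegrable
  unfold retardedSum
  simp_rw [e]
  rw [integral_add h12 (hint _), integral_sub (hint _) hx2, integral_smul,
    hI _ (by linarith [hx.1]), hI _ hx.1, hI _ (by linarith [hx.2]),
    intervalIntegral.integral_sub h13 h2.intervalIntegrable,
    intervalIntegral.integral_sub h1.intervalIntegrable h3.intervalIntegrable,
    intervalIntegral.integral_smul, intervalIntegral.integral_smul, intervalIntegral.integral_smul,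
    intervalIntegral.integral_comp_add_div (fun y => q y c) two_ne_zero,
    intervalIntegral.integral_comp_add_div (fun y => q y c) (by norm_num : (-2 : ℝ) ≠ 0),
    smul_smul, smul_smul]
  norm_num
  have e1 : ∫ y in (T / 2)..(T / 2 + x / 2), q y c =
      (∫ y in (0 : ℝ)..((T + x) / 2), q y c) - ∫ y in (0 : ℝ)..(T / 2), q y c := by
    rw [intervalIntegral.integral_interval_sub_left (hii _ _) (hii _ _)]
    congr 1; ring
  have e2 : ∫ y in (T / 2)..(T / 2 + x / -2), q y c =
      (∫ y in (0 : ℝ)..((T - x) / 2), q y c) - ∫ y in (0 : ℝ)..(T / 2), q y c := by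
    rw [intervalIntegral.integral_interval_sub_left (hii _ _) (hii _ _)]
    congr 1; ring
  rw [e1, e2, two_smul, two_smul]
  abel

end StepPart

/-! ### Smoothing: from `L₂` to `H¹` and from `H¹` to `H²`. -/

section Smoothing

variable {T : ℝ} {n : ℕ}
variable {q : ℝ → EuclideanSpace ℂ (Fin n) →L[ℂ] EuclideanSpace ℂ (Fin n)}
  {w : ℝ → ℝ → EuclideanSpace ℂ (Fin n) →L[ℂ] EuclideanSpace ℂ (Fin n)} {C : ℝ}

theorem exists_isWeakDeriv_of_primitive {f : L2Space T n} {g : ℝ → EuclideanSpace ℂ (Fin n)}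
    (hg : MemLp g 2 (volume.restrict (Icc 0 T))) {c : EuclideanSpace ℂ (Fin n)}
    (h : ∀ᵐ x ∂volume.restrict (Icc 0 T), f x = c + ∫ s in (0 : ℝ)..x, g s) :
    ∃ G : L2Space T n, (∀ᵐ x ∂volume.restrict (Icc 0 T), G x = g x) ∧ IsWeakDeriv f G := by
  refine ⟨hg.toLp, hg.coeFn_toLp, isWeakDeriv_of_ae_eq_primitive (c := c) ?_⟩
  filter_upwards [h, ae_restrict_mem measurableSet_Icc] with x hx hxT
  rw [hx, intervalIntegral.integral_of_le hxT.1, intervalIntegral.integral_of_le hxT.1]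
  congr 1
  refine integral_congr_ae ?_
  filter_upwards [ae_restrict_of_ae_restrict_of_subset
    (fun s hs => ⟨hs.1.le, hs.2.trans hxT.2⟩ : Ioc 0 x ⊆ Icc 0 T) hg.coeFn_toLp] with s hs
  exact hs.symm

theorem integrable_of_zero_off {f : L2Space T n} {F : ℝ → EuclideanSpace ℂ (Fin n)}
    (hF0 : ∀ t, t ∉ Icc 0 T → F t = 0)
    (hFf : ∀ᵐ x ∂volume.restrict (Icc 0 T), F x = f x) :
    Integrable F ∧ ∫⁻ s, ‖F s‖ₑ ^ 2 < ⊤ := by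
  have hi : (Icc 0 T).indicator F = F := by
    funext t
    by_cases h : t ∈ Icc 0 T
    · rw [indicator_of_mem h]
    · rw [indicator_of_notMem h, hF0 t h]
  constructor
  · rw [← hi, integrable_indicator_iff measurableSet_Icc]
    exact f.integrable.congr (Filter.EventuallyEq.symm hFf)
  · refine lintegral_sq_lt_top_of_memLp_two ?_
    rw [← hi, memLp_indicator_iff_restrict measurableSet_Icc]
    exact (memLp_congr_ae hFf).2 (Lp.memLp f)

theorem volterraL2_reflectL2_ae (hw : Continuous (Function.uncurry w)) (hC : ∀ x t, ‖w x t‖ ≤ C)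
    {f : L2Space T n} {F : ℝ → EuclideanSpace ℂ (Fin n)}
    (hFf : ∀ᵐ x ∂volume.restrict (Icc 0 T), F x = f x) :
    ∀ᵐ x ∂volume.restrict (Icc 0 T), volterraL2 T hw hC (reflectL2 T n f) x =
      ∫ s in Ioc x T, w x s (F (T - s)) := by
  have h := (measurePreserving_reflect T).quasiMeasurePreserving.ae hFf
  filter_upwards [volterraL2_ae hw hC (reflectL2 T n f), ae_restrict_mem measurableSet_Icc]
    with x hx hxT
  rw [hx]
  have hsub : Ioc x T ⊆ Icc 0 T := fun s hs => ⟨hxT.1.trans hs.1.le, hs.2⟩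
  refine integral_congr_ae ?_
  filter_upwards [ae_restrict_of_ae_restrict_of_subset hsub h,
    ae_restrict_of_ae_restrict_of_subset hsub (reflectL2_ae f)] with s h1 h2
  rw [h1, h2]

/-- First gain of a derivative, for arbitrary `f` in `L₂`: the wave of `prim F` is the time
primitive of the wave of `F`, so the retarded difference is an `x`-primitive. -/
theorem exists_isWeakDeriv_volterraL2 (hT : 0 ≤ T) (hq : Integrable q) (hq2 : MemLp q 2)
    (hq0 : ∀ y, y ∉ Icc 0 T → q y = 0)
    (hw : Continuous (Function.uncurry w)) (hC : ∀ x t, ‖w x t‖ ≤ C)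
    (hker : ∀ x t, (x, t) ∈ triangle T → w x t =
        -((1 / 2 : ℝ) • ∫ s in ((t - x) / 2)..((t + x) / 2), q s)
          - (1 / 2 : ℝ) • goursatInt q w x t)
    {f : L2Space T n} {F : ℝ → EuclideanSpace ℂ (Fin n)} (hFm : StronglyMeasurable F)
    (hF0 : ∀ t, t ∉ Icc 0 T → F t = 0)
    (hFf : ∀ᵐ x ∂volume.restrict (Icc 0 T), F x = f x) :
    ∃ h : L2Space T n, (∀ᵐ x ∂volume.restrict (Icc 0 T), h x =
        (-(1 / 2) : ℝ) • retardedSum T q (convWave w F) x) ∧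
      IsWeakDeriv (volterraL2 T hw hC (reflectL2 T n f)) h := by
  obtain ⟨hFi, hF2⟩ := integrable_of_zero_off hF0 hFf
  have hFn : ∀ t < 0, F t = 0 := fun t ht => hF0 t fun h => absurd h.1 (not_le.2 ht)
  have hk : IsCausalFamily T (convWave w F) := isCausalFamily_convWave hw hC hFm hFi hF2 hFn
  have hP := isTimePrimitive_convWave (T := T) hw hC hFm hFi hFn
  refine exists_isWeakDeriv_of_primitive (c := 0)
    ((hk.memLp_retardedSum hq2 hq hq0).const_smul (-(1 / 2) : ℝ)) ?_
  filter_upwards [volterraL2_reflectL2_ae hw hC hFf, ae_restrict_mem measurableSet_Icc] with x h1 hx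
  rw [h1, integral_kernel_eq_retardedDiff hT hq hq0 hw hC hker hFi hFn hx.1,
    retardedDiff_eq_integral hP hk hq hq0 hx, zero_add]
  rw [← neg_smul, ← intervalIntegral.integral_smul]

/-- Second gain, from one weak derivative of `f`. With `f = c + prim g`, the first derivative is a
retarded sum over a wave that splits into a step and the time primitive `P` of `k`. The step yields
`h₁` explicitly and `P` yields `h₂`, both in `L₂` because `q` is. -/
theorem IsWeakDeriv.exists_second_volterraL2 (hT : 0 < T) (hqm : StronglyMeasurable q)
    (hq : Integrable q) (hq2 : MemLp q 2)
    (hq0 : ∀ y, y ∉ Icc 0 T → q y = 0)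
    (hw : Continuous (Function.uncurry w)) (hC : ∀ x t, ‖w x t‖ ≤ C)
    (hker : ∀ x t, (x, t) ∈ triangle T → w x t =
        -((1 / 2 : ℝ) • ∫ s in ((t - x) / 2)..((t + x) / 2), q s)
          - (1 / 2 : ℝ) • goursatInt q w x t)
    {f g : L2Space T n} (hfg : IsWeakDeriv f g) :
    ∃ h h' : L2Space T n, IsWeakDeriv (volterraL2 T hw hC (reflectL2 T n f)) h ∧
      IsWeakDeriv h h' := by
  obtain ⟨c, hc⟩ := hfg.ae_eq_primitive hT
  set G : ℝ → EuclideanSpace ℂ (Fin n) := (Icc 0 T).indicator g with hG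
  have hGm : StronglyMeasurable G := (Lp.stronglyMeasurable g).indicator measurableSet_Icc
  have hG0 : ∀ t, t ∉ Icc 0 T → G t = 0 := fun t ht => indicator_of_notMem ht _
  have hGn : ∀ t < 0, G t = 0 := fun t ht => hG0 t fun h => absurd h.1 (not_le.2 ht)
  obtain ⟨hGi, hG2⟩ := integrable_of_zero_off (f := g) hG0
    ((ae_restrict_iff' measurableSet_Icc).2 (Filter.Eventually.of_forall fun x hx =>
      indicator_of_mem hx _))
  set F : ℝ → EuclideanSpace ℂ (Fin n) := (Icc 0 T).indicator fun t => c + prim G t with hF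
  have hFm : StronglyMeasurable F :=
    (continuous_const.add (continuous_prim hGi)).stronglyMeasurable.indicator measurableSet_Icc
  have hFf : ∀ᵐ x ∂volume.restrict (Icc 0 T), F x = f x := by
    filter_upwards [hc, ae_restrict_mem measurableSet_Icc] with x h1 hx
    rw [h1, hF, indicator_of_mem hx]
    congr 1
    refine intervalIntegral.integral_congr fun s hs => ?_
    rw [uIcc_of_le hx.1] at hs
    exact indicator_of_mem (show s ∈ Icc 0 T from ⟨hs.1, hs.2.trans hx.2⟩) _
  obtain ⟨h, hh, hd⟩ := exists_isWeakDeriv_volterraL2 hT.le hq hq2 hq0 hw hC hker hFm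
    (fun t ht => indicator_of_notMem ht _) hFf
  set k : ℝ → ℝ → EuclideanSpace ℂ (Fin n) := fun y τ =>
    (Ioi y).indicator (fun σ => w y σ c) τ + convWave w G y τ with hk
  set P : ℝ → ℝ → EuclideanSpace ℂ (Fin n) := fun y τ =>
    timeIntegral w y τ c + convWave w (prim G) y τ with hP
  have hkw : IsCausalFamily T (convWave w G) := isCausalFamily_convWave hw hC hGm hGi hG2 hGn
  have hkc : IsCausalFamily T k := (isCausalFamily_kernel hw hC c).add hkw
  have hPk : IsTimePrimitive T P k := (isTimePrimitive_timeIntegral hw c).add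
    (isTimePrimitive_convWave hw hC hGm hGi hGn) (isCausalFamily_kernel hw hC c) hkw
  have hPm : StronglyMeasurable (Function.uncurry P) :=
    ((continuous_timeIntegral hw).clm_apply continuous_const).stronglyMeasurable.add
      (stronglyMeasurable_convWave hw (continuous_prim hGi).stronglyMeasurable)
  set Θ : ℝ → ℝ → EuclideanSpace ℂ (Fin n) := fun y τ => (Ici y).indicator (fun _ => c) τ with hΘ
  have hΘm : StronglyMeasurable (Function.uncurry Θ) :=
    (stronglyMeasurable_const (b := c)).indicator (measurableSet_le measurable_fst measurable_snd)
  have hΘc : ∀ y τ, ‖Θ y τ‖ ≤ ‖c‖ := fun y τ => norm_indicator_le_norm_self _ _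
  obtain ⟨M, hM0, hM⟩ := hPk.exists_norm_le hkc
  have hsplit : ∀ x ∈ Icc 0 T, retardedSum T q (convWave w F) x =
      retardedSum T q Θ x + retardedSum T q P x := by
    intro x hx
    have hint : ∀ (K : ℝ → ℝ → EuclideanSpace ℂ (Fin n)) (N : ℝ),
        StronglyMeasurable (Function.uncurry K) →
        (∀ y ∈ Icc 0 T, ∀ τ ≤ T, ‖K y τ‖ ≤ N) →
        Integrable fun y => q y ((if x < y then (1 : ℝ) else -1) • K y (T - |x - y|)
          + K y (T - x - y)) := by
      intro K N hKm hKN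
      refine (hq.norm.mul_const (N + N)).mono' (aestronglyMeasurable_clm_apply
        hq.aestronglyMeasurable ((stronglyMeasurable_sumKernel hKm).comp_measurable
          (measurable_prodMk_left (x := x))).aestronglyMeasurable)
        (Filter.Eventually.of_forall fun y => ?_)
      by_cases hy : y ∈ Icc 0 T
      · refine (ContinuousLinearMap.le_opNorm _ _).trans
          (mul_le_mul_of_nonneg_left ((norm_sumKernel_le x y).trans (add_le_add ?_ ?_))
            (norm_nonneg _))
        · exact hKN y hy _ (by linarith [abs_nonneg (x - y)])
        · exact hKN y hy _ (by linarith [hx.1, hy.1])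
      · simp [hq0 y hy]
    unfold retardedSum
    rw [← integral_add (hint Θ ‖c‖ hΘm fun y _ τ _ => hΘc y τ) (hint P M hPm hM)]
    refine integral_congr_ae (Filter.Eventually.of_forall fun y => ?_)
    simp only
    by_cases hy : y ∈ Icc 0 T
    · rw [hF, convWave_eq_step_add hw hGi hGn c hy (by linarith [abs_nonneg (x - y)]),
        convWave_eq_step_add hw hGi hGn c hy (by linarith [hx.1, hy.1]), ← map_add, smul_add]
      congr 1
      simp only [hΘ, hP]
      abel
    · simp [hq0 y hy]
  obtain ⟨c', hc'⟩ := retardedSum_eq_integral hPk hPm hkc hq hq0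
  set h₁ : ℝ → EuclideanSpace ℂ (Fin n) := fun s =>
    (1 / 2 : ℝ) • q (T / 2 + s / 2) c - (2 : ℝ) • q s c - (1 / 2 : ℝ) • q (T / 2 + s / -2) c with hh₁
  set h₂ : ℝ → EuclideanSpace ℂ (Fin n) := fun s =>
    retardedDiff T q k s - (2 : ℝ) • q s (P s T) with hh₂
  have hqcm : StronglyMeasurable fun s => q s c := 
    (ContinuousLinearMap.apply ℂ (EuclideanSpace ℂ (Fin n)) c).continuous.comp_stronglyMeasurable hqm
  have hqc2 : MemLp (fun s => q s c) 2 := by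
    refine MemLp.of_le_mul (c := ‖c‖) hq2 hqcm.aestronglyMeasurable
      (Filter.Eventually.of_forall fun s => ?_)
    rw [mul_comm]
    exact ContinuousLinearMap.le_opNorm _ _
  have hh₁m : MemLp h₁ 2 (volume.restrict (Icc 0 T)) :=
    ((((memLp_two_comp_affine hqcm hqc2 (T / 2) two_ne_zero).const_smul (1 / 2 : ℝ)).sub
      (hqc2.const_smul (2 : ℝ))).sub ((memLp_two_comp_affine hqcm hqc2 (T / 2)
        (b := -2) (by norm_num)).const_smul (1 / 2 : ℝ))).restrict _
  have hqP : MemLp (fun s => q s (P s T)) 2 := by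
    refine MemLp.of_le_mul (c := M) hq2 (aestronglyMeasurable_clm_apply hq.aestronglyMeasurable
      (hPm.comp_measurable (by fun_prop : Measurable fun s : ℝ => (s, T))).aestronglyMeasurable)
      (Filter.Eventually.of_forall fun s => ?_)
    by_cases hs : s ∈ Icc 0 T
    · rw [mul_comm]
      exact (ContinuousLinearMap.le_opNorm _ _).trans (mul_le_mul_of_nonneg_left
        (hM s hs T le_rfl) (norm_nonneg _))
    · simp [hq0 s hs]
  have hh₂m : MemLp h₂ 2 (volume.restrict (Icc 0 T)) :=
    (hkc.memLp_retardedDiff hq2 hq hq0).sub ((hqP.const_smul (2 : ℝ)).restrict _)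
  obtain ⟨h', -, hd'⟩ := exists_isWeakDeriv_of_primitive (f := h)
    (c := (-(1 / 2) : ℝ) • (((2 : ℝ) • ∫ s in (0 : ℝ)..(T / 2), q s c) + c'))
    ((hh₁m.add hh₂m).const_smul (-(1 / 2) : ℝ)) (by
      filter_upwards [hh, ae_restrict_mem measurableSet_Icc] with x hx hxT
      have hsub : uIcc 0 x ⊆ Icc 0 T := uIcc_subset_Icc ⟨le_rfl, hT.le⟩ hxT
      have hi₁ : IntervalIntegrable h₁ volume 0 x :=
        (IntegrableOn.mono_set (hh₁m.integrable (by norm_num)) hsub).intervalIntegrable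
      have hi₂ : IntervalIntegrable h₂ volume 0 x :=
        (IntegrableOn.mono_set (hh₂m.integrable (by norm_num)) hsub).intervalIntegrable
      rw [hx, hsplit x hxT, retardedSum_step hq hq0 c hxT, hc' x hxT]
      simp only [Pi.smul_apply, Pi.add_apply]
      rw [intervalIntegral.integral_smul, intervalIntegral.integral_add hi₁ hi₂, ← smul_add]
      congr 1
      abel)
  exact ⟨h, h', hd, hd'⟩

end Smoothing

/-! ### Completeness of `H²` and restriction of operators to it. -/

section Sobolev

variable {T : ℝ} {n : ℕ}

theorem continuous_integral_test_smul {ψ : ℝ → ℝ} (hψ : Continuous ψ) (hc : HasCompactSupport ψ) :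
    Continuous fun f : L2Space T n => ∫ x in Icc 0 T, ψ x • f x := by
  obtain ⟨C, hC⟩ := hψ.bounded_above_of_compact_support hc
  obtain ⟨K, hK0, hK⟩ := exists_integral_norm_le T n
  have hC0 : 0 ≤ C := (norm_nonneg _).trans (hC 0)
  refine LipschitzWith.continuous (K := Real.toNNReal (C * K))
    (LipschitzWith.of_dist_le_mul fun f g => ?_)
  rw [dist_eq_norm, dist_eq_norm, ← integral_sub (integrable_test_smul hψ hc f)
    (integrable_test_smul hψ hc g), Real.coe_toNNReal _ (mul_nonneg hC0 hK0), mul_assoc]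
  refine le_trans ?_ (mul_le_mul_of_nonneg_left (hK (f - g)) hC0)
  rw [← integral_const_mul]
  refine norm_integral_le_of_norm_le ((f - g).integrable.norm.const_mul C) ?_
  filter_upwards [Lp.coeFn_sub f g] with x hx
  rw [hx, Pi.sub_apply, ← smul_sub, norm_smul]
  exact mul_le_mul_of_nonneg_right (hC x) (norm_nonneg _)

/-- Each test function imposes an equation between continuous functionals on `L₂`. Closedness makes
`H²` complete, as the closed graph theorem requires. -/
theorem isClosed_isWeakDeriv {X : Type*} [TopologicalSpace X] {a b : X → L2Space T n}
    (ha : Continuous a) (hb : Continuous b) : IsClosed {x | IsWeakDeriv (a x) (b x)} := by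
  simp only [IsWeakDeriv, ofPred_forall]
  refine isClosed_iInter fun φ => isClosed_iInter fun hφ => isClosed_iInter fun hc =>
    isClosed_iInter fun _ => isClosed_eq ?_ ?_
  · exact (continuous_integral_test_smul (hφ.continuous_deriv (by simp)) hc.deriv).comp ha
  · exact ((continuous_integral_test_smul hφ.continuous hc).comp hb).neg

theorem isClosed_H2Space : IsClosed (H2Space T n : Set (PiLp 2 fun _ : Fin 3 => L2Space T n)) :=
  (isClosed_isWeakDeriv (by fun_prop) (by fun_prop)).inter
    (isClosed_isWeakDeriv (by fun_prop) (by fun_prop))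

instance : CompleteSpace (H2Space T n) := isClosed_H2Space.completeSpace_coe

/-- The embedding of `H²` into `L₂`. -/
noncomputable def h2Embed (T : ℝ) (n : ℕ) : H2Space T n →L[ℂ] L2Space T n :=
  (PiLp.proj 2 (fun _ : Fin 3 => L2Space T n) 0).comp (H2Space T n).subtypeL

theorem h2Embed_injective : Function.Injective (h2Embed T n) := by
  intro F G h
  have h0 : F.1 0 = G.1 0 := h
  have h1 : F.1 1 = G.1 1 := by
    have := F.2.1
    rw [h0] at this
    exact this.unique G.2.1
  have h2 : F.1 2 = G.1 2 := by
    have := F.2.2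
    rw [h1] at this
    exact this.unique G.2.2
  refine Subtype.ext (PiLp.ext fun i => ?_)
  fin_cases i
  exacts [h0, h1, h2]

theorem mem_range_h2Embed {f : L2Space T n} :
    f ∈ LinearMap.range (h2Embed T n).toLinearMap ↔
      ∃ g h : L2Space T n, IsWeakDeriv f g ∧ IsWeakDeriv g h := by
  constructor
  · rintro ⟨F, rfl⟩
    exact ⟨F.1 1, F.1 2, F.2⟩
  · rintro ⟨g, h, h1, h2⟩
    exact ⟨⟨WithLp.toLp 2 ![f, g, h], h1, h2⟩, rfl⟩

/-- A bijective bounded operator on `L₂` that preserves and reflects membership in `H²` restricts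
to an isomorphism of `H²`. -/
theorem exists_h2_equiv {W : L2Space T n →L[ℂ] L2Space T n} (hW : Function.Bijective W)
    (hH : ∀ f, W f ∈ LinearMap.range (h2Embed T n).toLinearMap ↔
      f ∈ LinearMap.range (h2Embed T n).toLinearMap) :
    ∃ Φ : H2Space T n ≃L[ℂ] H2Space T n, ∀ F, h2ToL2 (Φ F) = W (h2ToL2 F) := by
  set e := LinearEquiv.ofInjective (h2Embed T n).toLinearMap h2Embed_injective
  set L : H2Space T n →ₗ[ℂ] H2Space T n :=
    e.symm.toLinearMap ∘ₗ (W.toLinearMap.restrict fun f hf => (hH f).2 hf) ∘ₗ e.toLinearMap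
  have hL : ∀ F, h2Embed T n (L F) = W (h2Embed T n F) := fun F =>
    congrArg Subtype.val (e.apply_symm_apply
      ((W.toLinearMap.restrict fun f hf => (hH f).2 hf) (e F)))
  have hLc : Continuous L := by
    -- The graph is closed since `W` is continuous in `L₂` and limits in `H²` are determined by
    -- their image in `L₂`; no explicit `H²` estimate is needed.
    refine L.continuous_of_seq_closed_graph fun u x y hx hy => h2Embed_injective ?_
    have h1 := ((h2Embed T n).continuous.tendsto y).comp hy
    have h2 := ((W.comp (h2Embed T n)).continuous.tendsto x).comp hx
    rw [hL]
    refine tendsto_nhds_unique h1 (h2.congr fun m => ?_)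
    exact (hL _).symm
  -- The inverse is bounded by the open mapping theorem.
  refine ⟨ContinuousLinearEquiv.ofBijective ⟨L, hLc⟩ ?_ ?_, fun F => ?_⟩
  · refine LinearMap.ker_eq_bot.2 fun F G h => h2Embed_injective (hW.1 ?_)
    rw [← hL, ← hL]
    exact congrArg _ h
  · refine LinearMap.range_eq_top.2 fun G => ?_
    obtain ⟨f, hf⟩ := hW.2 (h2Embed T n G)
    obtain ⟨F, rfl⟩ := (hH f).1 (hf ▸ ⟨G, rfl⟩)
    refine ⟨F, h2Embed_injective ?_⟩
    rw [← hf]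
    exact hL F
  · exact hL F

end Sobolev

/-! ### The control operator in `L₂` and in `H²`. -/

section ControlOperator

variable {T : ℝ} {n : ℕ}
variable {w : ℝ → ℝ → EuclideanSpace ℂ (Fin n) →L[ℂ] EuclideanSpace ℂ (Fin n)} {C : ℝ}

/-- The control operator `f ↦ f(T - ·) + ∫ₓᵀ w(x,s) f(T - s) ds` in `L₂`. -/
noncomputable def controlL2 (T : ℝ) (hw : Continuous (Function.uncurry w))
    (hC : ∀ x t, ‖w x t‖ ≤ C) : L2Space T n →L[ℂ] L2Space T n :=
  (1 + volterraL2 T hw hC).comp (reflectL2 T n)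

theorem controlL2_apply (hw : Continuous (Function.uncurry w)) (hC : ∀ x t, ‖w x t‖ ≤ C)
    (f : L2Space T n) : controlL2 T hw hC f =
      reflectL2 T n f + volterraL2 T hw hC (reflectL2 T n f) := rfl

theorem bijective_controlL2 (hT : 0 ≤ T) (hw : Continuous (Function.uncurry w))
    (hC : ∀ x t, ‖w x t‖ ≤ C) : Function.Bijective (controlL2 T hw hC : L2Space T n →L[ℂ] _) := by
  obtain ⟨u, hu⟩ := isUnit_one_add_volterraL2 (n := n) hT hw hC
  have h1 : Function.Bijective (1 + volterraL2 T hw hC : L2Space T n →L[ℂ] L2Space T n) := by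
    rw [← hu]
    refine Function.bijective_iff_has_inverse.2 ⟨(u⁻¹.1 : L2Space T n →L[ℂ] L2Space T n), ?_, ?_⟩
    · intro f
      rw [← mul_apply_eq_comp, u.inv_mul]
      rfl
    · intro f
      rw [← mul_apply_eq_comp, u.mul_inv]
      rfl
  have h2 : Function.Involutive (reflectL2 T n) := reflectL2_reflectL2
  exact h1.comp h2.bijective

/-- Regularity bootstrap: `W f` and `R f` differ by the smoother term `V R f`. One pass suffices in
the forward direction, two in the converse. -/
theorem mem_range_h2Embed_controlL2
    {q : ℝ → EuclideanSpace ℂ (Fin n) →L[ℂ] EuclideanSpace ℂ (Fin n)}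
    (hT : 0 < T) (hqm : StronglyMeasurable q)
    (hq : Integrable q) (hq2 : MemLp q 2)
    (hq0 : ∀ y, y ∉ Icc 0 T → q y = 0)
    (hw : Continuous (Function.uncurry w)) (hC : ∀ x t, ‖w x t‖ ≤ C)
    (hker : ∀ x t, (x, t) ∈ triangle T → w x t =
        -((1 / 2 : ℝ) • ∫ s in ((t - x) / 2)..((t + x) / 2), q s)
          - (1 / 2 : ℝ) • goursatInt q w x t) (f : L2Space T n) :
    controlL2 T hw hC f ∈ LinearMap.range (h2Embed T n).toLinearMap ↔
      f ∈ LinearMap.range (h2Embed T n).toLinearMap := by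
  rw [mem_range_h2Embed, mem_range_h2Embed]
  constructor
  · rintro ⟨g, h, h1, h2⟩
    have e : reflectL2 T n f =
        controlL2 T hw hC f - volterraL2 T hw hC (reflectL2 T n f) := by
      rw [controlL2_apply, add_sub_cancel_right]
    obtain ⟨v, -, hv⟩ := exists_isWeakDeriv_volterraL2 hT.le hq hq2 hq0 hw hC hker
      ((Lp.stronglyMeasurable f).indicator measurableSet_Icc)
      (fun t ht => indicator_of_notMem ht _)
      ((ae_restrict_iff' measurableSet_Icc).2 (Filter.Eventually.of_forall fun x hx =>
        indicator_of_mem hx _))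
    -- For `f` merely in `L₂` the Volterra term has one derivative, hence so has `f`; only then does
    -- the second gain apply.
    have hf1 := (h1.sub hv).reflect
    rw [← e, reflectL2_reflectL2] at hf1
    obtain ⟨v', v'', hv1, hv2⟩ := hf1.exists_second_volterraL2 hT hqm hq hq2 hq0 hw hC hker
    have hf2 := (h1.sub hv1).reflect
    rw [← e, reflectL2_reflectL2] at hf2
    exact ⟨_, _, hf2, (h2.sub hv2).reflect.neg⟩
  · rintro ⟨g, h, h1, h2⟩
    obtain ⟨v', v'', hv1, hv2⟩ := h1.exists_second_volterraL2 hT hqm hq hq2 hq0 hw hC hker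
    exact ⟨_, _, h1.reflect.add hv1, h2.reflect.neg.add hv2⟩

end ControlOperator

/-! ### From matrices to operators, and the conclusion. -/

/-- The action of matrices on vectors as a continuous linear map. -/
noncomputable def matrixCLM (n : ℕ) : Matrix (Fin n) (Fin n) ℂ →L[ℂ]
    (EuclideanSpace ℂ (Fin n) →L[ℂ] EuclideanSpace ℂ (Fin n)) :=
  LinearMap.toContinuousLinearMap
    (Matrix.toEuclideanCLM (n := Fin n) (𝕜 := ℂ)).toAlgEquiv.toLinearMap

theorem matrixCLM_apply {n : ℕ} (A : Matrix (Fin n) (Fin n) ℂ) :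
    matrixCLM n A = Matrix.toEuclideanCLM (n := Fin n) (𝕜 := ℂ) A := rfl

/-- The passage from matrices to operators is continuous, linear and multiplicative, so it commutes
with the integrals and with the product in the Goursat equation. -/
theorem matrixCLM_goursat_eq {n : ℕ} {T C : ℝ} {q : ℝ → Matrix (Fin n) (Fin n) ℂ}
    {w : ℝ → ℝ → Matrix (Fin n) (Fin n) ℂ} (hq : Integrable q)
    (hq0 : ∀ y, y ∉ Icc 0 T → q y = 0)
    (hw : Continuous (Function.uncurry w)) (hC : ∀ x t, ‖w x t‖ ≤ C) {x t : ℝ}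
    (hxt : (x, t) ∈ triangle T) (h : w x t =
        -((1 / 2 : ℝ) • ∫ s in ((t - x) / 2)..((t + x) / 2), q s)
          - (1 / 2 : ℝ) • goursatInt q w x t) :
    matrixCLM n (w x t) =
        -((1 / 2 : ℝ) • ∫ s in ((t - x) / 2)..((t + x) / 2), matrixCLM n (q s))
          - (1 / 2 : ℝ) • goursatInt (fun s => matrixCLM n (q s))
            (fun x t => matrixCLM n (w x t)) x t := by
  have hti : ∀ y τ, timeIntegral (fun x t => matrixCLM n (w x t)) y τ =
      matrixCLM n (timeIntegral w y τ) := fun y τ =>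
    (matrixCLM n).intervalIntegral_comp_comm
      ((hw.comp (Continuous.prodMk_right y)).intervalIntegrable _ _)
  rw [h, map_sub, map_neg, map_real_smul _ (matrixCLM n).continuous,
    map_real_smul _ (matrixCLM n).continuous,
    (matrixCLM n).intervalIntegral_comp_comm hq.intervalIntegrable]
  congr 2
  unfold goursatInt
  rw [← (matrixCLM n).integral_comp_comm
    (integrable_goursat_integrand hq hq0 hw hC hxt.1 (hxt.1.trans hxt.2.1) hxt.2.2)]
  congr 1
  funext y
  rw [hti, hti, ← map_sub, matrixCLM_apply, map_mul]
  rfl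

theorem wave_eq {n : ℕ} (w : ℝ → ℝ → Matrix (Fin n) (Fin n) ℂ)
    (f : ℝ → EuclideanSpace ℂ (Fin n)) {x t : ℝ} (hxt : x ≤ t) :
    wave w f x t = f (t - x) + ∫ s in Ioc x t, matrixCLM n (w x s) (f (t - s)) := by
  unfold wave
  rw [indicator_of_mem (mem_Ici.2 (sub_nonneg.2 hxt))]
  congr 1
  refine setIntegral_congr_fun measurableSet_Ioc fun s hs => ?_
  rw [indicator_of_mem (mem_Ici.2 (sub_nonneg.2 hs.2))]
  rfl

theorem theorem5p1 (n : ℕ) (T : ℝ) (hT : 0 < T) (q : ℝ → Matrix (Fin n) (Fin n) ℂ)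
    (hq : MemLp q 2 (volume.restrict (Icc (0 : ℝ) T))) :
    -- the kernel `w` exists and is unique on the triangle
    ∃ w : ℝ → ℝ → Matrix (Fin n) (Fin n) ℂ, IsGoursatKernel q T w ∧
      (∀ w' : ℝ → ℝ → Matrix (Fin n) (Fin n) ℂ, IsGoursatKernel q T w' →
        ∀ x t : ℝ, (x, t) ∈ triangle T → w' x t = w x t) ∧
      -- `W` is the control operator `f ↦ u(·,T)` in `L₂`
      ∃ W : L2Space T n →L[ℂ] L2Space T n,
        (∀ f : L2Space T n,
          (W f : ℝ → EuclideanSpace ℂ (Fin n)) =ᵐ[volume.restrict (Icc (0 : ℝ) T)]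
            fun x => wave w f x T) ∧
        -- and its restriction to `H²` is an isomorphism of `H²`
        ∃ Φ : H2Space T n ≃L[ℂ] H2Space T n,
          ∀ F : H2Space T n, h2ToL2 (Φ F) = W (h2ToL2 F) := by
  -- A strongly measurable representative, extended by zero, so that all potentials are integrals
  -- over the whole line and points outside `[0,T]` contribute nothing.
  set q₀ : ℝ → Matrix (Fin n) (Fin n) ℂ := (Icc 0 T).indicator (hq.1.mk q) with hq₀
  have hqm : StronglyMeasurable q₀ := hq.1.stronglyMeasurable_mk.indicator measurableSet_Icc
  have hq0 : ∀ y, y ∉ Icc 0 T → q₀ y = 0 := fun y hy => indicator_of_notMem hy _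
  have hqq : q =ᵐ[volume.restrict (Icc 0 T)] q₀ := by
    filter_upwards [hq.1.ae_eq_mk, ae_restrict_mem measurableSet_Icc] with y h1 hy
    rw [h1, hq₀, indicator_of_mem hy]
  have hmk : MemLp (hq.1.mk q) 2 (volume.restrict (Icc (0 : ℝ) T)) :=
    (memLp_congr_ae hq.1.ae_eq_mk).1 hq
  have hq2 : MemLp q₀ 2 := (memLp_indicator_iff_restrict measurableSet_Icc).2 hmk
  have hqi : Integrable q₀ := (integrable_indicator_iff measurableSet_Icc).2
    (hmk.integrable (by norm_num))
  obtain ⟨w, hw, huniq, hwc, ⟨C, hC⟩, hker⟩ := exists_goursatKernel hT.le hqq hqi hq0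
  refine ⟨w, hw, huniq, ?_⟩
  have hwc' : Continuous (Function.uncurry fun x t => matrixCLM n (w x t)) :=
    (matrixCLM n).continuous.comp hwc
  have hC' : ∀ x t, ‖matrixCLM n (w x t)‖ ≤ ‖matrixCLM n‖ * C := fun x t =>
    ((matrixCLM n).le_opNorm _).trans (mul_le_mul_of_nonneg_left (hC x t) (norm_nonneg _))
  refine ⟨controlL2 T hwc' hC', fun f => ?_, exists_h2_equiv (bijective_controlL2 hT.le hwc' hC')
    (mem_range_h2Embed_controlL2 (q := fun s => matrixCLM n (q₀ s)) hT
      ((matrixCLM n).continuous.comp_stronglyMeasurable hqm)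
      ((matrixCLM n).integrable_comp hqi) ((matrixCLM n).comp_memLp' hq2)
      (fun y hy => by simp only [hq0 y hy, map_zero]) hwc' hC'
      fun x t h => matrixCLM_goursat_eq hqi hq0 hwc hC h (hker x t h))⟩
  filter_upwards [Lp.coeFn_add (reflectL2 T n f) (volterraL2 T hwc' hC' (reflectL2 T n f)),
    reflectL2_ae f, volterraL2_reflectL2_ae hwc' hC' (f := f) (F := f)
    (Filter.Eventually.of_forall fun _ => rfl), ae_restrict_mem measurableSet_Icc]
    with x h1 h2 h3 hx
  rw [controlL2_apply, h1, Pi.add_apply, h2, h3, wave_eq w f hx.2]
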